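/- Let $F$ be a field of characteristic zero, let $0\neq x\in F$ and let $n\ge 0$. A diagram is a graph on $n$ top vertices and $n$ bottom vertices in which each vertex has degree at most one; its edges are called arcs, an arc is vertical if it joins a top vertex to a bottom vertex and horizontal otherwise. For diagrams $\mathfrak a,\mathfrak b$ place $\mathfrak a$ on top of $\mathfrak b$, identify the bottom vertices of $\mathfrak a$ with the top vertices of $\mathfrak b$, let $\ell$ be the number of connected components of the resulting graph that contain no vertex of the outer two rows, and put $\mathfrak a\cdot\mathfrak b=x^{\ell}\,\mathfrak c$, where $\mathfrak c$ is the diagram on the outer rows in which two distinct vertices are joined if and only if they are connected in the stacked graph. Let $\mathbb A_n$ be the $F$-algebra with basis all diagrams and this multiplication, let $\mathbb L_n$ be its subalgebra spanned by the diagrams without horizontal arcs, and let $\mathbb X_n$ be either $\mathbb A_n$ or $\mathbb L_n$. For $0\le m\le n$ let $\mathbb X_n^m$ be the two-sided ideal of $\mathbb X_n$ generated by the diagrams of $\mathbb X_n$ with at most $m$ vertical arcs, let $\mathbb X_n^{-1}=0$, and let $\mathbb I_n^m=\mathbb X_n^m/\mathbb X_n^{m-1}$. For a partition $\nu$ with $|\nu|=m\le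 n$ let $\mathfrak u$ be the diagram in which the $i$-th top vertex is joined to the $i$-th bottom vertex for $1\le i\le m$ and all other vertices are isolated, let $S^\nu$ be the Specht module of the symmetric group $S_m$ over $F$, and put $$M(\nu)=\mathbb I_n^m\,\mathfrak u\otimes_{F[S_m]}S^\nu,\qquad N(\nu)=\{w\in M(\nu)\mid \mathbb I_n^m\,w=0\},$$ where $S_m$ acts on $\mathbb I_n^m\mathfrak u$ from the right by permuting the first $m$ bottom vertices, and $\mathbb X_n$ acts on $M(\nu)$ by $\mathfrak b\,(\mathfrak a\otimes v)=(\mathfrak b\mathfrak a)\otimes v$. If $\mathbb X_n$ is not semisimple, then there are partitions $\mu,\lambda$ with $|\mu|<|\lambda|\le n$ and a nonzero homomorphism of $\mathbb X_n$-modules $\varphi\colon M(\lambda)\to M(\mu)$ with $\ker\varphi=N(\lambda)$; that is, there is an exact sequence of $\mathbb X_n$-modules $$0\longrightarrow N(\lambda)\longrightarrow M(\lambda)\stackrel{\varphi}{\longrightarrow}M(\mu)$$ with $\varphi\neq 0$. -/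

import Mathlib

/-! ### Composition of set partitions placed on top of each other -/

namespace DiagramAlgebra

/-- The number of blocks of `S` that contain no point of the form `f p`. -/
noncomputable def missing {O X : Type*} (S : Setoid X) (f : O → X) : ℕ :=
  Set.ncard {C : Set X | C ∈ S.classes ∧ ∀ p, f p ∉ C}

/-- The inclusion of the outer rows `T` (top) and `N` (bottom) into the three rows
`T`, `M`, `N`. -/
def outer {T M N : Type*} : T ⊕ N → T ⊕ (M ⊕ N) := Sum.map id Sum.inr

/-- The connected components of the graph on the three rows `T`, `M`, `N` obtained by placing
`a` (with rows `T`, `M`) on top of `b` (with rows `M`, `N`) and identifying the bottom row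
of `a` with the top row of `b`. -/
def glue {T M N : Type*} (a : Setoid (T ⊕ M)) (b : Setoid (M ⊕ N)) :
    Setoid (T ⊕ (M ⊕ N)) :=
  a.map (Sum.map id Sum.inl) ⊔ b.map Sum.inr

/-- Two outer vertices are connected in the product iff they are connected in the
stacked graph. -/
def comp {T M N : Type*} (a : Setoid (T ⊕ M)) (b : Setoid (M ⊕ N)) : Setoid (T ⊕ N) :=
  (glue a b).comap outer

/-- The number of components of the stacked graph that contain no outer vertex. -/
noncomputable def innerComponents {T M N : Type*} (a : Setoid (T ⊕ M)) (b : Setoid (M ⊕ N)) : ℕ :=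
  missing (glue a b) outer

/-- All arcs straight: the top vertex `i` is joined to the bottom vertex `i`. -/
def straight (T : Type*) : Setoid (T ⊕ T) := Setoid.ker (Sum.elim id id)

section lemmas

theorem map_le_iff {X Y : Type*} {r : Setoid X} {f : X → Y} {s : Setoid Y} :
    r.map f ≤ s ↔ r ≤ s.comap f := by
  constructor
  · intro h x y hxy
    exact h (Relation.EqvGen.rel _ _ ⟨x, y, hxy, rfl, rfl⟩)
  · intro h x y hxy
    induction hxy with
    | rel _ _ h' => obtain ⟨a, b, hab, rfl, rfl⟩ := h'; exact h hab
    | refl _ => exact s.refl _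
    | symm _ _ _ ih => exact s.symm ih
    | trans _ _ _ _ _ ih1 ih2 => exact s.trans ih1 ih2

theorem map_intro {X Y : Type*} {r : Setoid X} (f : X → Y) {x y : X} (h : r x y) :
    r.map f (f x) (f y) := map_le_iff.1 le_rfl h

theorem map_sup' {X Y : Type*} (r s : Setoid X) (f : X → Y) :
    (r ⊔ s).map f = r.map f ⊔ s.map f := by
  apply eq_of_forall_ge_iff
  intro c
  rw [sup_le_iff, map_le_iff, map_le_iff, map_le_iff, sup_le_iff]

theorem map_map' {X Y Z : Type*} (r : Setoid X) (f : X → Y) (g : Y → Z) :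
    (r.map f).map g = r.map (g ∘ f) := by
  apply eq_of_forall_ge_iff
  intro c
  rw [map_le_iff, map_le_iff, map_le_iff]
  rfl

theorem map_iff {X Y : Type*} {r : Setoid X} {f : X → Y} (hf : Function.Injective f) {y z : Y} :
    r.map f y z ↔ y = z ∨ ∃ u v, r u v ∧ f u = y ∧ f v = z := by
  let s : Setoid Y :=
    { r := fun y z => y = z ∨ ∃ u v, r u v ∧ f u = y ∧ f v = z
      iseqv :=
        { refl := fun _ => Or.inl rfl
          symm := by
            rintro y z (rfl | ⟨u, v, h, rfl, rfl⟩)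
            · exact Or.inl rfl
            · exact Or.inr ⟨v, u, r.symm h, rfl, rfl⟩
          trans := by
            rintro y z w (rfl | ⟨u, v, h, rfl, rfl⟩) (rfl | ⟨u', v', h', h1, rfl⟩)
            · exact Or.inl rfl
            · exact Or.inr ⟨u', v', h', h1, rfl⟩
            · exact Or.inr ⟨u, v, h, rfl, rfl⟩
            · rw [hf h1] at h'
              exact Or.inr ⟨u, v', r.trans h h', rfl, rfl⟩ } }
  constructor
  · intro h
    have : r.map f ≤ s := map_le_iff.2 fun u v h => Or.inr ⟨u, v, h, rfl, rfl⟩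
    exact this h
  · rintro (rfl | ⟨u, v, h, rfl, rfl⟩)
    · exact Setoid.refl' _ _
    · exact map_intro f h

/-- The relation generated by `S` and a relation `R` on a subset which contains the restriction
of `S`. -/
def thicken {O X : Type*} (S : Setoid X) (f : O → X) (R : Setoid O) (h : S.comap f ≤ R) :
    Setoid X where
  r y z := S y z ∨ ∃ p q, S y (f p) ∧ R p q ∧ S (f q) z
  iseqv :=
    { refl := fun y => Or.inl (S.refl y)
      symm := by
        rintro y z (h1 | ⟨p, q, h1, h2, h3⟩)
        · exact Or.inl (S.symm h1)
        · exact Or.inr ⟨q, p, S.symm h3, R.symm h2, S.symm h1⟩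
      trans := by
        rintro y z w (h1 | ⟨p, q, h1, h2, h3⟩) (h4 | ⟨p', q', h4, h5, h6⟩)
        · exact Or.inl (S.trans h1 h4)
        · exact Or.inr ⟨p', q', S.trans h1 h4, h5, h6⟩
        · exact Or.inr ⟨p, q, h1, h2, S.trans h3 h4⟩
        · have : R q p' := h (show S (f q) (f p') from S.trans h3 h4)
          exact Or.inr ⟨p, q', h1, R.trans h2 (R.trans this h5), h6⟩ }

theorem sup_map_eq {O X : Type*} (S : Setoid X) (f : O → X) (T : Setoid O) :
    S ⊔ T.map f = thicken S f (S.comap f ⊔ T) le_sup_left := by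
  apply le_antisymm
  · refine sup_le (fun y z h => Or.inl h) (map_le_iff.2 fun p q h => ?_)
    exact Or.inr ⟨p, q, S.refl _, (le_sup_right : T ≤ S.comap f ⊔ T) h, S.refl _⟩
  · have key : S.comap f ⊔ T ≤ (S ⊔ T.map f).comap f :=
      sup_le (fun p q h => (le_sup_left : S ≤ S ⊔ T.map f) h)
        (map_le_iff.1 le_sup_right)
    have hS : S ≤ S ⊔ T.map f := le_sup_left
    rintro y z (h | ⟨p, q, h1, h2, h3⟩)
    · exact hS h
    · exact Setoid.trans' _ (hS h1) (Setoid.trans' _ (key h2) (hS h3))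

theorem comap_sup_map {O X : Type*} (S : Setoid X) (f : O → X) (T : Setoid O) :
    (S ⊔ T.map f).comap f = S.comap f ⊔ T := by
  rw [sup_map_eq]
  apply le_antisymm
  · rintro p q (h | ⟨p', q', h1, h2, h3⟩)
    · exact (le_sup_left : S.comap f ≤ S.comap f ⊔ T) h
    · have h1' : (S.comap f ⊔ T) p p' := (le_sup_left : S.comap f ≤ S.comap f ⊔ T) h1
      have h3' : (S.comap f ⊔ T) q' q := (le_sup_left : S.comap f ≤ S.comap f ⊔ T) h3
      exact Setoid.trans' _ h1' (Setoid.trans' _ h2 h3')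
  · intro p q h
    exact Or.inr ⟨p, q, S.refl _, h, S.refl _⟩

theorem missing_sup_map {O X : Type*} (S : Setoid X) (f : O → X) (T : Setoid O) :
    missing (S ⊔ T.map f) f = missing S f := by
  rw [sup_map_eq]
  unfold missing
  congr 1
  ext C
  constructor
  · rintro ⟨⟨y, rfl⟩, h⟩
    refine ⟨⟨y, ?_⟩, h⟩
    ext z
    constructor
    · rintro (h1 | ⟨p, q, h1, h2, h3⟩)
      · exact h1
      · exact absurd (Or.inr ⟨q, q, S.refl _, Setoid.refl' _ _, h3⟩) (h q)
    · exact Or.inl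
  · rintro ⟨⟨y, rfl⟩, h⟩
    refine ⟨⟨y, ?_⟩, h⟩
    ext z
    constructor
    · exact Or.inl
    · rintro (h1 | ⟨p, q, h1, h2, h3⟩)
      · exact h1
      · exact absurd h3 (h q)

theorem missing_comp {P O X : Type*} [Finite X] (S : Setoid X) (f : O → X) (g : P → O) :
    missing S (f ∘ g) = missing S f + missing (S.comap f) g := by
  unfold missing
  have h1 : {C : Set X | C ∈ S.classes ∧ ∀ p, (f ∘ g) p ∉ C} =
      {C : Set X | C ∈ S.classes ∧ ∀ p, f p ∉ C} ∪
      {C : Set X | C ∈ S.classes ∧ (∀ p, f (g p) ∉ C) ∧ ∃ p, f p ∈ C} := by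
    ext C
    simp only [Set.mem_ofPred_eq, Set.mem_union, Function.comp]
    constructor
    · rintro ⟨h, h'⟩
      by_cases h2 : ∃ p, f p ∈ C
      · exact Or.inr ⟨h, h', h2⟩
      · exact Or.inl ⟨h, fun p hp => h2 ⟨p, hp⟩⟩
    · rintro (⟨h, h'⟩ | ⟨h, h', -⟩)
      · exact ⟨h, fun p => h' _⟩
      · exact ⟨h, h'⟩
  have h2 : {C : Set O | C ∈ (S.comap f).classes ∧ ∀ p, g p ∉ C} =
      (fun C => f ⁻¹' C) ''
      {C : Set X | C ∈ S.classes ∧ (∀ p, f (g p) ∉ C) ∧ ∃ p, f p ∈ C} := by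
    ext D
    constructor
    · rintro ⟨⟨y, rfl⟩, h⟩
      exact ⟨{x | S x (f y)}, ⟨⟨f y, rfl⟩, h, y, S.refl _⟩, rfl⟩
    · rintro ⟨_, ⟨⟨y, rfl⟩, h, q, hq⟩, rfl⟩
      refine ⟨⟨q, ?_⟩, h⟩
      ext p
      exact ⟨fun hp => S.trans hp (S.symm hq), fun hp => S.trans hp hq⟩
  rw [h1, h2, Set.ncard_union_eq, Set.InjOn.ncard_image]
  · rintro _ ⟨⟨y, rfl⟩, -, q, hq⟩ _ ⟨⟨z, rfl⟩, -, -⟩ h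
    have hz : S (f q) z := (Set.ext_iff.1 h q).1 hq
    have hq : S (f q) y := hq
    have hyz : S y z := S.trans (S.symm hq) hz
    ext x
    exact ⟨fun hx => S.trans hx hyz, fun hx => S.trans hx (S.symm hyz)⟩
  · rw [Set.disjoint_left]
    rintro C ⟨-, h⟩ ⟨-, -, p, hp⟩
    exact h p hp

/-- A square of inclusions in which `P` is the intersection of `Y` and `O` and in which `Y` and `O`
cover `X`. -/
structure Square {P Y O X : Type*} (g : P → Y) (h : P → O) (j : Y → X) (f : O → X) : Prop where
  inj_j : Function.Injective j
  inj_f : Function.Injective f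
  comm : ∀ p, j (g p) = f (h p)
  pull : ∀ u p, j u = f p → ∃ o, g o = u ∧ h o = p
  cover : ∀ x, (∃ u, j u = x) ∨ ∃ p, f p = x

theorem Square.comap_map {P Y O X : Type*} {g : P → Y} {h : P → O} {j : Y → X} {f : O → X}
    (sq : Square g h j f) (S : Setoid Y) : (S.map j).comap f = (S.comap g).map h := by
  apply le_antisymm
  · intro p q hpq
    rcases (map_iff sq.inj_j).1 (show S.map j (f p) (f q) from hpq) with e | ⟨u, v, huv, hu, hv⟩
    · rw [sq.inj_f e]
    · obtain ⟨o, rfl, rfl⟩ := sq.pull _ _ hu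
      obtain ⟨o', rfl, rfl⟩ := sq.pull _ _ hv
      exact map_intro h (show S.comap g o o' from huv)
  · refine map_le_iff.2 fun o o' hoo => ?_
    show S.map j (f (h o)) (f (h o'))
    rw [← sq.comm, ← sq.comm]
    exact map_intro j hoo

theorem Square.missing_map {P Y O X : Type*} {g : P → Y} {h : P → O} {j : Y → X} {f : O → X}
    (sq : Square g h j f) (S : Setoid Y) : missing (S.map j) f = missing S g := by
  unfold missing
  have cls : ∀ u, {x | S.map j x (j u)} = j '' {x | S x u} := by
    intro u
    ext x
    constructor
    · intro hx
      rcases (map_iff sq.inj_j).1 hx with rfl | ⟨a, b, hab, rfl, hb⟩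
      · exact ⟨u, S.refl _, rfl⟩
      · rw [sq.inj_j hb] at hab
        exact ⟨a, hab, rfl⟩
    · rintro ⟨a, ha, rfl⟩
      exact map_intro j ha
  have : {C : Set X | C ∈ (S.map j).classes ∧ ∀ p, f p ∉ C} =
      (fun C => j '' C) '' {C : Set Y | C ∈ S.classes ∧ ∀ p, g p ∉ C} := by
    ext C
    constructor
    · rintro ⟨⟨y, rfl⟩, hC⟩
      rcases sq.cover y with ⟨u, rfl⟩ | ⟨p, rfl⟩
      · rw [cls] at hC ⊢
        refine ⟨_, ⟨⟨u, rfl⟩, fun p hp => hC (h p) ?_⟩, rfl⟩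
        rw [← sq.comm]
        exact ⟨_, hp, rfl⟩
      · exact absurd ((S.map j).refl (f p)) (hC p)
    · rintro ⟨_, ⟨⟨u, rfl⟩, hC⟩, rfl⟩
      refine ⟨⟨j u, (cls u).symm⟩, ?_⟩
      rintro p ⟨a, ha, hp⟩
      obtain ⟨o, rfl, rfl⟩ := sq.pull _ _ hp
      exact hC o ha
  rw [this, Set.ncard_image_of_injective _ (Set.image_injective.2 sq.inj_j)]

section assoc

variable {T M N B : Type*}

theorem square_left : Square (outer : T ⊕ N → T ⊕ (M ⊕ N))
    (Sum.map id Sum.inl : T ⊕ N → T ⊕ (N ⊕ B))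
    (Sum.map id (Sum.map id Sum.inl) : T ⊕ (M ⊕ N) → T ⊕ (M ⊕ (N ⊕ B)))
    (outer : T ⊕ (N ⊕ B) → T ⊕ (M ⊕ (N ⊕ B))) where
  inj_j := by
    rintro (x | x | x) (y | y | y) <;> simp
  inj_f := by
    rintro (x | x | x) (y | y | y) <;> simp [outer]
  comm := by
    rintro (x | x) <;> simp [outer]
  pull := by
    rintro (x | x | x) (y | y | y) <;> simp [outer, eq_comm]
  cover := by
    rintro (x | x | x | x) <;> simp [outer]

theorem square_right : Square (outer : M ⊕ B → M ⊕ (N ⊕ B))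
    (Sum.inr : M ⊕ B → T ⊕ (M ⊕ B))
    (Sum.inr : M ⊕ (N ⊕ B) → T ⊕ (M ⊕ (N ⊕ B)))
    (Sum.map id outer : T ⊕ (M ⊕ B) → T ⊕ (M ⊕ (N ⊕ B))) where
  inj_j := Sum.inr_injective
  inj_f := by
    rintro (x | x | x) (y | y | y) <;> simp [outer]
  comm := by
    rintro (x | x) <;> simp [outer]
  pull := by
    rintro (x | x | x) (y | y | y) <;> simp [outer, eq_comm]
  cover := by
    rintro (x | x | x | x) <;> simp [outer]

/-- The components of the stack of three partitions. -/
def glue₃ (a : Setoid (T ⊕ M)) (b : Setoid (M ⊕ N)) (c : Setoid (N ⊕ B)) :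
    Setoid (T ⊕ (M ⊕ (N ⊕ B))) :=
  a.map (Sum.map id Sum.inl) ⊔ (b.map (Sum.inr ∘ Sum.map id Sum.inl) ⊔
    c.map (Sum.inr ∘ Sum.inr))

theorem glue₃_left (a : Setoid (T ⊕ M)) (b : Setoid (M ⊕ N)) (c : Setoid (N ⊕ B)) :
    glue₃ a b c = (glue a b).map (Sum.map id (Sum.map id Sum.inl)) ⊔
      (c.map (Sum.inr : N ⊕ B → T ⊕ (N ⊕ B))).map outer := by
  unfold glue₃ glue
  rw [map_sup', map_map', map_map', map_map', sup_assoc]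
  congr 2
  funext x
  rcases x with x | x <;> rfl

theorem glue₃_right (a : Setoid (T ⊕ M)) (b : Setoid (M ⊕ N)) (c : Setoid (N ⊕ B)) :
    glue₃ a b c = (glue b c).map Sum.inr ⊔
      (a.map (Sum.map id Sum.inl : T ⊕ M → T ⊕ (M ⊕ B))).map (Sum.map id outer) := by
  unfold glue₃ glue
  rw [map_sup', map_map', map_map', map_map', sup_comm]
  congr 2
  funext x
  rcases x with x | x <;> rfl

theorem comap_glue₃_left (a : Setoid (T ⊕ M)) (b : Setoid (M ⊕ N)) (c : Setoid (N ⊕ B)) :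
    (glue₃ a b c).comap outer = glue (comp a b) c := by
  rw [glue₃_left, comap_sup_map, square_left.comap_map]
  rfl

theorem comap_glue₃_right (a : Setoid (T ⊕ M)) (b : Setoid (M ⊕ N)) (c : Setoid (N ⊕ B)) :
    (glue₃ a b c).comap (Sum.map id outer) = glue a (comp b c) := by
  rw [glue₃_right, comap_sup_map, square_right.comap_map, sup_comm]
  rfl

theorem outer_outer : (outer ∘ outer : T ⊕ B → T ⊕ (M ⊕ (N ⊕ B))) = Sum.map id outer ∘ outer := by
  funext x
  rcases x with x | x <;> rfl

theorem comp_assoc (a : Setoid (T ⊕ M)) (b : Setoid (M ⊕ N)) (c : Setoid (N ⊕ B)) :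
    comp (comp a b) c = comp a (comp b c) := by
  have h1 : comp (comp a b) c = (glue₃ a b c).comap (outer ∘ outer) := by
    rw [comp, ← comap_glue₃_left]
    rfl
  have h2 : comp a (comp b c) = (glue₃ a b c).comap (Sum.map id outer ∘ outer) := by
    rw [comp, ← comap_glue₃_right]
    rfl
  rw [h1, h2, outer_outer]

theorem innerComponents_assoc [Finite T] [Finite M] [Finite N] [Finite B]
    (a : Setoid (T ⊕ M)) (b : Setoid (M ⊕ N)) (c : Setoid (N ⊕ B)) :
    innerComponents a b + innerComponents (comp a b) c = innerComponents b c + innerComponents a (comp b c) := by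
  have h1 : missing (glue₃ a b c) (outer ∘ outer) = innerComponents a b + innerComponents (comp a b) c := by
    rw [missing_comp, comap_glue₃_left, glue₃_left, missing_sup_map, square_left.missing_map]
    rfl
  have h2 : missing (glue₃ a b c) (Sum.map id outer ∘ outer) =
      innerComponents b c + innerComponents a (comp b c) := by
    rw [missing_comp, comap_glue₃_right, glue₃_right, missing_sup_map, square_right.missing_map]
    rfl
  rw [← h1, ← h2, outer_outer]

theorem glue_straight_left (a : Setoid (T ⊕ N)) :
    glue (straight T) a = a.comap (Sum.elim Sum.inl id) := by
  apply le_antisymm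
  · refine sup_le (map_le_iff.2 ?_) (map_le_iff.2 fun p q h => h)
    rintro (p | p) (q | q) (h : p = q) <;> subst h <;> exact Setoid.refl' _ _
  · have key : ∀ y : T ⊕ (T ⊕ N), glue (straight T) a y (Sum.inr (Sum.elim Sum.inl id y)) := by
      rintro (y | y)
      · exact (le_sup_left : _ ≤ glue (straight T) a) (map_intro (r := straight T)
          (Sum.map id Sum.inl) (show straight T (Sum.inl y) (Sum.inr y) from rfl))
      · exact Setoid.refl' _ _
    intro y z h
    exact Setoid.trans' _ (key y) (Setoid.trans' _
      ((le_sup_right : _ ≤ glue (straight T) a) (map_intro Sum.inr h)) (Setoid.symm' _ (key z)))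

theorem straight_comp (a : Setoid (T ⊕ N)) : comp (straight T) a = a := by
  unfold comp
  rw [glue_straight_left]
  ext (p | p) (q | q) <;> rfl

theorem innerComponents_straight_left (a : Setoid (T ⊕ N)) : innerComponents (straight T) a = 0 := by
  unfold innerComponents missing
  rw [glue_straight_left]
  refine (congrArg Set.ncard ?_).trans (Set.ncard_empty _)
  rw [Set.eq_empty_iff_forall_notMem]
  rintro _ ⟨⟨y, rfl⟩, h⟩
  rcases y with y | y | y
  · exact h (Sum.inl y) (a.refl _)
  · exact h (Sum.inl y) (a.refl _)
  · exact h (Sum.inr y) (a.refl _)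

theorem glue_straight_right (a : Setoid (T ⊕ N)) :
    glue a (straight N) = a.comap (Sum.map id (Sum.elim id id)) := by
  apply le_antisymm
  · refine sup_le (map_le_iff.2 ?_) (map_le_iff.2 ?_)
    · rintro (p | p) (q | q) h <;> exact h
    · rintro (p | p) (q | q) (h : p = q) <;> subst h <;> exact Setoid.refl' _ _
  · have key : ∀ y : T ⊕ (N ⊕ N), glue a (straight N) y
        (Sum.map id Sum.inl (Sum.map id (Sum.elim id id) y : T ⊕ N)) := by
      rintro (y | y | y)
      · exact Setoid.refl' _ _
      · exact Setoid.refl' _ _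
      · exact (le_sup_right : _ ≤ glue a (straight N)) (map_intro (r := straight N)
          Sum.inr (show straight N (Sum.inr y) (Sum.inl y) from rfl))
    intro y z h
    exact Setoid.trans' _ (key y) (Setoid.trans' _
      ((le_sup_left : _ ≤ glue a (straight N)) (map_intro (Sum.map id Sum.inl) h))
      (Setoid.symm' _ (key z)))

theorem comp_straight (a : Setoid (T ⊕ N)) : comp a (straight N) = a := by
  unfold comp
  rw [glue_straight_right]
  ext (p | p) (q | q) <;> rfl

theorem innerComponents_straight_right (a : Setoid (T ⊕ N)) : innerComponents a (straight N) = 0 := by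
  unfold innerComponents missing
  rw [glue_straight_right]
  refine (congrArg Set.ncard ?_).trans (Set.ncard_empty _)
  rw [Set.eq_empty_iff_forall_notMem]
  rintro _ ⟨⟨y, rfl⟩, h⟩
  rcases y with y | y | y
  · exact h (Sum.inl y) (a.refl _)
  · exact h (Sum.inr y) (a.refl _)
  · exact h (Sum.inr y) (a.refl _)

end assoc

end lemmas

/-! ### The partition algebra -/

/-- The partition algebra over `F` with parameter `x`: the vector space with basis the set
partitions of the `n` top vertices `Sum.inl i` and the `n` bottom vertices `Sum.inr i`. -/
def PartitionAlgebra {F : Type*} [Field F] (n : ℕ) (_x : F) : Type _ :=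
  Setoid (Fin n ⊕ Fin n) →₀ F

namespace PartitionAlgebra

variable {F : Type*} [Field F] {n : ℕ} {x : F}

noncomputable instance : AddCommGroup (PartitionAlgebra n x) :=
  inferInstanceAs (AddCommGroup (Setoid (Fin n ⊕ Fin n) →₀ F))

noncomputable instance : Module F (PartitionAlgebra n x) :=
  inferInstanceAs (Module F (Setoid (Fin n ⊕ Fin n) →₀ F))

/-- The basis vector of a set partition. -/
noncomputable def of (x : F) (d : Setoid (Fin n ⊕ Fin n)) : PartitionAlgebra n x :=
  Finsupp.single d 1

/-- The bilinear extension of `a · b = x ^ (innerComponents a b) • comp a b`. -/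
noncomputable def mulBilin (n : ℕ) (x : F) :
    PartitionAlgebra n x →ₗ[F] PartitionAlgebra n x →ₗ[F] PartitionAlgebra n x :=
  Finsupp.linearCombination F fun a : Setoid (Fin n ⊕ Fin n) =>
    (Finsupp.linearCombination F fun b : Setoid (Fin n ⊕ Fin n) =>
      x ^ innerComponents a b • of x (comp a b) : PartitionAlgebra n x →ₗ[F] PartitionAlgebra n x)

noncomputable instance : Mul (PartitionAlgebra n x) := ⟨fun f g => mulBilin n x f g⟩

noncomputable instance : One (PartitionAlgebra n x) := ⟨of x (straight (Fin n))⟩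

theorem mul_eq (f g : PartitionAlgebra n x) : f * g = mulBilin n x f g := rfl

theorem one_eq : (1 : PartitionAlgebra n x) = of x (straight (Fin n)) := rfl

theorem of_mul_of (a b : Setoid (Fin n ⊕ Fin n)) :
    of x a * of x b = x ^ innerComponents a b • of x (comp a b) := by
  rw [mul_eq]
  unfold mulBilin of
  erw [Finsupp.linearCombination_single, one_smul, Finsupp.linearCombination_single, one_smul]

theorem induct {p : PartitionAlgebra n x → Prop} (f : PartitionAlgebra n x)
    (zero : p 0) (add : ∀ f g, p f → p g → p (f + g)) (smul : ∀ (r : F) d, p (r • of x d)) :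
    p f := by
  refine Finsupp.induction_linear (motive := p) f zero add fun d r => ?_
  have : (Finsupp.single d r : PartitionAlgebra n x) = r • of x d := by
    unfold of
    erw [Finsupp.smul_single, smul_eq_mul, mul_one]
  rw [this]
  exact smul r d

theorem add_mul' (f g h : PartitionAlgebra n x) : (f + g) * h = f * h + g * h := by
  simp only [mul_eq, map_add, LinearMap.add_apply]

theorem mul_add' (f g h : PartitionAlgebra n x) : f * (g + h) = f * g + f * h := by
  simp only [mul_eq, map_add]

theorem zero_mul' (f : PartitionAlgebra n x) : 0 * f = 0 := by
  simp only [mul_eq, map_zero, LinearMap.zero_apply]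

theorem mul_zero' (f : PartitionAlgebra n x) : f * 0 = 0 := by
  simp only [mul_eq, map_zero]

theorem smul_mul' (r : F) (f g : PartitionAlgebra n x) : (r • f) * g = r • (f * g) := by
  simp only [mul_eq, map_smul, LinearMap.smul_apply]

theorem mul_smul' (r : F) (f g : PartitionAlgebra n x) : f * (r • g) = r • (f * g) := by
  simp only [mul_eq, map_smul]

theorem mul_assoc' (f g h : PartitionAlgebra n x) : f * g * h = f * (g * h) := by
  induction f using induct with
  | zero => simp only [zero_mul']
  | add f₁ f₂ h₁ h₂ => simp only [add_mul', h₁, h₂]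
  | smul r a =>
    induction g using induct with
    | zero => simp only [zero_mul', mul_zero']
    | add g₁ g₂ h₁ h₂ => simp only [add_mul', mul_add', h₁, h₂]
    | smul s b =>
      induction h using induct with
      | zero => simp only [mul_zero']
      | add k₁ k₂ h₁ h₂ => simp only [mul_add', h₁, h₂]
      | smul t c =>
        simp only [smul_mul', mul_smul', of_mul_of]
        rw [comp_assoc]
        simp only [smul_smul]
        congr 1
        have := congrArg (x ^ ·) (innerComponents_assoc a b c)
        simp only [pow_add] at this
        linear_combination (r * s * t) * this

theorem one_mul' (f : PartitionAlgebra n x) : 1 * f = f := by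
  induction f using induct with
  | zero => exact mul_zero' _
  | add f₁ f₂ h₁ h₂ => rw [mul_add', h₁, h₂]
  | smul r a => rw [mul_smul', one_eq, of_mul_of, straight_comp, innerComponents_straight_left, pow_zero,
      one_smul]

theorem mul_one' (f : PartitionAlgebra n x) : f * 1 = f := by
  induction f using induct with
  | zero => exact zero_mul' _
  | add f₁ f₂ h₁ h₂ => rw [add_mul', h₁, h₂]
  | smul r a => rw [smul_mul', one_eq, of_mul_of, comp_straight, innerComponents_straight_right, pow_zero,
      one_smul]

noncomputable instance : Ring (PartitionAlgebra n x) :=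
  { (inferInstance : AddCommGroup (PartitionAlgebra n x)) with
    mul := (· * ·)
    one := 1
    left_distrib := mul_add'
    right_distrib := add_mul'
    zero_mul := zero_mul'
    mul_zero := mul_zero'
    mul_assoc := mul_assoc'
    one_mul := one_mul'
    mul_one := mul_one' }

noncomputable instance : Algebra F (PartitionAlgebra n x) :=
  Algebra.ofModule smul_mul' mul_smul'

end PartitionAlgebra

/-! ### Diagrams and the algebras they span -/

/-- The partitions into blocks with at most two elements. A block with two elements is an arc,
a block with one element is an isolated vertex, which carries a loop. -/
def IsPartialOneFactor {V : Type*} (d : Setoid V) : Prop :=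
  ∀ p q r, d p q → d p r → p = q ∨ p = r ∨ q = r

/-- No arc joins two different vertices of the same row. -/
def NoHorizontalArc {T B : Type*} (d : Setoid (T ⊕ B)) : Prop :=
  (∀ i j, d (Sum.inl i) (Sum.inl j) → i = j) ∧ (∀ i j, d (Sum.inr i) (Sum.inr j) → i = j)

/-- The two families of algebras: spanned by all diagrams, or by the diagrams without
horizontal arcs. -/
inductive Kind where
  /-- All diagrams. -/
  | A
  /-- The diagrams without horizontal arcs. -/
  | L

/-- The diagrams on two rows of `n` vertices: all partial 1-factors, or those without horizontal
arcs. -/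
def diagrams (k : Kind) (n : ℕ) : Set (Setoid (Fin n ⊕ Fin n)) :=
  match k with
  | Kind.A => {d | IsPartialOneFactor d}
  | Kind.L => {d | IsPartialOneFactor d ∧ NoHorizontalArc d}

theorem isPartialOneFactor_of_mem {k : Kind} {n : ℕ} {d : Setoid (Fin n ⊕ Fin n)}
    (h : d ∈ diagrams k n) : IsPartialOneFactor d := by
  cases k
  · exact h
  · exact h.1

theorem mem_diagrams {k : Kind} {n : ℕ} {d : Setoid (Fin n ⊕ Fin n)}
    (h : IsPartialOneFactor d) (h' : NoHorizontalArc d) : d ∈ diagrams k n := by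
  cases k
  · exact h
  · exact ⟨h, h'⟩

section closure

variable {T M N : Type*}

theorem NoHorizontalArc.comp {a : Setoid (T ⊕ M)} {b : Setoid (M ⊕ N)}
    (ha : NoHorizontalArc a) (hb : NoHorizontalArc b) : NoHorizontalArc (comp a b) := by
  constructor
  · intro i i' h
    let P : T ⊕ (M ⊕ N) → Prop := Sum.elim (fun t => t = i) (Sum.elim
      (fun m => a (Sum.inl i) (Sum.inr m))
      (fun k => ∃ m, a (Sum.inl i) (Sum.inr m) ∧ b (Sum.inl m) (Sum.inr k)))
    have key : glue a b ≤ Setoid.ker P := by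
      refine sup_le (map_le_iff.2 ?_) (map_le_iff.2 ?_)
      · have : ∀ p q, a p q → P (Sum.map id Sum.inl p) → P (Sum.map id Sum.inl q) := by
          rintro (p | p) (q | q) hpq hp
          · have hp : p = i := hp
            subst hp
            exact (ha.1 _ _ hpq).symm
          · have hp : p = i := hp
            subst hp
            exact hpq
          · have hp : a (Sum.inl i) (Sum.inr p) := hp
            exact (ha.1 _ _ (a.trans hp hpq)).symm
          · have hp : a (Sum.inl i) (Sum.inr p) := hp
            exact a.trans hp hpq
        exact fun p q h => propext ⟨this p q h, this q p (a.symm h)⟩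
      · have : ∀ p q, b p q → P (Sum.inr p) → P (Sum.inr q) := by
          rintro (p | p) (q | q) hpq hp
          · rw [← hb.1 _ _ hpq]
            exact hp
          · exact ⟨p, hp, hpq⟩
          · obtain ⟨m, hm, hmp⟩ := hp
            rw [← hb.1 _ _ (b.trans hmp hpq)]
            exact hm
          · rw [← hb.2 _ _ hpq]
            exact hp
        exact fun p q h => propext ⟨this p q h, this q p (b.symm h)⟩
    have h1 : P (Sum.inl i) = P (Sum.inl i') := key h
    have h2 : P (Sum.inl i') := h1 ▸ (rfl : i = i)
    exact Eq.symm h2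
  · intro i i' h
    let P : T ⊕ (M ⊕ N) → Prop := Sum.elim
      (fun t => ∃ m, b (Sum.inl m) (Sum.inr i) ∧ a (Sum.inl t) (Sum.inr m)) (Sum.elim
      (fun m => b (Sum.inl m) (Sum.inr i)) (fun k => k = i))
    have key : glue a b ≤ Setoid.ker P := by
      refine sup_le (map_le_iff.2 ?_) (map_le_iff.2 ?_)
      · have : ∀ p q, a p q → P (Sum.map id Sum.inl p) → P (Sum.map id Sum.inl q) := by
          rintro (p | p) (q | q) hpq hp
          · rw [← ha.1 _ _ hpq]
            exact hp
          · obtain ⟨m, hm, hmp⟩ := hp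
            have e := ha.2 _ _ (a.trans (a.symm hmp) hpq)
            subst e
            exact hm
          · exact ⟨p, hp, a.symm hpq⟩
          · rw [← ha.2 _ _ hpq]
            exact hp
        exact fun p q h => propext ⟨this p q h, this q p (a.symm h)⟩
      · have : ∀ p q, b p q → P (Sum.inr p) → P (Sum.inr q) := by
          rintro (p | p) (q | q) hpq hp
          · have hp : b (Sum.inl p) (Sum.inr i) := hp
            exact b.trans (b.symm hpq) hp
          · have hp : b (Sum.inl p) (Sum.inr i) := hp
            exact hb.2 _ _ (b.trans (b.symm hpq) hp)
          · have hp : p = i := hp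
            subst hp
            exact b.symm hpq
          · have hp : p = i := hp
            subst hp
            exact (hb.2 _ _ hpq).symm
        exact fun p q h => propext ⟨this p q h, this q p (b.symm h)⟩
    have h1 : P (Sum.inr (Sum.inr i)) = P (Sum.inr (Sum.inr i')) := key h
    have h2 : P (Sum.inr (Sum.inr i')) := h1 ▸ (rfl : i = i)
    exact Eq.symm h2

/-- The stacked graph, with the arcs of the two diagrams as edges. -/
def stack (a : Setoid (T ⊕ M)) (b : Setoid (M ⊕ N)) : SimpleGraph (T ⊕ (M ⊕ N)) where
  Adj u v := u ≠ v ∧ ((∃ s t, a s t ∧ Sum.map id Sum.inl s = u ∧ Sum.map id Sum.inl t = v) ∨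
    ∃ s t, b s t ∧ Sum.inr s = u ∧ Sum.inr t = v)
  symm := ⟨by
    rintro u v ⟨h, ⟨s, t, h1, h2, h3⟩ | ⟨s, t, h1, h2, h3⟩⟩
    · exact ⟨h.symm, Or.inl ⟨t, s, a.symm h1, h3, h2⟩⟩
    · exact ⟨h.symm, Or.inr ⟨t, s, b.symm h1, h3, h2⟩⟩⟩
  loopless := ⟨fun _ h => h.1 rfl⟩

theorem glue_le_reachable (a : Setoid (T ⊕ M)) (b : Setoid (M ⊕ N)) :
    glue a b ≤ (stack a b).reachableSetoid := by
  refine sup_le (map_le_iff.2 ?_) (map_le_iff.2 ?_)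
  · intro p q h
    show (stack a b).Reachable _ _
    by_cases e : (Sum.map id Sum.inl p : T ⊕ (M ⊕ N)) = Sum.map id Sum.inl q
    · rw [e]
    · exact SimpleGraph.Adj.reachable ⟨e, Or.inl ⟨p, q, h, rfl, rfl⟩⟩
  · intro p q h
    show (stack a b).Reachable _ _
    by_cases e : (Sum.inr p : T ⊕ (M ⊕ N)) = Sum.inr q
    · rw [e]
    · exact SimpleGraph.Adj.reachable ⟨e, Or.inr ⟨p, q, h, rfl, rfl⟩⟩

open Classical in
/-- A connected graph with all degrees at most two has at most two vertices of degree at most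
one. -/
theorem card_leaf_le_two {V : Type*} [Fintype V] (G : SimpleGraph V) (hG : G.Connected)
    (E : Finset V) (h2 : ∀ v, G.degree v ≤ 2) (h1 : ∀ v ∈ E, G.degree v ≤ 1) : E.card ≤ 2 := by
  have hc := hG.card_vert_le_card_edgeSet_add_one
  have hs := G.sum_degrees_eq_twice_card_edges
  have hb : ∑ v, (G.degree v + if v ∈ E then 1 else 0) ≤ ∑ _v : V, 2 := by
    refine Finset.sum_le_sum fun v _ => ?_
    split_ifs with h
    · have := h1 v h
      omega
    · have := h2 v
      omega
  rw [Finset.sum_add_distrib, hs] at hb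
  simp at hb
  rw [Nat.card_eq_fintype_card, Nat.card_eq_fintype_card, ← SimpleGraph.edgeFinset_card] at hc
  omega

open Classical in
theorem IsPartialOneFactor.comp [Finite T] [Finite M] [Finite N]
    {a : Setoid (T ⊕ M)} {b : Setoid (M ⊕ N)}
    (ha : IsPartialOneFactor a) (hb : IsPartialOneFactor b) :
    IsPartialOneFactor (comp a b) := by
  have := Fintype.ofFinite T
  have := Fintype.ofFinite M
  have := Fintype.ofFinite N
  intro p q r hpq hpr
  by_contra! hne
  obtain ⟨n1, n2, n3⟩ := hne
  set G := stack a b with hG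
  set C := G.connectedComponentMk (outer p) with hC
  have hp : outer p ∈ C := rfl
  have hq : outer q ∈ C := by
    have : G.Reachable (outer p) (outer q) := glue_le_reachable a b hpq
    exact (SimpleGraph.ConnectedComponent.eq.2 this).symm
  have hr : outer r ∈ C := by
    have : G.Reachable (outer p) (outer r) := glue_le_reachable a b hpr
    exact (SimpleGraph.ConnectedComponent.eq.2 this).symm
  have inj : Function.Injective (outer : T ⊕ N → T ⊕ (M ⊕ N)) := by
    rintro (x | x) (y | y) <;> simp [outer]
  let SA : C → Finset C := fun v => Finset.univ.filter fun w => w ≠ v ∧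
    ∃ s t, a s t ∧ Sum.map id Sum.inl s = v.1 ∧ Sum.map id Sum.inl t = w.1
  let SB : C → Finset C := fun v => Finset.univ.filter fun w => w ≠ v ∧
    ∃ s t, b s t ∧ Sum.inr s = v.1 ∧ Sum.inr t = w.1
  have injA : Function.Injective (Sum.map id Sum.inl : T ⊕ M → T ⊕ (M ⊕ N)) := by
    rintro (x | x) (y | y) <;> simp
  have cA : ∀ v, (SA v).card ≤ 1 := by
    intro v
    refine Finset.card_le_one.2 fun w hw w' hw' => ?_
    simp only [SA, Finset.mem_filter, Finset.mem_univ, true_and] at hw hw'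
    obtain ⟨hwv, s, t, hst, hs, ht⟩ := hw
    obtain ⟨hwv', s', t', hst', hs', ht'⟩ := hw'
    have e := injA (hs.trans hs'.symm)
    subst e
    rcases ha s t t' hst hst' with e | e | e
    · subst e
      exact absurd (Subtype.ext (ht.symm.trans hs)) hwv
    · subst e
      exact absurd (Subtype.ext (ht'.symm.trans hs')) hwv'
    · subst e
      exact Subtype.ext (ht.symm.trans ht')
  have cB : ∀ v, (SB v).card ≤ 1 := by
    intro v
    refine Finset.card_le_one.2 fun w hw w' hw' => ?_
    simp only [SB, Finset.mem_filter, Finset.mem_univ, true_and] at hw hw'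
    obtain ⟨hwv, s, t, hst, hs, ht⟩ := hw
    obtain ⟨hwv', s', t', hst', hs', ht'⟩ := hw'
    have e := Sum.inr_injective (hs.trans hs'.symm)
    subst e
    rcases hb s t t' hst hst' with e | e | e
    · subst e
      exact absurd (Subtype.ext (ht.symm.trans hs)) hwv
    · subst e
      exact absurd (Subtype.ext (ht'.symm.trans hs')) hwv'
    · subst e
      exact Subtype.ext (ht.symm.trans ht')
  have hdeg : ∀ v : C, (C.toSimpleGraph).degree v ≤ (SA v).card + (SB v).card := by
    intro v
    rw [← SimpleGraph.card_neighborFinset_eq_degree]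
    refine (Finset.card_le_card ?_).trans (Finset.card_union_le _ _)
    intro w hw
    rw [SimpleGraph.mem_neighborFinset] at hw
    have hw : G.Adj v.1 w.1 := hw
    obtain ⟨h0, h | h⟩ := hw
    · refine Finset.mem_union_left _ ?_
      simp only [SA, Finset.mem_filter, Finset.mem_univ, true_and]
      exact ⟨fun e => h0 (congrArg Subtype.val e).symm, h⟩
    · refine Finset.mem_union_right _ ?_
      simp only [SB, Finset.mem_filter, Finset.mem_univ, true_and]
      exact ⟨fun e => h0 (congrArg Subtype.val e).symm, h⟩
  have hout : ∀ (o : T ⊕ N) (ho : outer o ∈ C), (C.toSimpleGraph).degree ⟨outer o, ho⟩ ≤ 1 := by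
    intro o ho
    refine (hdeg _).trans ?_
    rcases o with o | o
    · have : SB ⟨outer (Sum.inl o), ho⟩ = ∅ := by
        ext w
        simp [SB, outer]
      rw [this]
      simpa using cA _
    · have : SA ⟨outer (Sum.inr o), ho⟩ = ∅ := by
        ext w
        simp [SA, outer]
      rw [this]
      simpa using cB _
  have := card_leaf_le_two C.toSimpleGraph C.connected_toSimpleGraph
    {⟨outer p, hp⟩, ⟨outer q, hq⟩, ⟨outer r, hr⟩}
    (fun v => (hdeg v).trans (add_le_add (cA v) (cB v))) (by
      intro v hv
      simp only [Finset.mem_insert, Finset.mem_singleton] at hv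
      rcases hv with rfl | rfl | rfl
      · exact hout p hp
      · exact hout q hq
      · exact hout r hr)
  rw [Finset.card_insert_of_notMem, Finset.card_pair] at this
  · omega
  · simpa using fun h => n3 (inj h)
  · simp only [Finset.mem_insert, Finset.mem_singleton, Subtype.mk.injEq, not_or]
    exact ⟨fun h => n1 (inj h), fun h => n2 (inj h)⟩

theorem comp_mem_diagrams {k : Kind} {n : ℕ} {a b : Setoid (Fin n ⊕ Fin n)}
    (ha : a ∈ diagrams k n) (hb : b ∈ diagrams k n) : comp a b ∈ diagrams k n := by
  cases k
  · exact IsPartialOneFactor.comp ha hb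
  · exact ⟨ha.1.comp hb.1, ha.2.comp hb.2⟩

end closure

/-- The diagram of a permutation: the top vertex `π j` is joined to the bottom vertex `j`. -/
def permDiagram {n : ℕ} (π : Equiv.Perm (Fin n)) : Setoid (Fin n ⊕ Fin n) :=
  Setoid.ker (Sum.elim id π)

theorem permDiagram_mem (k : Kind) {n : ℕ} (π : Equiv.Perm (Fin n)) :
    permDiagram π ∈ diagrams k n := by
  refine mem_diagrams ?_ ⟨fun i j h => h, fun i j h => π.injective h⟩
  rintro (p | p) (q | q) (r | r) (h : _ = _) (h' : _ = _) <;>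
    simp only [Sum.elim_inl, Sum.elim_inr, id] at h h' <;>
    simp_all
  exact π.injective (h'.trans h.symm)

/-- The diagram with straight arcs at the first `m` vertices and loops at the other vertices of
both rows. -/
def loopDiagram (n m : ℕ) : Setoid (Fin n ⊕ Fin n) where
  r p q := p = q ∨ (Sum.elim id id p = Sum.elim id id q ∧ (Sum.elim id id p : Fin n).val < m)
  iseqv :=
    { refl := fun _ => Or.inl rfl
      symm := by
        rintro p q (rfl | ⟨h, h'⟩)
        · exact Or.inl rfl
        · exact Or.inr ⟨h.symm, h ▸ h'⟩
      trans := by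
        rintro p q r (rfl | ⟨h, h'⟩) (rfl | ⟨h1, h1'⟩)
        · exact Or.inl rfl
        · exact Or.inr ⟨h1, h1'⟩
        · exact Or.inr ⟨h, h'⟩
        · exact Or.inr ⟨h.trans h1, h'⟩ }

theorem loopDiagram_mem (k : Kind) (n m : ℕ) : loopDiagram n m ∈ diagrams k n := by
  refine mem_diagrams ?_ ⟨?_, ?_⟩
  · rintro (p | p) (q | q) (r | r) (h | ⟨h, -⟩) (h' | ⟨h', -⟩) <;>
      simp_all
  · rintro i j (h | ⟨h, -⟩)
    · exact Sum.inl_injective h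
    · exact h
  · rintro i j (h | ⟨h, -⟩)
    · exact Sum.inr_injective h
    · exact h

/-- The number of vertical arcs, i.e. of arcs which join a top vertex to a bottom vertex. -/
noncomputable def verticalArcs {n : ℕ} (d : Setoid (Fin n ⊕ Fin n)) : ℕ :=
  Set.ncard {p : Fin n × Fin n | d (Sum.inl p.1) (Sum.inr p.2)}

section algebra

variable {F : Type*} [Field F]

/-- The algebra spanned by the diagrams of kind `k`, as a subalgebra of the partition algebra. -/
noncomputable def diagramSubalgebra (k : Kind) (n : ℕ) (x : F) :
    Subalgebra F (PartitionAlgebra n x) :=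
  Submodule.toSubalgebra (Submodule.span F (PartitionAlgebra.of x '' diagrams k n))
    (by
      refine Submodule.subset_span ⟨straight (Fin n), ?_, rfl⟩
      exact permDiagram_mem k (Equiv.refl _))
    (by
      intro f g hf hg
      have h := Submodule.mul_mem_mul hf hg
      rw [Submodule.span_mul_span] at h
      refine Submodule.span_le.2 ?_ h
      rintro _ ⟨_, ⟨a, ha, rfl⟩, _, ⟨b, hb, rfl⟩, rfl⟩
      show PartitionAlgebra.of x a * PartitionAlgebra.of x b ∈ _
      rw [PartitionAlgebra.of_mul_of]
      exact Submodule.smul_mem _ _ (Submodule.subset_span ⟨_, comp_mem_diagrams ha hb, rfl⟩))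

/-- The algebra spanned by the diagrams of kind `k`. -/
def DiagramAlg (k : Kind) (n : ℕ) (x : F) : Type _ := diagramSubalgebra k n x

noncomputable instance (k : Kind) (n : ℕ) (x : F) : Ring (DiagramAlg k n x) :=
  inferInstanceAs (Ring (diagramSubalgebra k n x))

noncomputable instance (k : Kind) (n : ℕ) (x : F) : Algebra F (DiagramAlg k n x) :=
  inferInstanceAs (Algebra F (diagramSubalgebra k n x))

/-- A diagram as an element of the algebra. -/
noncomputable def diag {k : Kind} {n : ℕ} (x : F) (d : Setoid (Fin n ⊕ Fin n))
    (hd : d ∈ diagrams k n) : DiagramAlg k n x :=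
  ⟨PartitionAlgebra.of x d, Submodule.subset_span ⟨d, hd, rfl⟩⟩

/-- The two-sided ideal generated by the diagrams with fewer than `m` vertical arcs. -/
noncomputable def arcIdeal (k : Kind) (n : ℕ) (x : F) (m : ℕ) : Ideal (DiagramAlg k n x) :=
  (TwoSidedIdeal.span {a : DiagramAlg k n x |
    ∃ (d : Setoid (Fin n ⊕ Fin n)) (hd : d ∈ diagrams k n),
      verticalArcs d < m ∧ a = diag x d hd}).asIdeal

instance (k : Kind) (n : ℕ) (x : F) (m : ℕ) : (arcIdeal k n x m).IsTwoSided :=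
  inferInstanceAs (TwoSidedIdeal.asIdeal _).IsTwoSided

/-! ### Specht modules -/

/-- A fixed tableau of shape `ν`: a bijective filling of the boxes. -/
noncomputable def tableau (ν : YoungDiagram) : Fin ν.card ≃ ν.cells := ν.cells.equivFin.symm

open Classical in
/-- The sum of all permutations which preserve the rows of the tableau. -/
noncomputable def rowSum (F : Type*) [Field F] (ν : YoungDiagram) :
    MonoidAlgebra F (Equiv.Perm (Fin ν.card)) :=
  ∑ σ : Equiv.Perm (Fin ν.card) with ∀ i, (tableau ν (σ i)).1.1 = (tableau ν i).1.1,
    MonoidAlgebra.single σ 1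

open Classical in
/-- The signed sum of all permutations which preserve the columns of the tableau. -/
noncomputable def colSum (F : Type*) [Field F] (ν : YoungDiagram) :
    MonoidAlgebra F (Equiv.Perm (Fin ν.card)) :=
  ∑ σ : Equiv.Perm (Fin ν.card) with ∀ i, (tableau ν (σ i)).1.2 = (tableau ν i).1.2,
    MonoidAlgebra.single σ ((Equiv.Perm.sign σ : ℤ) : F)

/-- The Specht module of `ν`, as a left ideal of the group algebra of the symmetric group.
The left ideal generated by `rowSum` is the module of tabloids, with `rowSum` the tabloid of the
fixed tableau, and `colSum * rowSum` is the polytabloid of the fixed tableau. -/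
noncomputable def specht (F : Type*) [Field F] (ν : YoungDiagram) :
    Submodule (MonoidAlgebra F (Equiv.Perm (Fin ν.card)))
      (MonoidAlgebra F (Equiv.Perm (Fin ν.card))) :=
  Submodule.span _ {colSum F ν * rowSum F ν}

/-- `specht` as a type. -/
def SpechtModule (F : Type*) [Field F] (ν : YoungDiagram) : Type _ := specht F ν

noncomputable instance (ν : YoungDiagram) : AddCommGroup (SpechtModule F ν) :=
  inferInstanceAs (AddCommGroup (specht F ν))

noncomputable instance (ν : YoungDiagram) :
    Module (MonoidAlgebra F (Equiv.Perm (Fin ν.card))) (SpechtModule F ν) :=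
  inferInstanceAs (Module (MonoidAlgebra F (Equiv.Perm (Fin ν.card))) (specht F ν))

noncomputable instance (ν : YoungDiagram) : Module F (SpechtModule F ν) :=
  inferInstanceAs (Module F (specht F ν))

/-! ### The modules `M(ν)` and `N(ν)` -/

open scoped TensorProduct

/-- A permutation of the first `m` vertices as an element of the algebra. -/
noncomputable def permElt (k : Kind) {n m : ℕ} (x : F) (h : m ≤ n) (σ : Equiv.Perm (Fin m)) :
    DiagramAlg k n x :=
  diag x (permDiagram (σ.viaEmbedding (Fin.castLEEmb h))) (permDiagram_mem k _)

/-- The left ideal generated by `loopDiagram n m` in the algebra spanned by the diagrams with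
exactly `m` vertical arcs. The latter is the image of the ideal `arcIdeal k n x (m + 1)` in the
quotient by `arcIdeal k n x m`. -/
noncomputable def loopIdeal (k : Kind) (n : ℕ) (x : F) (m : ℕ) :
    Submodule (DiagramAlg k n x) (DiagramAlg k n x ⧸ arcIdeal k n x m) :=
  Submodule.map (LinearMap.toSpanSingleton (DiagramAlg k n x) _
    (Ideal.Quotient.mk (arcIdeal k n x m) (diag x (loopDiagram n m) (loopDiagram_mem k n m))))
    (arcIdeal k n x (m + 1))

/-- `loopIdeal` as a type. -/
def LoopModule (k : Kind) (n : ℕ) (x : F) (m : ℕ) : Type _ := loopIdeal k n x m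

noncomputable instance (k : Kind) (n : ℕ) (x : F) (m : ℕ) : AddCommGroup (LoopModule k n x m) :=
  inferInstanceAs (AddCommGroup (loopIdeal k n x m))

noncomputable instance (k : Kind) (n : ℕ) (x : F) (m : ℕ) :
    Module (DiagramAlg k n x) (LoopModule k n x m) :=
  inferInstanceAs (Module (DiagramAlg k n x) (loopIdeal k n x m))

noncomputable instance (k : Kind) (n : ℕ) (x : F) (m : ℕ) : Module F (LoopModule k n x m) :=
  inferInstanceAs (Module F (loopIdeal k n x m))

instance (k : Kind) (n : ℕ) (x : F) (m : ℕ) :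
    IsScalarTower F (DiagramAlg k n x) (LoopModule k n x m) :=
  inferInstanceAs (IsScalarTower F (DiagramAlg k n x) (loopIdeal k n x m))

/-- The tensor product over `F` of `LoopModule` and the Specht module of `ν`. -/
abbrev TensorModule (k : Kind) (n : ℕ) (x : F) (ν : YoungDiagram) : Type _ :=
  LoopModule k n x ν.card ⊗[F] SpechtModule F ν

/-- The relations `p σ ⊗ v = p ⊗ σ v` that turn the tensor product over `F` into the tensor
product over the group algebra of the symmetric group. -/
noncomputable def tensorRelations (k : Kind) {n : ℕ} (x : F) (ν : YoungDiagram)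
    (h : ν.card ≤ n) : Submodule (DiagramAlg k n x) (TensorModule k n x ν) :=
  Submodule.span _ {z | ∃ (p q : LoopModule k n x ν.card) (σ : Equiv.Perm (Fin ν.card))
    (v : SpechtModule F ν),
      (q.1 : DiagramAlg k n x ⧸ arcIdeal k n x ν.card) =
        p.1 * Ideal.Quotient.mk (arcIdeal k n x ν.card) (permElt k x h σ) ∧
      z = q ⊗ₜ[F] v -
        p ⊗ₜ[F] ((MonoidAlgebra.single σ 1 : MonoidAlgebra F (Equiv.Perm (Fin ν.card))) • v)}

/-- The module `M(ν)`: the tensor product of `LoopModule` and the Specht module of `ν` over the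
group algebra of the symmetric group, with the action `b (a ⊗ v) = (b a) ⊗ v`. -/
def CellModule (k : Kind) {n : ℕ} (x : F) (ν : YoungDiagram) (h : ν.card ≤ n) : Type _ :=
  TensorModule k n x ν ⧸ tensorRelations k x ν h

noncomputable instance (k : Kind) {n : ℕ} (x : F) (ν : YoungDiagram) (h : ν.card ≤ n) :
    AddCommGroup (CellModule k x ν h) :=
  inferInstanceAs (AddCommGroup (TensorModule k n x ν ⧸ tensorRelations k x ν h))

noncomputable instance (k : Kind) {n : ℕ} (x : F) (ν : YoungDiagram) (h : ν.card ≤ n) :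
    Module (DiagramAlg k n x) (CellModule k x ν h) :=
  inferInstanceAs (Module (DiagramAlg k n x) (TensorModule k n x ν ⧸ tensorRelations k x ν h))

/-- The submodule `N(ν)` of the vectors of `M(ν)` that are annihilated by the ideal generated by the
diagrams with at most `|ν|` vertical arcs. As the diagrams with fewer than `|ν|` vertical arcs act
by zero on `M(ν)`, these are the vectors annihilated by the algebra of diagrams with exactly `|ν|`
vertical arcs. -/
noncomputable def cellRadical (k : Kind) {n : ℕ} (x : F) (ν : YoungDiagram) (h : ν.card ≤ n) :
    Submodule (DiagramAlg k n x) (CellModule k x ν h) where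
  carrier := {w | ∀ a ∈ arcIdeal k n x (ν.card + 1), a • w = 0}
  add_mem' := by
    intro v w hv hw a ha
    rw [smul_add, hv a ha, hw a ha, add_zero]
  zero_mem' := fun a _ => smul_zero a
  smul_mem' := by
    intro b w hw a ha
    rw [smul_smul]
    exact hw _ (Ideal.mul_mem_right b _ ha)

end algebra

end DiagramAlgebra

/-! Write A for the algebra, J(m) for `arcIdeal k n x m` and e(m) for `loopElt k n x m`. The proof
rests on two facts about the modules M(ν) and N(ν).

If every N(ν) vanishes, then A is semisimple (`isSemisimpleRing_of_cellRadical_eq_bot`). Every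
simple A-module L is the image of a map M(ν) → L with kernel N(ν), and J(|ν| + 1) does not
annihilate L (`exists_hom_of_isSimpleModule`).

Hence, if A is not semisimple, some N(μ) is nonzero and contains a simple submodule L. Take M(λ) → L
with kernel N(λ), followed by the inclusion of L in M(μ). As J(|μ| + 1) annihilates N(μ) but J(|λ| +
1) does not annihilate L, it follows that |μ| < |λ|.

Both facts come from the layers J(m + 1) / J(m). Since x ≠ 0, the element e(m) is idempotent up to a
nonzero scalar and generates J(m + 1) as a two-sided ideal (`mem_closure_of_mem_arcIdeal`). Modulo
J(m), every element of e(m) A e(m) comes from the group algebra of S_m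
(`exists_loopElt_mul_mul_loopElt`). In characteristic zero the Young symmetrizers generate this
group algebra as a two-sided ideal (`one_mem_of_symmetrizers_mem`) and the Specht modules are
simple. So, in a module annihilated by J(m), every vector in the image of e(m) lies in a sum of
images of modules M(ν) with |ν| = m (`loopElt_smul_mem`), and each vector of M(ν) outside N(ν)
generates M(ν) (`eq_top_of_notMem_cellRadical`). -/

namespace DiagramAlgebra

/-! ### Fillings of Young diagrams -/

/-- The number of boxes in the first `k` rows. -/
def topBoxes (ν : YoungDiagram) (k : ℕ) : ℕ := (ν.cells.filter fun c => c.1 < k).card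

theorem card_col_filter (ν : YoungDiagram) (k j : ℕ) :
    (ν.cells.filter fun c => c.1 < k ∧ c.2 = j).card = min k (ν.colLen j) := by
  have : (ν.cells.filter fun c => c.1 < k ∧ c.2 = j) =
      (Finset.range (min k (ν.colLen j))).image fun i => (i, j) := by
    ext ⟨a, b⟩
    simp only [Finset.mem_filter, YoungDiagram.mem_cells, Finset.mem_image, Finset.mem_range,
      lt_min_iff, Prod.mk.injEq]
    constructor
    · rintro ⟨h, h1, rfl⟩
      exact ⟨a, ⟨h1, YoungDiagram.mem_iff_lt_colLen.1 h⟩, rfl, rfl⟩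
    · rintro ⟨i, ⟨h1, h2⟩, rfl, rfl⟩
      exact ⟨YoungDiagram.mem_iff_lt_colLen.2 h2, h1, rfl⟩
  rw [this, Finset.card_image_of_injective _ (Prod.mk_left_injective j), Finset.card_range]

theorem exists_col_bound (ν : YoungDiagram) : ∃ N, ∀ c ∈ ν.cells, c.2 < N :=
  ⟨ν.cells.sup Prod.snd + 1, fun _ hc => Nat.lt_succ_of_le (Finset.le_sup (f := Prod.snd) hc)⟩

theorem topBoxes_eq_sum (ν : YoungDiagram) {N : ℕ} (hN : ∀ c ∈ ν.cells, c.2 < N) (k : ℕ) :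
    topBoxes ν k = ∑ j ∈ Finset.range N, min k (ν.colLen j) := by
  unfold topBoxes
  rw [Finset.card_eq_sum_card_fiberwise (f := Prod.snd) (t := Finset.range N)]
  · refine Finset.sum_congr rfl fun j _ => ?_
    rw [← card_col_filter, Finset.filter_filter]
  · intro c hc
    simp only [Finset.coe_filter, Set.mem_ofPred_eq] at hc
    simpa using hN c hc.1

/-- Consecutive differences of `topBoxes` are the row lengths. The pointwise order of these
functions is the dominance order on diagrams of equal size; injectivity makes it antisymmetric on
diagrams. -/
theorem topBoxes_injective : Function.Injective topBoxes := by
  intro ν ν' h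
  have key : ∀ (ν : YoungDiagram) k, topBoxes ν (k + 1) = topBoxes ν k + ν.rowLen k := by
    intro ν k
    unfold topBoxes
    rw [YoungDiagram.rowLen_eq_card, ← Finset.card_union_of_disjoint]
    · congr 1
      ext c
      simp only [Finset.mem_filter, Finset.mem_union, YoungDiagram.mem_row_iff,
        YoungDiagram.mem_cells, Nat.lt_succ_iff_lt_or_eq]
      tauto
    · rw [Finset.disjoint_left]
      intro c hc hc'
      have := (Finset.mem_filter.1 hc).2
      have := (YoungDiagram.mem_row_iff.1 hc').2
      omega
  have hrow : ∀ k, ν.rowLen k = ν'.rowLen k := by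
    intro k
    have h1 := key ν k
    have h2 := key ν' k
    rw [h] at h1
    omega
  ext ⟨i, j⟩
  rw [YoungDiagram.mem_cells, YoungDiagram.mem_cells, YoungDiagram.mem_iff_lt_rowLen,
    YoungDiagram.mem_iff_lt_rowLen, hrow]

theorem card_filter_filling {m : ℕ} {ν : YoungDiagram} (t : Fin m ≃ ν.cells)
    (p : ℕ × ℕ → Prop) [DecidablePred p] :
    (Finset.univ.filter fun e : Fin m => p (t e).1).card = (ν.cells.filter p).card := by
  refine Finset.card_bij (fun e _ => (t e).1) ?_ ?_ ?_
  · intro e he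
    exact Finset.mem_filter.2 ⟨(t e).2, (Finset.mem_filter.1 he).2⟩
  · intro e _ e' _ h
    exact t.injective (Subtype.ext h)
  · intro c hc
    have hc := Finset.mem_filter.1 hc
    exact ⟨t.symm ⟨c, hc.1⟩, by simpa using hc.2, by simp⟩

section transversal

variable {m : ℕ} {ν ν' : YoungDiagram} (t : Fin m ≃ ν.cells) (t' : Fin m ≃ ν'.cells)

/-- Each of the first `k` rows of `t` meets column `j` of `t'` at most once, which gives the bound
`k`; the other bound is the length of that column. -/
theorem card_le_of_transversal
    (h : ∀ a b, (t a).1.1 = (t b).1.1 → (t' a).1.2 = (t' b).1.2 → a = b) (k j : ℕ) :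
    (Finset.univ.filter fun e : Fin m => (t e).1.1 < k ∧ (t' e).1.2 = j).card ≤
      min k (ν'.colLen j) := by
  refine le_min ?_ ?_
  · have : k = (Finset.range k).card := by simp
    conv_rhs => rw [this]
    refine Finset.card_le_card_of_injOn (fun e => (t e).1.1) ?_ ?_
    · intro e he
      simpa using (Finset.mem_filter.1 he).2.1
    · intro a ha b hb hab
      have ha := (Finset.mem_filter.1 ha).2.2
      have hb := (Finset.mem_filter.1 hb).2.2
      exact h a b hab (ha.trans hb.symm)
  · rw [YoungDiagram.colLen_eq_card]
    have := card_filter_filling t' (fun c => c.2 = j)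
    have e : ν'.col j = ν'.cells.filter fun c => c.2 = j := rfl
    rw [e, ← this]
    exact Finset.card_le_card fun e he => by simp_all

theorem topBoxes_eq_sum_filling {N : ℕ} (hN : ∀ c ∈ ν'.cells, c.2 < N) (k : ℕ) :
    topBoxes ν k = ∑ j ∈ Finset.range N,
      (Finset.univ.filter fun e : Fin m => (t e).1.1 < k ∧ (t' e).1.2 = j).card := by
  rw [topBoxes, ← card_filter_filling t (fun c => c.1 < k),
    Finset.card_eq_sum_card_fiberwise (f := fun e => (t' e).1.2) (t := Finset.range N)]
  · refine Finset.sum_congr rfl fun j _ => ?_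
    rw [Finset.filter_filter]
  · intro e _
    simpa using hN _ (t' e).2

theorem topBoxes_le_of_transversal
    (h : ∀ a b, (t a).1.1 = (t b).1.1 → (t' a).1.2 = (t' b).1.2 → a = b) :
    topBoxes ν ≤ topBoxes ν' := by
  intro k
  obtain ⟨N, hN⟩ := exists_col_bound ν'
  rw [topBoxes_eq_sum_filling t t' hN, topBoxes_eq_sum ν' hN]
  exact Finset.sum_le_sum fun j _ => card_le_of_transversal t t' h k j

end transversal

/-- For equal shapes the inequalities of `card_le_of_transversal` have equal sums over the columns,
so each is an equality. An entry whose row in `t` lies below the end of its column in `t'` would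
raise the count by one when that row is added, although `min k (colLen j)` has already become
constant. -/
theorem mem_of_transversal {m : ℕ} {ν : YoungDiagram} (t t' : Fin m ≃ ν.cells)
    (h : ∀ a b, (t a).1.1 = (t b).1.1 → (t' a).1.2 = (t' b).1.2 → a = b) (e : Fin m) :
    ((t e).1.1, (t' e).1.2) ∈ ν.cells := by
  obtain ⟨N, hN⟩ := exists_col_bound ν
  have heq : ∀ k j, j < N →
      (Finset.univ.filter fun e : Fin m => (t e).1.1 < k ∧ (t' e).1.2 = j).card =
        min k (ν.colLen j) := by
    intro k j hj
    have h1 := topBoxes_eq_sum_filling t t' hN k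
    rw [topBoxes_eq_sum ν hN] at h1
    exact (Finset.sum_eq_sum_iff_of_le fun j _ => card_le_of_transversal t t' h k j).1 h1.symm j
      (Finset.mem_range.2 hj)
  rw [YoungDiagram.mem_cells, YoungDiagram.mem_iff_lt_colLen]
  by_contra! hle
  have h1 := heq (t e).1.1 (t' e).1.2 (hN _ (t' e).2)
  have h2 := heq ((t e).1.1 + 1) (t' e).1.2 (hN _ (t' e).2)
  rw [min_eq_right hle] at h1
  rw [min_eq_right (hle.trans (Nat.le_succ _)), ← h1] at h2
  have h3 := Finset.eq_of_subset_of_card_le (s := Finset.univ.filter fun a : Fin m =>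
      (t a).1.1 < (t e).1.1 ∧ (t' a).1.2 = (t' e).1.2) (t := Finset.univ.filter fun a : Fin m =>
      (t a).1.1 < (t e).1.1 + 1 ∧ (t' a).1.2 = (t' e).1.2)
    (fun a ha => by
      simp only [Finset.mem_filter, Finset.mem_univ, true_and] at ha ⊢
      exact ⟨ha.1.trans (Nat.lt_succ_self _), ha.2⟩) h2.le
  have : e ∈ Finset.univ.filter fun a : Fin m =>
      (t a).1.1 < (t e).1.1 ∧ (t' a).1.2 = (t' e).1.2 := by
    rw [h3]
    simp
  simp at this

/-- If no two entries share a row of `t` and a column of `t'`, then some rearrangement of the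
entries within the rows of `t` has the columns of `t'`. -/
theorem exists_perm_of_transversal {m : ℕ} {ν : YoungDiagram} (t t' : Fin m ≃ ν.cells)
    (h : ∀ a b, (t a).1.1 = (t b).1.1 → (t' a).1.2 = (t' b).1.2 → a = b) :
    ∃ ρ : Equiv.Perm (Fin m), ∀ e, (t (ρ e)).1.1 = (t e).1.1 ∧ (t (ρ e)).1.2 = (t' e).1.2 := by
  -- `f e` is the entry of `t` in the row of `e` in `t` and the column of `e` in `t'`;
  -- transversality is exactly the injectivity of `f`.
  let f : Fin m → Fin m := fun e => t.symm ⟨_, mem_of_transversal t t' h e⟩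
  have hf : ∀ e, (t (f e)).1 = ((t e).1.1, (t' e).1.2) := fun e => by simp [f]
  have inj : Function.Injective f := by
    intro a b hab
    have h1 := hf a
    rw [hab, hf b, Prod.mk.injEq] at h1
    exact (h b a h1.1 h1.2).symm
  refine ⟨Equiv.ofBijective f (Finite.injective_iff_bijective.1 inj), fun e => ?_⟩
  rw [Equiv.ofBijective_apply, hf]
  exact ⟨rfl, rfl⟩

/-- The Young diagram whose row lengths are the parts of a partition. -/
def partitionDiagram {m : ℕ} (p : m.Partition) : YoungDiagram :=
  YoungDiagram.ofRowLens (p.parts.sort (· ≥ ·)) (p.parts.pairwise_sort (· ≥ ·)).sortedGE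

theorem partitionDiagram_injective {m : ℕ} :
    Function.Injective (partitionDiagram : m.Partition → YoungDiagram) := by
  have key : ∀ p : m.Partition, ((partitionDiagram p).rowLens : Multiset ℕ) = p.parts := by
    intro p
    rw [partitionDiagram, YoungDiagram.rowLens_ofRowLens_eq_self, Multiset.sort_eq]
    intro x hx
    exact p.parts_pos ((Multiset.mem_sort _).1 hx)
  intro p q h
  ext1
  rw [← key, ← key, h]

theorem card_cellsOfRowLens (w : List ℕ) : (YoungDiagram.cellsOfRowLens w).card = w.sum := by
  induction w with
  | nil => rfl
  | cons a w ih =>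
    rw [YoungDiagram.cellsOfRowLens, Finset.card_union_of_disjoint, Finset.card_map, ih]
    · simp
    · rw [Finset.disjoint_left]
      rintro ⟨i, j⟩ h1 h2
      simp at h1 h2
      omega

theorem card_partitionDiagram {m : ℕ} (p : m.Partition) : (partitionDiagram p).card = m := by
  have : (partitionDiagram p).card = (p.parts.sort (· ≥ ·)).sum := card_cellsOfRowLens _
  rw [this, ← Multiset.sum_coe, Multiset.sort_eq, p.parts_sum]

end DiagramAlgebra

namespace DiagramAlgebra

/-! ### Young symmetrizers -/

/-- With a complement V of U and 1 = ε + δ accordingly, u = uε + uδ = uδ lies in U ∩ V. Combined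
with Maschke's theorem, this yields the nonvanishing statements below without computing any scalar.
-/
theorem eq_bot_of_mul_eq_zero {R : Type*} [Ring R] [IsSemisimpleRing R] (U : Ideal R)
    (h : ∀ a ∈ U, ∀ b ∈ U, a * b = 0) : U = ⊥ := by
  obtain ⟨V, hV⟩ := exists_isCompl U
  rw [eq_bot_iff]
  intro u hu
  have h1 : (1 : R) ∈ U ⊔ V := by rw [hV.sup_eq_top]; trivial
  obtain ⟨ε, hε, δ, hδ, h1⟩ := Submodule.mem_sup.1 h1
  have h2 : u = u * δ := by
    have h3 : u * (ε + δ) = u := by rw [h1, mul_one]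
    rw [mul_add, h u hu ε hε, zero_add] at h3
    exact h3.symm
  have h3 : u ∈ V := h2 ▸ V.mul_mem_left u hδ
  exact (Submodule.disjoint_def.1 hV.disjoint) u hu h3

section

variable (F : Type*) [Field F] {m : ℕ}

/-- The permutations which preserve a labelling. -/
def labelStabilizer (f : Fin m → ℕ) : Subgroup (Equiv.Perm (Fin m)) where
  carrier := {σ | ∀ i, f (σ i) = f i}
  mul_mem' := fun {σ τ} h h' i => (h (τ i)).trans (h' i)
  one_mem' := fun _ => rfl
  inv_mem' := fun {σ} h i => by
    have := h (σ⁻¹ i)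
    rw [show σ (σ⁻¹ i) = i from σ.apply_symm_apply i] at this
    exact this.symm

theorem swap_mem_labelStabilizer {f : Fin m → ℕ} {a b : Fin m} (h : f a = f b) :
    Equiv.swap a b ∈ labelStabilizer f := by
  intro i
  rw [Equiv.swap_apply_def]
  split_ifs with h1 h2
  · rw [h1, h]
  · rw [h2, h]
  · rfl

/-- The sign of a permutation as an element of the field. -/
def signIn (σ : Equiv.Perm (Fin m)) : F := ((Equiv.Perm.sign σ : ℤ) : F)

theorem signIn_mul (σ τ : Equiv.Perm (Fin m)) : signIn F (σ * τ) = signIn F σ * signIn F τ := by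
  simp [signIn]

theorem signIn_mul_self (σ : Equiv.Perm (Fin m)) : signIn F σ * signIn F σ = 1 := by
  rcases Int.units_eq_one_or (Equiv.Perm.sign σ) with h | h <;> simp [signIn, h]

open Classical in
/-- The sum of the permutations which preserve a labelling. -/
noncomputable def labelSum (f : Fin m → ℕ) : MonoidAlgebra F (Equiv.Perm (Fin m)) :=
  ∑ σ : Equiv.Perm (Fin m) with σ ∈ labelStabilizer f, MonoidAlgebra.single σ 1

open Classical in
/-- The signed sum of the permutations which preserve a labelling. -/
noncomputable def labelSignSum (f : Fin m → ℕ) : MonoidAlgebra F (Equiv.Perm (Fin m)) :=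
  ∑ σ : Equiv.Perm (Fin m) with σ ∈ labelStabilizer f, MonoidAlgebra.single σ (signIn F σ)

variable {F}

theorem single_mul_labelSum {f : Fin m → ℕ} {τ : Equiv.Perm (Fin m)} (h : τ ∈ labelStabilizer f) :
    MonoidAlgebra.single τ 1 * labelSum F f = labelSum F f := by
  classical
  unfold labelSum
  rw [Finset.mul_sum]
  refine Finset.sum_bij (fun σ _ => τ * σ) ?_ ?_ ?_ ?_
  · intro σ hσ
    simp only [Finset.mem_filter, Finset.mem_univ, true_and] at hσ ⊢
    exact mul_mem h hσ
  · intro _ _ _ _ e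
    exact mul_left_cancel e
  · intro σ hσ
    simp only [Finset.mem_filter, Finset.mem_univ, true_and] at hσ
    exact ⟨τ⁻¹ * σ, by simpa using mul_mem (inv_mem h) hσ, by simp⟩
  · intro σ _
    simp [MonoidAlgebra.single_mul_single]

theorem labelSum_mul_single {f : Fin m → ℕ} {τ : Equiv.Perm (Fin m)} (h : τ ∈ labelStabilizer f) :
    labelSum F f * MonoidAlgebra.single τ 1 = labelSum F f := by
  classical
  unfold labelSum
  rw [Finset.sum_mul]
  refine Finset.sum_bij (fun σ _ => σ * τ) ?_ ?_ ?_ ?_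
  · intro σ hσ
    simp only [Finset.mem_filter, Finset.mem_univ, true_and] at hσ ⊢
    exact mul_mem hσ h
  · intro _ _ _ _ e
    exact mul_right_cancel e
  · intro σ hσ
    simp only [Finset.mem_filter, Finset.mem_univ, true_and] at hσ
    exact ⟨σ * τ⁻¹, by simpa using mul_mem hσ (inv_mem h), by simp⟩
  · intro σ _
    simp [MonoidAlgebra.single_mul_single]

theorem single_mul_labelSignSum {f : Fin m → ℕ} {τ : Equiv.Perm (Fin m)}
    (h : τ ∈ labelStabilizer f) :
    MonoidAlgebra.single τ 1 * labelSignSum F f = signIn F τ • labelSignSum F f := by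
  classical
  unfold labelSignSum
  rw [Finset.mul_sum, Finset.smul_sum]
  refine Finset.sum_bij (fun σ _ => τ * σ) ?_ ?_ ?_ ?_
  · intro σ hσ
    simp only [Finset.mem_filter, Finset.mem_univ, true_and] at hσ ⊢
    exact mul_mem h hσ
  · intro _ _ _ _ e
    exact mul_left_cancel e
  · intro σ hσ
    simp only [Finset.mem_filter, Finset.mem_univ, true_and] at hσ
    exact ⟨τ⁻¹ * σ, by simpa using mul_mem (inv_mem h) hσ, by simp⟩
  · intro σ _
    rw [MonoidAlgebra.single_mul_single, MonoidAlgebra.smul_single, signIn_mul, smul_eq_mul,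
      ← mul_assoc, signIn_mul_self]

theorem labelSignSum_mul_single {f : Fin m → ℕ} {τ : Equiv.Perm (Fin m)}
    (h : τ ∈ labelStabilizer f) :
    labelSignSum F f * MonoidAlgebra.single τ 1 = signIn F τ • labelSignSum F f := by
  classical
  unfold labelSignSum
  rw [Finset.sum_mul, Finset.smul_sum]
  refine Finset.sum_bij (fun σ _ => σ * τ) ?_ ?_ ?_ ?_
  · intro σ hσ
    simp only [Finset.mem_filter, Finset.mem_univ, true_and] at hσ ⊢
    exact mul_mem hσ h
  · intro _ _ _ _ e
    exact mul_right_cancel e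
  · intro σ hσ
    simp only [Finset.mem_filter, Finset.mem_univ, true_and] at hσ
    exact ⟨σ * τ⁻¹, by simpa using mul_mem hσ (inv_mem h), by simp⟩
  · intro σ _
    rw [MonoidAlgebra.single_mul_single, MonoidAlgebra.smul_single, signIn_mul, smul_eq_mul,
      mul_left_comm, signIn_mul_self]

theorem signIn_swap {a b : Fin m} (h : a ≠ b) : signIn F (Equiv.swap a b) = -1 := by
  simp [signIn, Equiv.Perm.sign_swap h]

theorem eq_zero_of_eq_neg' [CharZero F] {V : Type*} [AddCommGroup V] [Module F V] {v : V}
    (h : v = (-1 : F) • v) : v = 0 := by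
  have h1 : (2 : F) • v = 0 := by
    rw [two_smul]
    nth_rewrite 2 [h]
    rw [neg_smul, one_smul, add_neg_cancel]
  exact (smul_eq_zero.1 h1).resolve_left two_ne_zero

theorem swap_mul_eq {a b : Fin m} (g : Equiv.Perm (Fin m)) :
    Equiv.swap (g a) (g b) * g = g * Equiv.swap a b := by
  rw [Equiv.mul_swap_eq_swap_mul]

/-- The transposition of `a` and `b` can be absorbed on the right at the cost of a sign, or moved
past `g` and absorbed on the left at no cost. The product thus equals its negative. -/
theorem labelSum_mul_labelSignSum_eq_zero [CharZero F] (f f' : Fin m → ℕ)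
    (g : Equiv.Perm (Fin m)) {a b : Fin m} (hab : a ≠ b) (h : f (g a) = f (g b))
    (h' : f' a = f' b) :
    labelSum F f * MonoidAlgebra.single g 1 * labelSignSum F f' = 0 := by
  have hs : MonoidAlgebra.single g (1 : F) * MonoidAlgebra.single (Equiv.swap a b) 1 =
      MonoidAlgebra.single (Equiv.swap (g a) (g b)) 1 * MonoidAlgebra.single g 1 := by
    rw [MonoidAlgebra.single_mul_single, MonoidAlgebra.single_mul_single, swap_mul_eq]
  refine eq_zero_of_eq_neg' (F := F) ?_
  rw [← signIn_swap (F := F) hab, ← mul_smul_comm,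
    ← single_mul_labelSignSum (swap_mem_labelStabilizer h'), ← mul_assoc, mul_assoc (labelSum F f)
      (MonoidAlgebra.single g 1) (MonoidAlgebra.single (Equiv.swap a b) 1),
    hs, ← mul_assoc, labelSum_mul_single (swap_mem_labelStabilizer h)]

theorem labelSignSum_mul_labelSum_eq_zero [CharZero F] (f f' : Fin m → ℕ)
    (g : Equiv.Perm (Fin m)) {a b : Fin m} (hab : a ≠ b) (h : f (g a) = f (g b))
    (h' : f' a = f' b) :
    labelSignSum F f * MonoidAlgebra.single g 1 * labelSum F f' = 0 := by
  have hs : MonoidAlgebra.single g (1 : F) * MonoidAlgebra.single (Equiv.swap a b) 1 =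
      MonoidAlgebra.single (Equiv.swap (g a) (g b)) 1 * MonoidAlgebra.single g 1 := by
    rw [MonoidAlgebra.single_mul_single, MonoidAlgebra.single_mul_single, swap_mul_eq]
  refine eq_zero_of_eq_neg' (F := F) ?_
  rw [← signIn_swap (F := F) (g.injective.ne hab), ← smul_mul_assoc, ← smul_mul_assoc,
    ← labelSignSum_mul_single (swap_mem_labelStabilizer h), mul_assoc (labelSignSum F f)
      (MonoidAlgebra.single (Equiv.swap (g a) (g b)) 1) (MonoidAlgebra.single g 1), ← hs,
    ← mul_assoc, mul_assoc _ (MonoidAlgebra.single (Equiv.swap a b) 1),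
    single_mul_labelSum (swap_mem_labelStabilizer h')]

/-- The labels of the entries of a filling by their rows. -/
def rowLabel {ν : YoungDiagram} (t : Fin m ≃ ν.cells) (e : Fin m) : ℕ := (t e).1.1

/-- The labels of the entries of a filling by their columns. -/
def colLabel {ν : YoungDiagram} (t : Fin m ≃ ν.cells) (e : Fin m) : ℕ := (t e).1.2

variable (F) in
/-- The Young symmetrizer of a filling. -/
noncomputable def symmetrizer {ν : YoungDiagram} (t : Fin m ≃ ν.cells) :
    MonoidAlgebra F (Equiv.Perm (Fin m)) :=
  labelSignSum F (colLabel t) * labelSum F (rowLabel t)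

theorem exists_smul_of_forall_single {G : Type*} [Group G] (a b z : MonoidAlgebra F G)
    (h : ∀ g : G, ∃ c : F, a * MonoidAlgebra.single g 1 * b = c • z) (w : MonoidAlgebra F G) :
    ∃ c : F, a * w * b = c • z := by
  induction w using MonoidAlgebra.induction_on with
  | of g => exact h g
  | add v w hv hw =>
    obtain ⟨c, hc⟩ := hv
    obtain ⟨d, hd⟩ := hw
    exact ⟨c + d, by rw [mul_add, add_mul, hc, hd, add_smul]⟩
  | smul r w hw =>
    obtain ⟨c, hc⟩ := hw
    exact ⟨r * c, by rw [mul_smul_comm, smul_mul_assoc, hc, smul_smul]⟩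

/-- By linearity `w` may be a permutation `g`. Either two entries of one row are sent by `g` to one
column, and the product vanishes, or `g` is a column permutation times a row permutation, and the
product is the symmetrizer up to sign. -/
theorem exists_smul_symmetrizer [CharZero F] {ν : YoungDiagram} (t : Fin m ≃ ν.cells)
    (w : MonoidAlgebra F (Equiv.Perm (Fin m))) :
    ∃ c : F, labelSignSum F (colLabel t) * w * labelSum F (rowLabel t) = c • symmetrizer F t := by
  refine exists_smul_of_forall_single _ _ _ (fun g => ?_) w
  by_cases h : ∃ a b, a ≠ b ∧ rowLabel t a = rowLabel t b ∧ colLabel t (g a) = colLabel t (g b)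
  · obtain ⟨a, b, hab, h1, h2⟩ := h
    exact ⟨0, by rw [labelSignSum_mul_labelSum_eq_zero _ _ g hab h2 h1, zero_smul]⟩
  · push Not at h
    obtain ⟨ρ, hρ⟩ := exists_perm_of_transversal t (g.trans t)
      (fun a b h1 h2 => by_contra fun hab => h a b hab h1 h2)
    have hr : ρ ∈ labelStabilizer (rowLabel t) := fun e => (hρ e).1
    have hc : g * ρ⁻¹ ∈ labelStabilizer (colLabel t) := fun e => by
      have := (hρ (ρ⁻¹ e)).2
      rw [show ρ (ρ⁻¹ e) = e from ρ.apply_symm_apply e] at this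
      exact this.symm
    refine ⟨signIn F (g * ρ⁻¹), ?_⟩
    have : MonoidAlgebra.single g (1 : F) =
        MonoidAlgebra.single (g * ρ⁻¹) 1 * MonoidAlgebra.single ρ 1 := by
      rw [MonoidAlgebra.single_mul_single]
      simp
    rw [this, ← mul_assoc, labelSignSum_mul_single hc, mul_assoc, single_mul_labelSum hr,
      smul_mul_assoc]
    rfl

theorem symmetrizer_mul_mul_symmetrizer [CharZero F] {ν : YoungDiagram} (t : Fin m ≃ ν.cells)
    (w : MonoidAlgebra F (Equiv.Perm (Fin m))) :
    ∃ c : F, symmetrizer F t * w * symmetrizer F t = c • symmetrizer F t := by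
  obtain ⟨c, hc⟩ := exists_smul_symmetrizer t
    (labelSum F (rowLabel t) * w * labelSignSum F (colLabel t))
  refine ⟨c, ?_⟩
  rw [← hc]
  simp only [symmetrizer, mul_assoc]

/-- Without dominance no filling of `ν` is transversal to one of `ν'`, so every permutation placed
between the row sum of `t` and the column sum of `t'` gives zero. -/
theorem symmetrizer_mul_mul_symmetrizer_eq_zero [CharZero F] {ν ν' : YoungDiagram}
    (t : Fin m ≃ ν.cells) (t' : Fin m ≃ ν'.cells) (h : ¬ topBoxes ν ≤ topBoxes ν')
    (w : MonoidAlgebra F (Equiv.Perm (Fin m))) :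
    symmetrizer F t * w * symmetrizer F t' = 0 := by
  have key : ∃ c : F, labelSum F (rowLabel t) * w * labelSignSum F (colLabel t') =
      c • (0 : MonoidAlgebra F (Equiv.Perm (Fin m))) := by
    refine exists_smul_of_forall_single _ _ _ (fun g => ⟨0, ?_⟩) w
    have : ∃ a b, a ≠ b ∧ rowLabel t (g a) = rowLabel t (g b) ∧ colLabel t' a = colLabel t' b := by
      by_contra! h1
      exact h (topBoxes_le_of_transversal (g.trans t) t'
        (fun a b h2 h3 => by_contra fun hab => h1 a b hab h2 h3))
    obtain ⟨a, b, hab, h1, h2⟩ := this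
    rw [labelSum_mul_labelSignSum_eq_zero _ _ g hab h1 h2, zero_smul]
  obtain ⟨c, hc⟩ := key
  rw [smul_zero] at hc
  have : symmetrizer F t * w * symmetrizer F t' = labelSignSum F (colLabel t) *
      (labelSum F (rowLabel t) * w * labelSignSum F (colLabel t')) * labelSum F (rowLabel t') := by
    simp only [symmetrizer, mul_assoc]
  rw [this, hc, mul_zero, zero_mul]

/-- Only the identity preserves both rows and columns, so σ = τ = 1 is the only pair with στ = 1. -/
theorem coeff_one_symmetrizer {ν : YoungDiagram} (t : Fin m ≃ ν.cells) :
    (symmetrizer F t).coeff 1 = 1 := by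
  classical
  unfold symmetrizer labelSignSum labelSum
  rw [Finset.sum_mul_sum, MonoidAlgebra.coeff_sum, Finsupp.finsetSum_apply,
    Finset.sum_eq_single 1, MonoidAlgebra.coeff_sum, Finsupp.finsetSum_apply,
    Finset.sum_eq_single 1]
  · simp [MonoidAlgebra.single_mul_single, signIn]
  · intro τ _ hτ
    rw [MonoidAlgebra.single_mul_single, MonoidAlgebra.coeff_single, Finsupp.single_apply, if_neg]
    rwa [one_mul]
  · intro h
    exact absurd (by simp [one_mem]) h
  · intro σ hσ hσ1
    rw [MonoidAlgebra.coeff_sum, Finsupp.finsetSum_apply]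
    refine Finset.sum_eq_zero fun τ hτ => ?_
    rw [MonoidAlgebra.single_mul_single, MonoidAlgebra.coeff_single, Finsupp.single_apply, if_neg]
    intro h
    refine hσ1 (Equiv.ext fun e => ?_)
    simp only [Finset.mem_filter, Finset.mem_univ, true_and] at hσ hτ
    have hτ' : τ⁻¹ ∈ labelStabilizer (rowLabel t) := inv_mem hτ
    rw [← eq_inv_of_mul_eq_one_left h] at hτ'
    exact t.injective (Subtype.ext (Prod.ext (hτ' e) (hσ e)))
  · intro h
    exact absurd (by simp [one_mem]) h

/-- The left ideal generated by a Young symmetrizer is minimal. -/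
theorem symmetrizer_mem_of_mem [CharZero F] {ν : YoungDiagram} (t : Fin m ≃ ν.cells)
    (s : MonoidAlgebra F (Equiv.Perm (Fin m))) (hs : s ∈ Ideal.span {symmetrizer F t})
    (h0 : s ≠ 0) : symmetrizer F t ∈ Ideal.span {s} := by
  have hc : ∀ y ∈ Ideal.span {s}, ∃ a, y = a * symmetrizer F t := by
    intro y hy
    have hle : Ideal.span {s} ≤ Ideal.span {symmetrizer F t} :=
      (Ideal.span_singleton_le_iff_mem _).2 hs
    obtain ⟨a, ha⟩ := Ideal.mem_span_singleton'.1 (hle hy)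
    exact ⟨a, ha.symm⟩
  -- If the symmetrizer annihilates the left ideal of `s` from the left, that ideal has square zero,
  -- because each of its elements ends in the symmetrizer; then it vanishes by semisimplicity.
  by_cases h : ∀ y ∈ Ideal.span {s}, symmetrizer F t * y = 0
  · refine absurd ?_ h0
    have hbot : Ideal.span {s} = ⊥ := by
      refine eq_bot_of_mul_eq_zero _ fun a ha b hb => ?_
      obtain ⟨a', rfl⟩ := hc a ha
      rw [mul_assoc, h b hb, mul_zero]
    exact Ideal.span_singleton_eq_bot.1 hbot
  · push Not at h
    obtain ⟨y, hy, hy0⟩ := h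
    obtain ⟨a, ha⟩ := hc y hy
    -- With z the symmetrizer and y = az, the product zy = zaz is a multiple of z; it is nonzero, so
    -- z can be recovered from y.
    obtain ⟨c, hcc⟩ := symmetrizer_mul_mul_symmetrizer t a
    have hzy : symmetrizer F t * y = c • symmetrizer F t := by rw [ha, ← mul_assoc, hcc]
    have hc0 : c ≠ 0 := by
      rintro rfl
      exact hy0 (by rw [hzy, zero_smul])
    have : symmetrizer F t = (c⁻¹ • symmetrizer F t) * y := by
      rw [smul_mul_assoc, hzy, smul_smul, inv_mul_cancel₀ hc0, one_smul]
    rw [this]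
    exact Ideal.mul_mem_left _ _ hy

end

end DiagramAlgebra

/-! ### The centre of the group algebra, and simplicity of Specht modules -/

namespace DiagramAlgebra

section

variable {F : Type*} [Field F] {m : ℕ}

/-- The sum of the conjugates of a Young symmetrizer. -/
noncomputable def centralSymmetrizer (F : Type*) [Field F] {m : ℕ} {ν : YoungDiagram}
    (t : Fin m ≃ ν.cells) : MonoidAlgebra F (Equiv.Perm (Fin m)) :=
  ∑ g : Equiv.Perm (Fin m),
    MonoidAlgebra.single g 1 * symmetrizer F t * MonoidAlgebra.single g⁻¹ 1

theorem single_mul_centralSymmetrizer {ν : YoungDiagram} (t : Fin m ≃ ν.cells)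
    (h : Equiv.Perm (Fin m)) :
    MonoidAlgebra.single h 1 * centralSymmetrizer F t =
      centralSymmetrizer F t * MonoidAlgebra.single h 1 := by
  unfold centralSymmetrizer
  rw [Finset.mul_sum, Finset.sum_mul]
  refine Fintype.sum_equiv (Equiv.mulLeft h) _ _ fun g => ?_
  rw [Equiv.coe_mulLeft, mul_assoc (_ * _) (MonoidAlgebra.single (h * g)⁻¹ (1 : F)),
    MonoidAlgebra.single_mul_single, mul_inv_rev, inv_mul_cancel_right, ← mul_assoc, ← mul_assoc,
    MonoidAlgebra.single_mul_single, one_mul]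

theorem mul_centralSymmetrizer {ν : YoungDiagram} (t : Fin m ≃ ν.cells)
    (w : MonoidAlgebra F (Equiv.Perm (Fin m))) :
    w * centralSymmetrizer F t = centralSymmetrizer F t * w := by
  induction w using MonoidAlgebra.induction_on with
  | of g => exact single_mul_centralSymmetrizer t g
  | add v w hv hw => rw [add_mul, mul_add, hv, hw]
  | smul r w hw => rw [smul_mul_assoc, mul_smul_comm, hw]

/-- Every conjugate has coefficient one at the identity, so the sum has the order of the group
there. -/
theorem centralSymmetrizer_ne_zero [CharZero F] {ν : YoungDiagram} (t : Fin m ≃ ν.cells) :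
    centralSymmetrizer F t ≠ 0 := by
  intro h
  have h1 : (centralSymmetrizer F t).coeff 1 = (Fintype.card (Equiv.Perm (Fin m)) : F) := by
    unfold centralSymmetrizer
    rw [MonoidAlgebra.coeff_sum, Finsupp.finsetSum_apply]
    have : ∀ g : Equiv.Perm (Fin m), (MonoidAlgebra.single g 1 * symmetrizer F t *
        MonoidAlgebra.single g⁻¹ 1).coeff 1 = 1 := by
      intro g
      rw [MonoidAlgebra.coeff_mul_single_apply, MonoidAlgebra.coeff_single_mul_apply]
      simp [coeff_one_symmetrizer]
    rw [Finset.sum_congr rfl fun g _ => this g]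
    simp
  rw [h] at h1
  exact Nat.cast_ne_zero.2 Fintype.card_ne_zero h1.symm

/-- If the central element killed the symmetrizer, it would kill all its conjugates and hence their
sum, itself. A central element of square zero generates a left ideal of square zero. -/
theorem centralSymmetrizer_mul_symmetrizer_ne_zero [CharZero F] {ν : YoungDiagram}
    (t : Fin m ≃ ν.cells) : centralSymmetrizer F t * symmetrizer F t ≠ 0 := by
  intro h
  refine centralSymmetrizer_ne_zero (F := F) t ?_
  have hff : centralSymmetrizer F t * centralSymmetrizer F t = 0 := by
    nth_rewrite 2 [centralSymmetrizer]
    rw [Finset.mul_sum]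
    refine Finset.sum_eq_zero fun g _ => ?_
    rw [← mul_assoc, ← mul_assoc, ← mul_centralSymmetrizer, mul_assoc (MonoidAlgebra.single g _), h,
      mul_zero, zero_mul]
  refine Ideal.span_singleton_eq_bot.1 (eq_bot_of_mul_eq_zero _ fun a ha b hb => ?_)
  obtain ⟨a, rfl⟩ := Ideal.mem_span_singleton'.1 ha
  obtain ⟨b, rfl⟩ := Ideal.mem_span_singleton'.1 hb
  rw [mul_centralSymmetrizer t b, mul_assoc a, ← mul_assoc (centralSymmetrizer F t), hff, zero_mul,
    mul_zero]

theorem centralSymmetrizer_mul_symmetrizer_eq_zero [CharZero F] {ν ν' : YoungDiagram}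
    (t : Fin m ≃ ν.cells) (t' : Fin m ≃ ν'.cells) (h : ¬ topBoxes ν ≤ topBoxes ν') :
    centralSymmetrizer F t * symmetrizer F t' = 0 := by
  unfold centralSymmetrizer
  rw [Finset.sum_mul]
  refine Finset.sum_eq_zero fun g _ => ?_
  rw [mul_assoc _ (MonoidAlgebra.single g⁻¹ 1), mul_assoc (MonoidAlgebra.single g 1),
    ← mul_assoc (symmetrizer F t), symmetrizer_mul_mul_symmetrizer_eq_zero t t' h, mul_zero]

/-- The central elements of the group algebra. -/
def centralElements (F : Type*) [Field F] (m : ℕ) :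
    Submodule F (MonoidAlgebra F (Equiv.Perm (Fin m))) where
  carrier := {w | ∀ g : Equiv.Perm (Fin m),
    MonoidAlgebra.single g 1 * w = w * MonoidAlgebra.single g 1}
  add_mem' := fun {v w} hv hw g => by rw [mul_add, add_mul, hv, hw]
  zero_mem' := fun g => by rw [mul_zero, zero_mul]
  smul_mem' := fun r w hw g => by rw [mul_smul_comm, smul_mul_assoc, hw]

theorem coeff_conj_of_mem_centralElements {w : MonoidAlgebra F (Equiv.Perm (Fin m))}
    (hw : w ∈ centralElements F m) (g h : Equiv.Perm (Fin m)) :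
    w.coeff (g * h * g⁻¹) = w.coeff h := by
  have h1 := congrArg (fun v => v.coeff (g * h)) (hw g)
  simp only [MonoidAlgebra.coeff_mul_single_apply, MonoidAlgebra.coeff_single_mul_apply] at h1
  simpa using h1.symm

/-- A central element is constant on conjugacy classes, and a class is determined by its cycle type.
The form `Fintype.card (Fin m)` is the one in which cycle types are given as partitions. -/
theorem finrank_centralElements_le (F : Type*) [Field F] (m : ℕ) :
    Module.finrank F (centralElements F m) ≤
      Fintype.card (Fintype.card (Fin m)).Partition := by
  classical
  let f : centralElements F m →ₗ[F] (ConjClasses (Equiv.Perm (Fin m)) → F) :=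
    { toFun := fun w c => w.1.coeff c.out
      map_add' := fun _ _ => rfl
      map_smul' := fun _ _ => rfl }
  have hf : Function.Injective f := by
    rw [injective_iff_map_eq_zero]
    intro w hw
    ext g
    obtain ⟨c, hc⟩ := isConj_iff.1 (ConjClasses.mk_eq_mk_iff_isConj.1
      (Quotient.out_eq (ConjClasses.mk g)))
    have h1 := congrFun hw (ConjClasses.mk g)
    have h2 := coeff_conj_of_mem_centralElements w.2 c (ConjClasses.mk g).out
    rw [hc] at h2
    exact h2.trans h1
  refine (LinearMap.finrank_le_finrank_of_injective hf).trans ?_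
  rw [Module.finrank_fintype_fun_eq_card]
  refine Fintype.card_le_of_injective (fun c => c.out.partition) fun c d h => ?_
  have h1 := ConjClasses.mk_eq_mk_iff_isConj.2 (Equiv.Perm.partition_eq_of_isConj.2 h)
  have hc : ∀ c : ConjClasses (Equiv.Perm (Fin m)), ConjClasses.mk c.out = c :=
    fun c => Quotient.out_eq c
  rwa [hc, hc] at h1

/-- The standard filling with a prescribed number of entries. -/
noncomputable def filling {m : ℕ} (ν : YoungDiagram) (h : ν.card = m) : Fin m ≃ ν.cells :=
  (finCongr h.symm).trans (tableau ν)

/-- The Young symmetrizers generate the group algebra of the symmetric group as a two-sided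
ideal. -/
theorem one_mem_of_symmetrizers_mem [CharZero F]
    (K : Submodule F (MonoidAlgebra F (Equiv.Perm (Fin m))))
    (hK : ∀ (ν : YoungDiagram) (h : ν.card = m) (a b : MonoidAlgebra F (Equiv.Perm (Fin m))),
      a * symmetrizer F (filling ν h) * b ∈ K) : 1 ∈ K := by
  classical
  have hm : Fintype.card (Fin m) = m := Fintype.card_fin m
  let I := (Fintype.card (Fin m)).Partition
  let t : (p : I) → Fin m ≃ (partitionDiagram p).cells := fun p =>
    filling (partitionDiagram p) ((card_partitionDiagram p).trans hm)
  let v : I → centralElements F m := fun p =>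
    ⟨centralSymmetrizer F (t p), fun g => single_mul_centralSymmetrizer _ g⟩
  -- The family is triangular for dominance: in a relation, multiplying by the symmetrizer of a
  -- shape that is minimal among those with nonzero coefficient leaves only the term of that shape.
  have hv : LinearIndependent F v := by
    rw [Fintype.linearIndependent_iff]
    intro c hc
    by_contra! hne
    obtain ⟨p, hp⟩ := Finset.exists_minimalFor (fun p : I => topBoxes (partitionDiagram p))
      (Finset.univ.filter fun p => c p ≠ 0) (by
        obtain ⟨p, hp⟩ := hne
        exact ⟨p, by simpa using hp⟩)
    have hcp : c p ≠ 0 := by simpa using hp.1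
    have h1 : ∑ q, c q • centralSymmetrizer F (t q) = 0 := by
      simpa [v] using congrArg (Submodule.subtype _) hc
    have h2 := congrArg (· * symmetrizer F (t p)) h1
    simp only [Finset.sum_mul, smul_mul_assoc, zero_mul] at h2
    rw [Finset.sum_eq_single p] at h2
    · exact (smul_eq_zero.1 h2).elim hcp (centralSymmetrizer_mul_symmetrizer_ne_zero _)
    · intro q _ hqp
      by_cases hq : c q = 0
      · rw [hq, zero_smul]
      · rw [centralSymmetrizer_mul_symmetrizer_eq_zero, smul_zero]
        intro hle
        refine hqp (partitionDiagram_injective (topBoxes_injective (le_antisymm hle ?_)))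
        exact hp.2 (by simpa using hq) hle
    · exact fun h => absurd (Finset.mem_univ _) h
  -- There is one independent central element per partition, and the dimension is at most the number
  -- of partitions. So these elements span the centre, which contains 1.
  have hcard : Fintype.card I = Module.finrank F (centralElements F m) :=
    le_antisymm hv.fintype_card_le_finrank (finrank_centralElements_le F m)
  have hspan := hv.span_eq_top_of_card_eq_finrank' hcard
  have h1 : (⟨1, fun g => by rw [mul_one, one_mul]⟩ : centralElements F m) ∈
      Submodule.span F (Set.range v) := by
    rw [hspan]
    trivial
  have h2 : Submodule.span F (Set.range v) ≤ K.comap (Submodule.subtype _) := by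
    rw [Submodule.span_le]
    rintro _ ⟨p, rfl⟩
    exact Submodule.sum_mem _ fun g _ => hK _ _ _ _
  exact h2 h1

theorem symmetrizer_tableau (ν : YoungDiagram) :
    symmetrizer F (tableau ν) = colSum F ν * rowSum F ν := by
  classical
  have h1 : labelSignSum F (colLabel (tableau ν)) = colSum F ν := by
    unfold labelSignSum colSum
    refine Finset.sum_congr (Finset.filter_congr fun σ _ => Iff.rfl) fun _ _ => rfl
  have h2 : labelSum F (rowLabel (tableau ν)) = rowSum F ν := by
    unfold labelSum rowSum
    refine Finset.sum_congr (Finset.filter_congr fun σ _ => Iff.rfl) fun _ _ => rfl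
  rw [symmetrizer, h1, h2]

theorem specht_eq_span (ν : YoungDiagram) :
    specht F ν = Ideal.span {symmetrizer F (tableau ν)} := by
  rw [symmetrizer_tableau]
  rfl

/-- A nonzero vector of a Specht module generates it. -/
theorem exists_smul_eq_of_spechtModule [CharZero F] {ν : YoungDiagram} {s : SpechtModule F ν}
    (hs : s ≠ 0) (s' : SpechtModule F ν) :
    ∃ a : MonoidAlgebra F (Equiv.Perm (Fin ν.card)), a • s = s' := by
  obtain ⟨s, h⟩ := s
  obtain ⟨s', h'⟩ := s'
  have hs0 : s ≠ 0 := fun h0 => hs (Subtype.ext h0)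
  rw [specht_eq_span] at h h'
  have h1 := symmetrizer_mem_of_mem (tableau ν) s h hs0
  have h2 := (Ideal.span_singleton_le_iff_mem _).2 h1 h'
  obtain ⟨a, ha⟩ := Ideal.mem_span_singleton'.1 h2
  exact ⟨a, Subtype.ext ha⟩

end

end DiagramAlgebra

namespace DiagramAlgebra

/-! ### Products of special diagrams -/

section reflection

variable {T M N : Type*}

/-- The reflection of a diagram which exchanges the two rows. -/
def reflect (a : Setoid (T ⊕ M)) : Setoid (M ⊕ T) := a.comap Sum.swap

theorem reflect_reflect (a : Setoid (T ⊕ M)) : reflect (reflect a) = a := by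
  ext (p | p) (q | q) <;> rfl

theorem map_equiv_eq_comap {X Y : Type*} (e : X ≃ Y) (S : Setoid X) :
    S.map e = S.comap e.symm := by
  ext y z
  rw [map_iff e.injective]
  constructor
  · rintro (rfl | ⟨u, v, h, rfl, rfl⟩)
    · exact Setoid.refl' _ _
    · change S _ _
      simpa using h
  · intro h
    exact Or.inr ⟨e.symm y, e.symm z, h, by simp, by simp⟩

theorem reflect_eq_map (a : Setoid (T ⊕ M)) : reflect a = a.map Sum.swap :=
  (map_equiv_eq_comap (Equiv.sumComm T M) a).symm

/-- The reflection of three rows. -/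
def reverseRows (T M N : Type*) : T ⊕ (M ⊕ N) ≃ N ⊕ (M ⊕ T) where
  toFun := Sum.elim (Sum.inr ∘ Sum.inr) (Sum.elim (Sum.inr ∘ Sum.inl) Sum.inl)
  invFun := Sum.elim (Sum.inr ∘ Sum.inr) (Sum.elim (Sum.inr ∘ Sum.inl) Sum.inl)
  left_inv := by rintro (x | x | x) <;> rfl
  right_inv := by rintro (x | x | x) <;> rfl

theorem glue_reflect (a : Setoid (T ⊕ M)) (b : Setoid (M ⊕ N)) :
    glue (reflect b) (reflect a) = (glue a b).map (reverseRows T M N) := by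
  unfold glue
  rw [reflect_eq_map, reflect_eq_map, map_sup', map_map', map_map', map_map', map_map', sup_comm]
  congr 2
  · funext x
    rcases x with x | x <;> rfl
  · funext x
    rcases x with x | x <;> rfl

theorem comp_reflect (a : Setoid (T ⊕ M)) (b : Setoid (M ⊕ N)) :
    comp (reflect b) (reflect a) = reflect (comp a b) := by
  unfold comp
  rw [glue_reflect, map_equiv_eq_comap]
  ext (p | p) (q | q) <;> rfl

/-- The row reversal is a bijection, hence a degenerate `Square`, along which `missing` is
transported; the swap of the two outer rows does not change which components avoid them. -/
theorem innerComponents_reflect (a : Setoid (T ⊕ M)) (b : Setoid (M ⊕ N)) :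
    innerComponents (reflect b) (reflect a) = innerComponents a b := by
  have inj : Function.Injective (outer : T ⊕ N → T ⊕ (M ⊕ N)) := by
    rintro (x | x) (y | y) <;> simp [outer]
  have sq : Square (outer : T ⊕ N → T ⊕ (M ⊕ N)) (id : T ⊕ N → T ⊕ N) (reverseRows T M N)
      (reverseRows T M N ∘ outer) :=
    { inj_j := (reverseRows T M N).injective
      inj_f := (reverseRows T M N).injective.comp inj
      comm := fun _ => rfl
      pull := fun u p h => ⟨p, (reverseRows T M N).injective h.symm, rfl⟩
      cover := fun x => Or.inl ((reverseRows T M N).surjective x) }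
  unfold innerComponents
  rw [glue_reflect, ← sq.missing_map]
  unfold missing
  congr 1
  ext C
  refine and_congr_right fun _ => ⟨fun h p => ?_, fun h p => ?_⟩
  · have := h p.swap
    rcases p with p | p <;> exact this
  · have := h p.swap
    rcases p with p | p <;> exact this

end reflection

variable {n : ℕ}

theorem reflect_mem_diagrams {k : Kind} {d : Setoid (Fin n ⊕ Fin n)} (hd : d ∈ diagrams k n) :
    reflect d ∈ diagrams k n := by
  have h1 : ∀ d : Setoid (Fin n ⊕ Fin n), IsPartialOneFactor d →
      IsPartialOneFactor (reflect d) := by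
    intro d h p q r hq hr
    have := h p.swap q.swap r.swap hq hr
    simpa [(Sum.swap_leftInverse).injective.eq_iff] using this
  have h2 : ∀ d : Setoid (Fin n ⊕ Fin n), NoHorizontalArc d → NoHorizontalArc (reflect d) :=
    fun d h => ⟨h.2, h.1⟩
  cases k
  · exact h1 d hd
  · exact ⟨h1 d hd.1, h2 d hd.2⟩

theorem verticalArcs_reflect (d : Setoid (Fin n ⊕ Fin n)) :
    verticalArcs (reflect d) = verticalArcs d := by
  unfold verticalArcs
  rw [← Set.ncard_image_of_injective _ (Prod.swap_injective)]
  congr 1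
  ext ⟨i, j⟩
  simp only [Set.mem_image, Set.mem_ofPred_eq, Prod.exists, Prod.swap_prod_mk, Prod.mk.injEq]
  constructor
  · rintro ⟨a, b, h, rfl, rfl⟩
    exact d.symm h
  · intro h
    exact ⟨j, i, d.symm h, rfl, rfl⟩

/-- Each top vertex is joined to exactly one middle vertex, so the stacked graph retracts onto its
two lower rows. -/
theorem glue_permDiagram_left (π : Equiv.Perm (Fin n)) (a : Setoid (Fin n ⊕ Fin n)) :
    glue (permDiagram π) a = a.comap (Sum.elim (Sum.inl ∘ π.symm) id) := by
  apply le_antisymm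
  · refine sup_le (map_le_iff.2 ?_) (map_le_iff.2 fun p q h => h)
    have key : ∀ p : Fin n ⊕ Fin n, (Sum.elim (Sum.inl ∘ π.symm) id (Sum.map id Sum.inl p) :
        Fin n ⊕ Fin n) = Sum.inl (π.symm (Sum.elim id π p)) := by
      rintro (p | p) <;> simp
    intro p q h
    have h : Sum.elim id π p = Sum.elim id π q := h
    change a _ _
    rw [key, key, h]
  · have key : ∀ y : Fin n ⊕ (Fin n ⊕ Fin n),
        glue (permDiagram π) a y (Sum.inr (Sum.elim (Sum.inl ∘ π.symm) id y)) := by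
      rintro (y | y)
      · exact (le_sup_left : _ ≤ glue (permDiagram π) a) (map_intro (r := permDiagram π)
          (Sum.map id Sum.inl) (show permDiagram π (Sum.inl y) (Sum.inr (π.symm y)) from
            (π.apply_symm_apply y).symm))
      · exact Setoid.refl' _ _
    intro y z h
    exact Setoid.trans' _ (key y) (Setoid.trans' _
      ((le_sup_right : _ ≤ glue (permDiagram π) a) (map_intro Sum.inr h)) (Setoid.symm' _ (key z)))

theorem permDiagram_comp (π : Equiv.Perm (Fin n)) (a : Setoid (Fin n ⊕ Fin n)) :
    comp (permDiagram π) a = a.comap (Sum.map π.symm id) := by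
  unfold comp
  rw [glue_permDiagram_left]
  ext (p | p) (q | q) <;> rfl

theorem innerComponents_permDiagram_left (π : Equiv.Perm (Fin n)) (a : Setoid (Fin n ⊕ Fin n)) :
    innerComponents (permDiagram π) a = 0 := by
  unfold innerComponents missing
  rw [glue_permDiagram_left]
  refine (congrArg Set.ncard ?_).trans (Set.ncard_empty _)
  rw [Set.eq_empty_iff_forall_notMem]
  rintro _ ⟨⟨y, rfl⟩, h⟩
  rcases y with y | y | y
  · exact h (Sum.inl y) (a.refl _)
  · refine h (Sum.inl (π y)) ?_
    change a _ _
    simp [outer]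
  · exact h (Sum.inr y) (a.refl _)

theorem reflect_permDiagram (π : Equiv.Perm (Fin n)) :
    reflect (permDiagram π) = permDiagram π.symm := by
  ext (p | p) (q | q)
  · exact π.injective.eq_iff
  · exact (Equiv.eq_symm_apply π).symm
  · exact (Equiv.symm_apply_eq π).symm
  · exact π.symm.injective.eq_iff.symm

theorem comp_permDiagram (π : Equiv.Perm (Fin n)) (a : Setoid (Fin n ⊕ Fin n)) :
    comp a (permDiagram π) = a.comap (Sum.map id π) := by
  rw [← reflect_reflect (comp a (permDiagram π)), ← comp_reflect, reflect_permDiagram,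
    permDiagram_comp]
  ext (p | p) (q | q) <;> rfl

theorem permDiagram_mul (π ρ : Equiv.Perm (Fin n)) :
    comp (permDiagram π) (permDiagram ρ) = permDiagram (π * ρ) := by
  rw [comp_permDiagram]
  ext (p | p) (q | q) <;> rfl

/-- The diagram obtained by deleting the arcs that meet the complement of a set. -/
def restrict {V : Type*} (a : Setoid V) (K : Set V) : Setoid V where
  r p q := p = q ∨ (a p q ∧ p ∈ K ∧ q ∈ K)
  iseqv :=
    { refl := fun _ => Or.inl rfl
      symm := by
        rintro p q (rfl | ⟨h, hp, hq⟩)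
        · exact Or.inl rfl
        · exact Or.inr ⟨a.symm h, hq, hp⟩
      trans := by
        rintro p q r (rfl | ⟨h, hp, hq⟩) (rfl | ⟨h', hq', hr⟩)
        · exact Or.inl rfl
        · exact Or.inr ⟨h', hq', hr⟩
        · exact Or.inr ⟨h, hp, hq⟩
        · exact Or.inr ⟨a.trans h h', hp, hr⟩ }

theorem restrict_iff {V : Type*} {a : Setoid V} {K : Set V} {p q : V} :
    restrict a K p q ↔ p = q ∨ (a p q ∧ p ∈ K ∧ q ∈ K) := Iff.rfl

theorem restrict_le {V : Type*} (a : Setoid V) (K : Set V) : restrict a K ≤ a := by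
  rintro p q (rfl | ⟨h, -, -⟩)
  · exact a.refl _
  · exact h

/-- The vertices of both rows whose lower ones lie in `S`. -/
def keepBelow (S : Set (Fin n)) : Set (Fin n ⊕ Fin n) := {p | ∀ j, p = Sum.inr j → j ∈ S}

/-- The vertices of both rows whose upper ones lie in `S`. -/
def keepAbove (S : Set (Fin n)) : Set (Fin n ⊕ Fin n) := {p | ∀ j, p = Sum.inl j → j ∈ S}

theorem inl_mem_keepBelow {S : Set (Fin n)} {i : Fin n} : Sum.inl i ∈ keepBelow S :=
  fun _ h => absurd h Sum.inl_ne_inr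

theorem inr_mem_keepBelow {S : Set (Fin n)} {i : Fin n} : Sum.inr i ∈ keepBelow S ↔ i ∈ S :=
  ⟨fun h => h i rfl, fun h _ e => Sum.inr_injective e ▸ h⟩

theorem inr_mem_keepAbove {S : Set (Fin n)} {i : Fin n} : Sum.inr i ∈ keepAbove S :=
  fun _ h => absurd h Sum.inr_ne_inl

theorem inl_mem_keepAbove {S : Set (Fin n)} {i : Fin n} : Sum.inl i ∈ keepAbove S ↔ i ∈ S :=
  ⟨fun h => h i rfl, fun h _ e => Sum.inl_injective e ▸ h⟩

/-- Straight arcs at the vertices of `S` and loops at the other vertices. -/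
def partialStraight (S : Set (Fin n)) : Setoid (Fin n ⊕ Fin n) :=
  restrict (straight (Fin n)) (Sum.elim id id ⁻¹' S)

theorem loopDiagram_eq (n m : ℕ) : loopDiagram n m = partialStraight {i | i.val < m} := by
  ext p q
  refine or_congr_right ⟨fun h => ⟨h.1, h.2, ?_⟩, fun h => ⟨h.1, h.2.1⟩⟩
  change (Sum.elim id id q : Fin n).val < m
  rw [← h.1]
  exact h.2

theorem reflect_partialStraight (S : Set (Fin n)) :
    reflect (partialStraight S) = partialStraight S := by
  have key : ∀ p : Fin n ⊕ Fin n, Sum.elim id id p.swap = Sum.elim id id p := by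
    rintro (p | p) <;> rfl
  ext p q
  change (p.swap = q.swap ∨ (Sum.elim id id p.swap = Sum.elim id id q.swap ∧
    Sum.elim id id p.swap ∈ S ∧ Sum.elim id id q.swap ∈ S)) ↔ _
  rw [key, key, Sum.swap_leftInverse.injective.eq_iff]
  rfl

theorem comp_partialStraight (a : Setoid (Fin n ⊕ Fin n)) (S : Set (Fin n)) :
    comp a (partialStraight S) = restrict a (keepBelow S) := by
  classical
  apply le_antisymm
  -- A labelling that is constant on components: vertices carry their block of `a`, except that a
  -- bottom vertex outside `S`, being isolated, carries a label of its own.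
  · let f : Fin n ⊕ (Fin n ⊕ Fin n) → Quotient a ⊕ Fin n := Sum.elim
      (fun i => Sum.inl (Quotient.mk a (Sum.inl i))) (Sum.elim
      (fun i => Sum.inl (Quotient.mk a (Sum.inr i)))
      (fun i => if i ∈ S then Sum.inl (Quotient.mk a (Sum.inr i)) else Sum.inr i))
    have key : glue a (partialStraight S) ≤ Setoid.ker f := by
      refine sup_le (map_le_iff.2 ?_) (map_le_iff.2 ?_)
      · rintro (p | p) (q | q) h <;> exact congrArg Sum.inl (Quotient.sound h)
      · rintro (p | p) (q | q) (h | ⟨h, hp, hq⟩)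
        · rw [h]
        · have h : p = q := h
          rw [h]
        · exact absurd h Sum.inl_ne_inr
        · have h : p = q := h
          subst h
          have hp : p ∈ S := hp
          simp [Setoid.ker_def, f, hp]
        · exact absurd h Sum.inr_ne_inl
        · have h : p = q := h
          subst h
          have hp : p ∈ S := hp
          simp [Setoid.ker_def, f, hp]
        · rw [h]
        · have h : p = q := h
          rw [h]
    intro p q h
    have h1 : f (outer p) = f (outer q) := key h
    rw [restrict_iff]
    rcases p with p | p <;> rcases q with q | q
    · exact Or.inr ⟨Quotient.exact (Sum.inl_injective h1), inl_mem_keepBelow, inl_mem_keepBelow⟩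
    · by_cases hq : q ∈ S
      · simp only [f, outer, Sum.map_inl, Sum.map_inr, Sum.elim_inl, Sum.elim_inr, hq, if_true,
          id] at h1
        exact Or.inr ⟨Quotient.exact (Sum.inl_injective h1), inl_mem_keepBelow, inr_mem_keepBelow.2 hq⟩
      · simp [f, outer, hq] at h1
    · by_cases hp : p ∈ S
      · simp only [f, outer, Sum.map_inl, Sum.map_inr, Sum.elim_inl, Sum.elim_inr, hp, if_true,
          id] at h1
        exact Or.inr ⟨Quotient.exact (Sum.inl_injective h1), inr_mem_keepBelow.2 hp, inl_mem_keepBelow⟩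
      · simp [f, outer, hp] at h1
    · by_cases hp : p ∈ S <;> by_cases hq : q ∈ S
      · simp only [f, outer, Sum.map_inr, Sum.elim_inr, hp, hq, if_true] at h1
        exact Or.inr ⟨Quotient.exact (Sum.inl_injective h1), inr_mem_keepBelow.2 hp,
          inr_mem_keepBelow.2 hq⟩
      · simp [f, outer, hp, hq] at h1
      · simp [f, outer, hp, hq] at h1
      · simp only [f, outer, Sum.map_inr, Sum.elim_inr, hp, hq, if_false] at h1
        exact Or.inl (congrArg Sum.inr (Sum.inr_injective h1))
  · have key : ∀ p : Fin n ⊕ Fin n, p ∈ keepBelow S →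
        glue a (partialStraight S) (outer p) (Sum.map id Sum.inl p) := by
      rintro (p | p) hp
      · exact Setoid.refl' _ _
      · have hp : p ∈ S := inr_mem_keepBelow.1 hp
        exact (le_sup_right : _ ≤ glue a (partialStraight S)) (map_intro
          (r := partialStraight S) Sum.inr
          (show partialStraight S (Sum.inr p) (Sum.inl p) from Or.inr ⟨rfl, hp, hp⟩))
    rintro p q (rfl | ⟨h, hp, hq⟩)
    · exact Setoid.refl' _ _
    · change glue a (partialStraight S) (outer p) (outer q)
      exact Setoid.trans' _ (key p hp) (Setoid.trans' _
        ((le_sup_left : _ ≤ glue a (partialStraight S)) (map_intro _ h))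
        (Setoid.symm' _ (key q hq)))

theorem partialStraight_comp (a : Setoid (Fin n ⊕ Fin n)) (S : Set (Fin n)) :
    comp (partialStraight S) a = restrict a (keepAbove S) := by
  rw [← reflect_reflect (comp (partialStraight S) a), ← comp_reflect, reflect_partialStraight,
    comp_partialStraight]
  have key : ∀ p : Fin n ⊕ Fin n, p.swap ∈ keepBelow S ↔ p ∈ keepAbove S := by
    rintro (p | p)
    · exact inr_mem_keepBelow.trans inl_mem_keepAbove.symm
    · exact iff_of_true inl_mem_keepBelow inr_mem_keepAbove
  ext p q
  refine or_congr ?_ (and_congr ?_ (and_congr (key p) (key q)))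
  · exact Sum.swap_leftInverse.injective.eq_iff
  · change a _ _ ↔ _
    rw [Sum.swap_swap, Sum.swap_swap]

theorem partialStraight_perm (π : Equiv.Perm (Fin n)) (S : Set (Fin n)) :
    comp (permDiagram π) (comp (partialStraight S) (permDiagram π.symm)) =
      partialStraight (π.symm ⁻¹' S) := by
  rw [comp_permDiagram, permDiagram_comp]
  have key : ∀ p : Fin n ⊕ Fin n, Sum.elim id id (Sum.map π.symm π.symm p) =
      π.symm (Sum.elim id id p) := by
    rintro (p | p) <;> rfl
  have key' : ∀ p : Fin n ⊕ Fin n, Sum.map id π.symm (Sum.map π.symm id p) =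
      Sum.map π.symm π.symm p := by
    rintro (p | p) <;> rfl
  have inj : Function.Injective (Sum.map π.symm π.symm) :=
    Sum.map_injective.2 ⟨π.symm.injective, π.symm.injective⟩
  ext p q
  change partialStraight S (Sum.map id π.symm (Sum.map π.symm id p))
    (Sum.map id π.symm (Sum.map π.symm id q)) ↔ _
  rw [key', key']
  refine or_congr inj.eq_iff (and_congr ?_ (and_congr ?_ ?_))
  · change Sum.elim id id _ = Sum.elim id id _ ↔ Sum.elim id id _ = Sum.elim id id _
    rw [key, key, π.symm.injective.eq_iff]
  · change Sum.elim id id _ ∈ S ↔ _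
    rw [key]
    rfl
  · change Sum.elim id id _ ∈ S ↔ _
    rw [key]
    rfl

end DiagramAlgebra

/-! ### Factorization of diagrams through `loopDiagram` -/

namespace DiagramAlgebra

variable {n : ℕ}

theorem restrict_mem_diagrams {k : Kind} {d : Setoid (Fin n ⊕ Fin n)} (hd : d ∈ diagrams k n)
    (K : Set (Fin n ⊕ Fin n)) : restrict d K ∈ diagrams k n := by
  have h1 : ∀ d : Setoid (Fin n ⊕ Fin n), IsPartialOneFactor d →
      IsPartialOneFactor (restrict d K) :=
    fun d h p q r hq hr => h p q r (restrict_le d K hq) (restrict_le d K hr)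
  have h2 : ∀ d : Setoid (Fin n ⊕ Fin n), NoHorizontalArc d → NoHorizontalArc (restrict d K) :=
    fun d h => ⟨fun i j hij => h.1 i j (restrict_le d K hij),
      fun i j hij => h.2 i j (restrict_le d K hij)⟩
  cases k
  · exact h1 d hd
  · exact ⟨h1 d hd.1, h2 d hd.2⟩

/-- The lower vertices of the vertical arcs. -/
def lowerEnds (d : Setoid (Fin n ⊕ Fin n)) : Set (Fin n) := {j | ∃ i, d (Sum.inl i) (Sum.inr j)}

open Classical in
/-- The labels of the vertices of `lowerHalf d`. -/
noncomputable def lowerLabel (d : Setoid (Fin n ⊕ Fin n)) (j : Fin n) : Quotient d ⊕ Quotient d :=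
  if j ∈ lowerEnds d then Sum.inl (Quotient.mk d (Sum.inr j)) else Sum.inr (Quotient.mk d (Sum.inr j))

/-- The diagram with the lower horizontal arcs of `d` and with straight arcs at the lower ends of
the vertical arcs of `d`. -/
noncomputable def lowerHalf (d : Setoid (Fin n ⊕ Fin n)) : Setoid (Fin n ⊕ Fin n) :=
  restrict (Setoid.ker (Sum.elim (lowerLabel d)
    (fun j => (Sum.inl (Quotient.mk d (Sum.inr j)) : Quotient d ⊕ Quotient d))))
    (keepAbove (lowerEnds d))

theorem lowerHalf_inl_inl {d : Setoid (Fin n ⊕ Fin n)} {i j : Fin n} :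
    lowerHalf d (Sum.inl i) (Sum.inl j) ↔
      i = j ∨ (d (Sum.inr i) (Sum.inr j) ∧ i ∈ lowerEnds d ∧ j ∈ lowerEnds d) := by
  refine or_congr Sum.inl_injective.eq_iff ⟨?_, ?_⟩
  · rintro ⟨h, hi, hj⟩
    have hi := inl_mem_keepAbove.1 hi
    have hj := inl_mem_keepAbove.1 hj
    have h : lowerLabel d i = lowerLabel d j := h
    rw [lowerLabel, lowerLabel, if_pos hi, if_pos hj] at h
    exact ⟨Quotient.exact (Sum.inl_injective h), hi, hj⟩
  · rintro ⟨h, hi, hj⟩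
    refine ⟨?_, inl_mem_keepAbove.2 hi, inl_mem_keepAbove.2 hj⟩
    change lowerLabel d i = lowerLabel d j
    rw [lowerLabel, lowerLabel, if_pos hi, if_pos hj]
    exact congrArg Sum.inl (Quotient.sound h)

theorem lowerHalf_inl_inr {d : Setoid (Fin n ⊕ Fin n)} {i j : Fin n} :
    lowerHalf d (Sum.inl i) (Sum.inr j) ↔ d (Sum.inr i) (Sum.inr j) ∧ i ∈ lowerEnds d := by
  constructor
  · rintro (h | ⟨h, hi, -⟩)
    · exact absurd h Sum.inl_ne_inr
    · have hi := inl_mem_keepAbove.1 hi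
      have h : lowerLabel d i = Sum.inl (Quotient.mk d (Sum.inr j)) := h
      rw [lowerLabel, if_pos hi] at h
      exact ⟨Quotient.exact (Sum.inl_injective h), hi⟩
  · rintro ⟨h, hi⟩
    refine Or.inr ⟨?_, inl_mem_keepAbove.2 hi, inr_mem_keepAbove⟩
    change lowerLabel d i = Sum.inl (Quotient.mk d (Sum.inr j))
    rw [lowerLabel, if_pos hi]
    exact congrArg Sum.inl (Quotient.sound h)

theorem lowerHalf_inr_inr {d : Setoid (Fin n ⊕ Fin n)} {i j : Fin n} :
    lowerHalf d (Sum.inr i) (Sum.inr j) ↔ d (Sum.inr i) (Sum.inr j) := by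
  constructor
  · rintro (h | ⟨h, -, -⟩)
    · exact h ▸ d.refl _
    · exact Quotient.exact (Sum.inl_injective h)
  · intro h
    exact Or.inr ⟨congrArg Sum.inl (Quotient.sound h), inr_mem_keepAbove, inr_mem_keepAbove⟩

theorem eq_of_lowerEnds {d : Setoid (Fin n ⊕ Fin n)} (hd : IsPartialOneFactor d) {i j : Fin n}
    (hi : i ∈ lowerEnds d) (h : d (Sum.inr i) (Sum.inr j)) : i = j := by
  obtain ⟨s, hs⟩ := hi
  rcases hd _ _ _ hs (d.trans hs h) with h | h | h
  · exact absurd h Sum.inl_ne_inr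
  · exact absurd h Sum.inl_ne_inr
  · exact Sum.inr_injective h

theorem lowerHalf_mem_diagrams {k : Kind} {d : Setoid (Fin n ⊕ Fin n)} (hd : d ∈ diagrams k n) :
    lowerHalf d ∈ diagrams k n := by
  have hf := isPartialOneFactor_of_mem hd
  have hll : ∀ i j, lowerHalf d (Sum.inl i) (Sum.inl j) → i = j := by
    intro i j h
    rcases lowerHalf_inl_inl.1 h with h | ⟨h, hi, -⟩
    · exact h
    · exact eq_of_lowerEnds hf hi h
  have hlr : ∀ i j, lowerHalf d (Sum.inl i) (Sum.inr j) → i = j ∧ i ∈ lowerEnds d := by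
    intro i j h
    obtain ⟨h, hi⟩ := lowerHalf_inl_inr.1 h
    exact ⟨eq_of_lowerEnds hf hi h, hi⟩
  have h1 : IsPartialOneFactor (lowerHalf d) := by
    rintro (p | p) (q | q) (r | r) hpq hpr
    · exact Or.inl (congrArg _ (hll _ _ hpq))
    · exact Or.inl (congrArg _ (hll _ _ hpq))
    · exact Or.inr (Or.inl (congrArg _ (hll _ _ hpr)))
    · exact Or.inr (Or.inr (congrArg _ ((hlr _ _ hpq).1.symm.trans (hlr _ _ hpr).1)))
    · exact Or.inr (Or.inr (congrArg _ (hll _ _ (Setoid.trans' _ (Setoid.symm' _ hpq) hpr))))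
    · obtain ⟨rfl, hq⟩ := hlr _ _ (Setoid.symm' _ hpq)
      exact Or.inr (Or.inl (congrArg _ (eq_of_lowerEnds hf hq (lowerHalf_inr_inr.1 hpr))))
    · obtain ⟨rfl, hr⟩ := hlr _ _ (Setoid.symm' _ hpr)
      exact Or.inl (congrArg _ (eq_of_lowerEnds hf hr (lowerHalf_inr_inr.1 hpq)))
    · rcases hf _ _ _ (lowerHalf_inr_inr.1 hpq) (lowerHalf_inr_inr.1 hpr) with h | h | h
      · exact Or.inl h
      · exact Or.inr (Or.inl h)
      · exact Or.inr (Or.inr h)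
  cases k
  · exact h1
  · exact ⟨h1, hll, fun i j h => hd.2.2 i j (lowerHalf_inr_inr.1 h)⟩

/-- The straight arcs of `lowerHalf d` prolong the vertical arcs of `d`, while its lower row
supplies the horizontal arcs. The remaining middle vertices meet no outer vertex; the second copy of
`Quotient d` in `lowerLabel` keeps their labels apart from those of the outer rows. -/
theorem comp_lowerHalf (d : Setoid (Fin n ⊕ Fin n)) : comp d (lowerHalf d) = d := by
  apply le_antisymm
  · let f : Fin n ⊕ (Fin n ⊕ Fin n) → Quotient d ⊕ Quotient d := Sum.elim
      (fun i => Sum.inl (Quotient.mk d (Sum.inl i))) (Sum.elim (lowerLabel d)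
      (fun i => Sum.inl (Quotient.mk d (Sum.inr i))))
    have hsat : ∀ i j, d (Sum.inr i) (Sum.inr j) → lowerLabel d i = lowerLabel d j := by
      intro i j h
      have hij : i ∈ lowerEnds d ↔ j ∈ lowerEnds d :=
        ⟨fun ⟨s, hs⟩ => ⟨s, d.trans hs h⟩, fun ⟨s, hs⟩ => ⟨s, d.trans hs (d.symm h)⟩⟩
      unfold lowerLabel
      by_cases hi : i ∈ lowerEnds d
      · rw [if_pos hi, if_pos (hij.1 hi)]
        exact congrArg Sum.inl (Quotient.sound h)
      · rw [if_neg hi, if_neg (fun hj => hi (hij.2 hj))]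
        exact congrArg Sum.inr (Quotient.sound h)
    have hlr : ∀ i j, d (Sum.inl i) (Sum.inr j) →
        Sum.inl (Quotient.mk d (Sum.inl i)) = lowerLabel d j := by
      intro i j h
      rw [lowerLabel, if_pos ⟨i, h⟩]
      exact congrArg Sum.inl (Quotient.sound h)
    have key : glue d (lowerHalf d) ≤ Setoid.ker f := by
      refine sup_le (map_le_iff.2 ?_) (map_le_iff.2 ?_)
      · rintro (p | p) (q | q) h
        · exact congrArg Sum.inl (Quotient.sound h)
        · exact hlr p q h
        · exact (hlr q p (d.symm h)).symm
        · exact hsat p q h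
      · rintro p q (rfl | ⟨h, -, -⟩)
        · exact Setoid.refl' _ _
        · rcases p with p | p <;> rcases q with q | q <;> exact h
    intro p q h
    have h1 : f (outer p) = f (outer q) := key h
    rcases p with p | p <;> rcases q with q | q <;> exact Quotient.exact (Sum.inl_injective h1)
  · have hl : d.map (Sum.map id Sum.inl) ≤ glue d (lowerHalf d) := le_sup_left
    have hr : (lowerHalf d).map Sum.inr ≤ glue d (lowerHalf d) := le_sup_right
    have hlr : ∀ p q, d (Sum.inl p) (Sum.inr q) →
        glue d (lowerHalf d) (Sum.inl p) (Sum.inr (Sum.inr q)) := by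
      intro p q h
      exact Setoid.trans' _ (hl (map_intro _ h))
        (hr (map_intro Sum.inr (lowerHalf_inl_inr.2 ⟨d.refl (Sum.inr q), p, h⟩)))
    rintro (p | p) (q | q) h
    · exact hl (map_intro _ h)
    · exact hlr p q h
    · exact Setoid.symm' _ (hlr q p (d.symm h))
    · exact hr (map_intro _ (lowerHalf_inr_inr.2 h))

/-- Top vertices of `lowerHalf d` outside `lowerEnds d` are already isolated, so there is no arc to
delete. -/
theorem partialStraight_comp_lowerHalf {d : Setoid (Fin n ⊕ Fin n)} {S : Set (Fin n)}
    (h : lowerEnds d ⊆ S) : comp (partialStraight S) (lowerHalf d) = lowerHalf d := by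
  rw [partialStraight_comp]
  refine le_antisymm (restrict_le _ _) ?_
  have key : ∀ p, p ∈ keepAbove (lowerEnds d) → p ∈ keepAbove S := fun p hp j hj => h (hp j hj)
  rintro p q (rfl | ⟨h, hp, hq⟩)
  · exact Setoid.refl' _ _
  · exact Or.inr ⟨Or.inr ⟨h, hp, hq⟩, key p hp, key q hq⟩

theorem ncard_lowerEnds_le (d : Setoid (Fin n ⊕ Fin n)) :
    (lowerEnds d).ncard ≤ verticalArcs d := by
  unfold verticalArcs
  have : lowerEnds d = Prod.snd '' {p : Fin n × Fin n | d (Sum.inl p.1) (Sum.inr p.2)} := by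
    ext j
    simp [lowerEnds]
  rw [this]
  exact Set.ncard_image_le (Set.toFinite _)

theorem exists_perm_of_ncard_le {m : ℕ} (hm : m ≤ n) (S : Set (Fin n)) (hS : S.ncard ≤ m) :
    ∃ π : Equiv.Perm (Fin n), ∀ i ∈ S, (π i).val < m := by
  classical
  have hc : (Finset.univ.filter fun i : Fin n => i.val < m).card = m := by
    rw [Fin.card_filter_val_lt, min_eq_right hm]
  obtain ⟨T, hT, hTc⟩ := Finset.exists_subset_card_eq (hS.trans hc.ge)
  have e : {i // i ∈ S} ≃ {i // i ∈ T} := Fintype.equivOfCardEq (by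
    rw [Fintype.card_coe, hTc, ← Nat.card_coe_set_eq, Nat.card_eq_fintype_card])
  refine ⟨e.extendSubtype, fun i hi => ?_⟩
  have := e.extendSubtype_mem i hi
  simpa using (Finset.mem_filter.1 (hT this)).2

/-- A diagram with at most `m` vertical arcs factors through `loopDiagram n m`. -/
theorem exists_factorization {k : Kind} {m : ℕ} (hm : m ≤ n) {d : Setoid (Fin n ⊕ Fin n)}
    (hd : d ∈ diagrams k n) (h : verticalArcs d ≤ m) :
    ∃ a ∈ diagrams k n, ∃ b ∈ diagrams k n, d = comp a (comp (loopDiagram n m) b) := by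
  -- The permutation `π` moves the lower ends among the first `m` vertices. Inserting its inverse
  -- and itself between `d` and `lowerHalf d` makes room for `loopDiagram n m`.
  obtain ⟨π, hπ⟩ := exists_perm_of_ncard_le hm (lowerEnds d) ((ncard_lowerEnds_le d).trans h)
  refine ⟨comp d (permDiagram π.symm), comp_mem_diagrams hd (permDiagram_mem k _),
    comp (permDiagram π) (lowerHalf d), comp_mem_diagrams (permDiagram_mem k _)
      (lowerHalf_mem_diagrams hd), ?_⟩
  have h1 : comp (partialStraight (π.symm.symm ⁻¹' {i | i.val < m})) (lowerHalf d) = lowerHalf d :=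
    partialStraight_comp_lowerHalf hπ
  rw [← partialStraight_perm, Equiv.symm_symm, ← loopDiagram_eq] at h1
  rw [comp_assoc, ← comp_assoc (loopDiagram n m), ← comp_assoc (permDiagram π.symm), h1,
    comp_lowerHalf]

theorem loop_comp_loop {m : ℕ} (d : Setoid (Fin n ⊕ Fin n)) :
    comp (loopDiagram n m) (comp d (loopDiagram n m)) =
      restrict d {p | (Sum.elim id id p : Fin n).val < m} := by
  rw [loopDiagram_eq, comp_partialStraight, partialStraight_comp]
  have key : ∀ p : Fin n ⊕ Fin n, (p ∈ keepBelow {i : Fin n | i.val < m} ∧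
      p ∈ keepAbove {i : Fin n | i.val < m}) ↔ (Sum.elim id id p : Fin n).val < m := by
    rintro (p | p)
    · exact (and_iff_right inl_mem_keepBelow).trans inl_mem_keepAbove
    · exact (and_iff_left inr_mem_keepAbove).trans inr_mem_keepBelow
  ext p q
  constructor
  · rintro (h | ⟨h | ⟨h, h1, h2⟩, h3, h4⟩)
    · exact Or.inl h
    · exact Or.inl h
    · exact Or.inr ⟨h, (key p).1 ⟨h1, h3⟩, (key q).1 ⟨h2, h4⟩⟩
  · rintro (h | ⟨h, h1, h2⟩)
    · exact Or.inl h
    · have h1 := (key p).2 h1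
      have h2 := (key q).2 h2
      exact Or.inr ⟨Or.inr ⟨h, h1.1, h2.1⟩, h1.2, h2.2⟩

theorem viaEmbedding_castLE {m : ℕ} (hm : m ≤ n) (σ : Equiv.Perm (Fin m)) (i : Fin m) :
    σ.viaEmbedding (Fin.castLEEmb hm) (Fin.castLE hm i) = Fin.castLE hm (σ i) :=
  Equiv.Perm.viaEmbedding_apply σ (Fin.castLEEmb hm) i

theorem viaEmbedding_lt_iff {m : ℕ} (hm : m ≤ n) (σ : Equiv.Perm (Fin m)) (i : Fin n) :
    (σ.viaEmbedding (Fin.castLEEmb hm) i).val < m ↔ i.val < m := by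
  by_cases h : i.val < m
  · have := viaEmbedding_castLE hm σ ⟨i, h⟩
    have e : Fin.castLE hm ⟨i, h⟩ = i := rfl
    rw [e] at this
    rw [this]
    exact iff_of_true (σ ⟨i, h⟩).2 h
  · rw [Equiv.Perm.viaEmbedding_apply_of_notMem]
    rintro ⟨j, rfl⟩
    exact h j.2

/-- The extended permutation preserves the set of the first `m` vertices, so conjugation by it fixes
`loopDiagram n m`. -/
theorem loop_comp_perm {m : ℕ} (hm : m ≤ n) (σ : Equiv.Perm (Fin m)) :
    comp (loopDiagram n m) (permDiagram (σ.viaEmbedding (Fin.castLEEmb hm))) =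
      comp (permDiagram (σ.viaEmbedding (Fin.castLEEmb hm))) (loopDiagram n m) := by
  set π := σ.viaEmbedding (Fin.castLEEmb hm) with hπ
  have h1 : comp (permDiagram π) (comp (loopDiagram n m) (permDiagram π.symm)) =
      loopDiagram n m := by
    rw [loopDiagram_eq, partialStraight_perm]
    congr 1
    ext i
    have := viaEmbedding_lt_iff hm σ (π.symm i)
    rw [← hπ, π.apply_symm_apply] at this
    exact this.symm
  have h2 : comp (permDiagram π.symm) (permDiagram π) = straight (Fin n) := by
    rw [permDiagram_mul]
    ext p q
    have : π.symm * π = 1 := inv_mul_cancel π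
    rw [this]
    rfl
  conv_lhs => rw [← h1]
  rw [comp_assoc, comp_assoc, h2, comp_straight]

/-- A diagram with all arcs among the first `m` vertices has fewer than `m` vertical arcs or is
given by a permutation. -/
theorem exists_perm_of_verticalArcs {m : ℕ} (hm : m ≤ n) {d : Setoid (Fin n ⊕ Fin n)}
    (hd : IsPartialOneFactor d)
    (h : ¬ verticalArcs (restrict d {p | (Sum.elim id id p : Fin n).val < m}) < m) :
    ∃ σ : Equiv.Perm (Fin m), restrict d {p | (Sum.elim id id p : Fin n).val < m} =
      comp (permDiagram (σ.viaEmbedding (Fin.castLEEmb hm))) (loopDiagram n m) := by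
  classical
  set c := restrict d {p | (Sum.elim id id p : Fin n).val < m} with hc
  have hcf : IsPartialOneFactor c :=
    fun p q r hq hr => hd p q r (restrict_le _ _ hq) (restrict_le _ _ hr)
  have hlt : ∀ i j, c (Sum.inl i) (Sum.inr j) → i.val < m ∧ j.val < m := by
    rintro i j (h | ⟨-, hi, hj⟩)
    · exact absurd h Sum.inl_ne_inr
    · exact ⟨hi, hj⟩
  have huniq : ∀ i i' j, c (Sum.inl i) (Sum.inr j) → c (Sum.inl i') (Sum.inr j) → i = i' := by
    intro i i' j h h'
    rcases hcf _ _ _ (c.symm h) (c.symm h') with h | h | h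
    · exact absurd h Sum.inr_ne_inl
    · exact absurd h Sum.inr_ne_inl
    · exact Sum.inl_injective h
  have huniq' : ∀ i j j', c (Sum.inl i) (Sum.inr j) → c (Sum.inl i) (Sum.inr j') → j = j' := by
    intro i j j' h h'
    rcases hcf _ _ _ h h' with h | h | h
    · exact absurd h Sum.inl_ne_inr
    · exact absurd h Sum.inl_ne_inr
    · exact Sum.inr_injective h
  have hex : ∀ j : Fin m, ∃ i : Fin m, c (Sum.inl (Fin.castLE hm i)) (Sum.inr (Fin.castLE hm j)) := by
    -- A vertical arc is determined by its lower end. With at least `m` such arcs and all ends among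
    -- the first `m` vertices, every one of these vertices is an end.
    have hcard : m ≤ (lowerEnds c).ncard := by
      have e : lowerEnds c = Prod.snd '' {p : Fin n × Fin n | c (Sum.inl p.1) (Sum.inr p.2)} := by
        ext j
        simp [lowerEnds]
      rw [e, Set.InjOn.ncard_image]
      · exact not_lt.1 h
      · rintro ⟨i, j⟩ hij ⟨i', j'⟩ hij' (e : j = j')
        subst e
        rw [huniq i i' j hij hij']
    have hsub : lowerEnds c ⊆ Set.range (Fin.castLE hm) := by
      rintro j ⟨i, hij⟩
      exact ⟨⟨j, (hlt i j hij).2⟩, rfl⟩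
    have heq : lowerEnds c = Set.range (Fin.castLE hm) := by
      refine Set.eq_of_subset_of_ncard_le hsub ?_
      refine le_trans ?_ hcard
      rw [← Set.image_univ, Set.ncard_image_of_injective _ (Fin.castLE_injective hm),
        Set.ncard_univ, Nat.card_eq_fintype_card, Fintype.card_fin]
    intro j
    have hj : Fin.castLE hm j ∈ lowerEnds c := heq ▸ ⟨j, rfl⟩
    obtain ⟨i, hi⟩ := hj
    exact ⟨⟨i, (hlt _ _ hi).1⟩, hi⟩
  choose f hf using hex
  have inj : Function.Injective f := by
    intro j j' e
    have h1 := hf j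
    rw [e] at h1
    exact Fin.castLE_injective hm (huniq' _ _ _ h1 (hf j'))
  have surj : Function.Surjective f := Finite.injective_iff_surjective.1 inj
  let σ : Equiv.Perm (Fin m) := Equiv.ofBijective f ⟨inj, surj⟩
  refine ⟨σ, ?_⟩
  have hvert : ∀ i : Fin n, i.val < m → ∃ j, c (Sum.inl i) (Sum.inr j) := by
    intro i hi
    obtain ⟨j, hj⟩ := surj ⟨i, hi⟩
    have := hf j
    rw [hj] at this
    exact ⟨_, this⟩
  have hvert' : ∀ j : Fin n, j.val < m → ∃ i, c (Sum.inl i) (Sum.inr j) :=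
    fun j hj => ⟨_, hf ⟨j, hj⟩⟩
  have hπ : ∀ i j, c (Sum.inl i) (Sum.inr j) ↔
      j.val < m ∧ i = σ.viaEmbedding (Fin.castLEEmb hm) j := by
    intro i j
    constructor
    · intro hij
      have hj := (hlt _ _ hij).2
      refine ⟨hj, ?_⟩
      have h1 := viaEmbedding_castLE hm σ ⟨j, hj⟩
      have h2 := huniq _ _ _ hij (hf ⟨j, hj⟩)
      exact h2.trans h1.symm
    · rintro ⟨hj, rfl⟩
      have h1 := viaEmbedding_castLE hm σ ⟨j, hj⟩
      have e : Fin.castLE hm ⟨j, hj⟩ = j := rfl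
      rw [e] at h1
      rw [h1]
      exact hf ⟨j, hj⟩
  rw [← loop_comp_perm, loopDiagram_eq, partialStraight_comp]
  -- A horizontal arc of `c` would join two of the first `m` vertices, and each of those already
  -- lies on a vertical arc.
  have hll : ∀ i i', c (Sum.inl i) (Sum.inl i') → i = i' := by
    rintro i i' (h | ⟨h, hi, hi'⟩)
    · exact Sum.inl_injective h
    · obtain ⟨j, hj⟩ := hvert i hi
      have : c (Sum.inl i) (Sum.inl i') := Or.inr ⟨h, hi, hi'⟩
      exact huniq _ _ _ hj (c.trans (c.symm this) hj)
  have hrr : ∀ i i', c (Sum.inr i) (Sum.inr i') → i = i' := by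
    rintro i i' (h | ⟨h, hi, hi'⟩)
    · exact Sum.inr_injective h
    · obtain ⟨j, hj⟩ := hvert' i hi
      have : c (Sum.inr i) (Sum.inr i') := Or.inr ⟨h, hi, hi'⟩
      exact huniq' _ _ _ hj (c.trans hj this)
  set π := σ.viaEmbedding (Fin.castLEEmb hm) with hπd
  have hlr : ∀ i j, restrict (permDiagram π) (keepAbove {i | i.val < m}) (Sum.inl i) (Sum.inr j) ↔
      c (Sum.inl i) (Sum.inr j) := by
    intro i j
    rw [hπ]
    constructor
    · rintro (h | ⟨h, hi, -⟩)
      · exact absurd h Sum.inl_ne_inr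
      · have h : i = π j := h
        have hi := inl_mem_keepAbove.1 hi
        subst h
        exact ⟨(viaEmbedding_lt_iff hm σ j).1 hi, rfl⟩
    · rintro ⟨hj, rfl⟩
      exact Or.inr ⟨rfl, inl_mem_keepAbove.2 ((viaEmbedding_lt_iff hm σ j).2 hj),
        inr_mem_keepAbove⟩
  ext (p | p) (q | q)
  · constructor
    · intro h
      rw [hll p q h]
    · intro h
      have h : p = q := restrict_le _ _ h
      rw [h]
  · exact (hlr p q).symm
  · exact ⟨fun h => Setoid.symm' _ ((hlr q p).2 (c.symm h)),
      fun h => c.symm ((hlr q p).1 (Setoid.symm' _ h))⟩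
  · constructor
    · intro h
      rw [hrr p q h]
    · intro h
      have h : π p = π q := restrict_le _ _ h
      rw [π.injective h]

theorem verticalArcs_straight_le : verticalArcs (straight (Fin n)) ≤ n := by
  unfold verticalArcs
  have : {p : Fin n × Fin n | straight (Fin n) (Sum.inl p.1) (Sum.inr p.2)} =
      Set.range fun i : Fin n => (i, i) := by
    ext ⟨i, j⟩
    simp only [Set.mem_ofPred_eq, Set.mem_range, Prod.mk.injEq]
    exact ⟨fun h => ⟨i, rfl, h⟩, fun ⟨a, h1, h2⟩ => h1.symm.trans h2⟩
  rw [this, ← Set.image_univ]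
  refine (Set.ncard_image_le (Set.toFinite _)).trans ?_
  simp [Set.ncard_univ]

theorem verticalArcs_loopDiagram_lt (m : ℕ) : verticalArcs (loopDiagram n m) < m + 1 := by
  unfold verticalArcs
  have : {p : Fin n × Fin n | loopDiagram n m (Sum.inl p.1) (Sum.inr p.2)} =
      (fun i : Fin n => (i, i)) '' {i | i.val < m} := by
    ext ⟨i, j⟩
    simp only [Set.mem_ofPred_eq, Set.mem_image, Prod.mk.injEq]
    constructor
    · rintro (h | ⟨h, hi⟩)
      · exact absurd h Sum.inl_ne_inr
      · exact ⟨i, hi, rfl, h⟩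
    · rintro ⟨a, h, rfl, rfl⟩
      exact Or.inr ⟨rfl, h⟩
  rw [this, Nat.lt_succ_iff]
  refine (Set.ncard_image_le (Set.toFinite _)).trans ?_
  have e : {i : Fin n | i.val < m} = ((Finset.univ.filter fun i : Fin n => i.val < m) : Set (Fin n)) := by
    ext i
    simp
  rw [e, Set.ncard_coe_finset, Fin.card_filter_val_lt]
  exact min_le_right _ _

end DiagramAlgebra

namespace DiagramAlgebra

/-! ### Structure of the diagram algebras -/

section

variable {F : Type*} [Field F] {k : Kind} {n : ℕ} {x : F}

theorem diag_mul_diag {a b : Setoid (Fin n ⊕ Fin n)} (ha : a ∈ diagrams k n)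
    (hb : b ∈ diagrams k n) :
    diag x a ha * diag x b hb =
      x ^ innerComponents a b • diag x (comp a b) (comp_mem_diagrams ha hb) :=
  Subtype.ext (PartitionAlgebra.of_mul_of a b)

theorem diag_congr {a b : Setoid (Fin n ⊕ Fin n)} (ha : a ∈ diagrams k n) (h : a = b) :
    diag x a ha = diag x b (h ▸ ha) := by
  subst h
  rfl

theorem straight_mem_diagrams : straight (Fin n) ∈ diagrams k n :=
  permDiagram_mem k (Equiv.refl _)

theorem diag_straight (h : straight (Fin n) ∈ diagrams k n) :
    diag x (straight (Fin n)) h = (1 : DiagramAlg k n x) := rfl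

theorem span_diag : Submodule.span F {a : DiagramAlg k n x |
    ∃ (d : Setoid (Fin n ⊕ Fin n)) (hd : d ∈ diagrams k n), a = diag x d hd} = ⊤ := by
  rw [eq_top_iff]
  rintro ⟨a, ha⟩ -
  have ha' : a ∈ Submodule.span F (PartitionAlgebra.of x '' diagrams k n) := ha
  induction ha' using Submodule.span_induction with
  | mem a h =>
    obtain ⟨d, hd, rfl⟩ := h
    exact Submodule.subset_span ⟨d, hd, rfl⟩
  | zero => exact Submodule.zero_mem _
  | add a b h h' h1 h2 => exact Submodule.add_mem _ (h1 h) (h2 h')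
  | smul r a h h1 => exact Submodule.smul_mem _ r (h1 h)

@[elab_as_elim]
theorem diag_induction {motive : DiagramAlg k n x → Prop} (a : DiagramAlg k n x)
    (diag : ∀ d hd, motive (diag x d hd)) (add : ∀ a b, motive a → motive b → motive (a + b))
    (smul : ∀ (r : F) a, motive a → motive (r • a)) : motive a := by
  have ha : a ∈ Submodule.span F {a : DiagramAlg k n x |
    ∃ (d : Setoid (Fin n ⊕ Fin n)) (hd : d ∈ diagrams k n), a = DiagramAlgebra.diag x d hd} := by
    rw [span_diag]
    trivial
  induction ha using Submodule.span_induction with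
  | mem a h =>
    obtain ⟨d, hd, rfl⟩ := h
    exact diag d hd
  | zero =>
    -- The zero vector is obtained as 0 • 1, which spares the induction principle a separate case.
    have := smul 0 1 (diag (straight (Fin n)) straight_mem_diagrams)
    rwa [zero_smul] at this
  | add a b _ _ h1 h2 => exact add a b h1 h2
  | smul r a _ h1 => exact smul r a h1

instance finite_setoid (V : Type*) [Finite V] : Finite (Setoid V) :=
  Finite.of_injective (fun s : Setoid V => s.r) fun s t h => by
    ext p q
    exact iff_of_eq (congrFun (congrFun h p) q)

instance finite_diagramAlg : Module.Finite F (DiagramAlg k n x) := by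
  have : Module.Finite F (PartitionAlgebra n x) :=
    inferInstanceAs (Module.Finite F (Setoid (Fin n ⊕ Fin n) →₀ F))
  exact inferInstanceAs (Module.Finite F (Subalgebra.toSubmodule (diagramSubalgebra k n x)))

/-! ### Permutations of the first vertices -/

/-- The permutations of the first `m` vertices as elements of the algebra. -/
noncomputable def permHom (k : Kind) (x : F) {m : ℕ} (hm : m ≤ n) :
    Equiv.Perm (Fin m) →* DiagramAlg k n x where
  toFun := permElt k x hm
  map_one' := by
    have h : permDiagram ((1 : Equiv.Perm (Fin m)).viaEmbedding (Fin.castLEEmb hm)) =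
        straight (Fin n) := by
      rw [← Equiv.Perm.viaEmbeddingHom_apply, map_one]
      rfl
    exact (diag_congr (permDiagram_mem k _) h).trans (diag_straight _)
  map_mul' := by
    intro σ τ
    unfold permElt
    rw [diag_mul_diag, innerComponents_permDiagram_left, pow_zero, one_smul]
    refine diag_congr _ ?_
    rw [permDiagram_mul, ← Equiv.Perm.viaEmbeddingHom_apply, map_mul]
    rfl

/-- The group algebra of the symmetric group on the first `m` vertices. -/
noncomputable def permAlg (k : Kind) (x : F) {m : ℕ} (hm : m ≤ n) :
    MonoidAlgebra F (Equiv.Perm (Fin m)) →ₐ[F] DiagramAlg k n x :=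
  MonoidAlgebra.lift F (DiagramAlg k n x) (Equiv.Perm (Fin m)) (permHom k x hm)

theorem permAlg_single {m : ℕ} (hm : m ≤ n) (σ : Equiv.Perm (Fin m)) :
    permAlg k x hm (MonoidAlgebra.single σ 1) = permElt k x hm σ := by
  rw [permAlg, MonoidAlgebra.lift_single, one_smul]
  rfl

/-- The diagram `loopDiagram n m` as an element of the algebra. -/
noncomputable def loopElt (k : Kind) (n : ℕ) (x : F) (m : ℕ) : DiagramAlg k n x :=
  diag x (loopDiagram n m) (loopDiagram_mem k n m)

theorem innerComponents_permDiagram_right (π : Equiv.Perm (Fin n)) (a : Setoid (Fin n ⊕ Fin n)) :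
    innerComponents a (permDiagram π) = 0 := by
  rw [← innerComponents_reflect, reflect_permDiagram, innerComponents_permDiagram_left]

theorem loopElt_mul_permElt {m : ℕ} (hm : m ≤ n) (σ : Equiv.Perm (Fin m)) :
    loopElt k n x m * permElt k x hm σ = permElt k x hm σ * loopElt k n x m := by
  unfold loopElt permElt
  rw [diag_mul_diag, diag_mul_diag, innerComponents_permDiagram_left,
    innerComponents_permDiagram_right]
  congr 1
  exact diag_congr _ (loop_comp_perm hm σ)

theorem loopElt_mul_permAlg {m : ℕ} (hm : m ≤ n) (w : MonoidAlgebra F (Equiv.Perm (Fin m))) :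
    loopElt k n x m * permAlg k x hm w = permAlg k x hm w * loopElt k n x m := by
  induction w using MonoidAlgebra.induction_on with
  | of σ =>
    rw [MonoidAlgebra.of_apply, permAlg_single, loopElt_mul_permElt]
  | add v w hv hw => rw [map_add, mul_add, add_mul, hv, hw]
  | smul r w hw => rw [map_smul, mul_smul_comm, smul_mul_assoc, hw]

/-- The scalar is a power of `x` that counts the components lost in the middle row; only its
invertibility matters. This makes `loopElt` an idempotent up to scaling. -/
theorem exists_loopElt_mul_loopElt (hx : x ≠ 0) (m : ℕ) :
    ∃ c : F, c ≠ 0 ∧ loopElt k n x m * loopElt k n x m = c • loopElt k n x m := by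
  refine ⟨_, pow_ne_zero (innerComponents (loopDiagram n m) (loopDiagram n m)) hx, ?_⟩
  unfold loopElt
  rw [diag_mul_diag]
  congr 1
  refine diag_congr _ ?_
  rw [loopDiagram_eq, partialStraight_comp]
  refine le_antisymm (restrict_le _ _) ?_
  rintro p q (rfl | ⟨h, hp, hq⟩)
  · exact Setoid.refl' _ _
  · refine Or.inr ⟨Or.inr ⟨h, hp, hq⟩, ?_, ?_⟩
    · rintro j rfl
      exact hp
    · rintro j rfl
      exact hq

/-! ### The ideals generated by the diagrams with few vertical arcs -/

theorem diag_mem_arcIdeal {m : ℕ} {d : Setoid (Fin n ⊕ Fin n)} (hd : d ∈ diagrams k n)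
    (h : verticalArcs d < m) : diag x d hd ∈ arcIdeal k n x m :=
  TwoSidedIdeal.mem_asIdeal.2 (TwoSidedIdeal.subset_span ⟨d, hd, h, rfl⟩)

theorem arcIdeal_le_of_forall {m : ℕ} (J : TwoSidedIdeal (DiagramAlg k n x))
    (h : ∀ d (hd : d ∈ diagrams k n), verticalArcs d < m → diag x d hd ∈ J) {a : DiagramAlg k n x}
    (ha : a ∈ arcIdeal k n x m) : a ∈ J := by
  have h1 := TwoSidedIdeal.mem_asIdeal.1 ha
  refine TwoSidedIdeal.span_le.2 ?_ h1
  rintro _ ⟨d, hd, hlt, rfl⟩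
  exact h d hd hlt

theorem arcIdeal_mono {m m' : ℕ} (h : m ≤ m') : arcIdeal k n x m ≤ arcIdeal k n x m' := by
  intro a ha
  refine TwoSidedIdeal.mem_asIdeal.2 (TwoSidedIdeal.span_mono ?_ (TwoSidedIdeal.mem_asIdeal.1 ha))
  rintro _ ⟨d, hd, hlt, rfl⟩
  exact ⟨d, hd, hlt.trans_le h, rfl⟩

theorem arcIdeal_zero : arcIdeal k n x 0 = ⊥ := by
  rw [eq_bot_iff]
  intro a ha
  have := arcIdeal_le_of_forall ⊥ (fun d hd hlt => absurd hlt (Nat.not_lt_zero _)) ha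
  rwa [TwoSidedIdeal.mem_bot] at this

theorem arcIdeal_top : arcIdeal k n x (n + 1) = ⊤ := by
  rw [Ideal.eq_top_iff_one, ← diag_straight straight_mem_diagrams]
  exact diag_mem_arcIdeal _ (Nat.lt_succ_of_le verticalArcs_straight_le)

theorem loopElt_mem_arcIdeal (m : ℕ) : loopElt k n x m ∈ arcIdeal k n x (m + 1) :=
  diag_mem_arcIdeal _ (verticalArcs_loopDiagram_lt m)

/-- The ideal `arcIdeal k n x (m + 1)` is generated by `loopElt k n x m`. -/
theorem mem_closure_of_mem_arcIdeal (hx : x ≠ 0) {m : ℕ} (hm : m ≤ n) {a : DiagramAlg k n x}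
    (ha : a ∈ arcIdeal k n x (m + 1)) :
    a ∈ AddSubmonoid.closure (Set.range fun p : DiagramAlg k n x × DiagramAlg k n x =>
      p.1 * loopElt k n x m * p.2) := by
  have h1 : a ∈ TwoSidedIdeal.span {loopElt k n x m} := by
    refine arcIdeal_le_of_forall _ (fun d hd hlt => ?_) ha
    obtain ⟨b, hb, c, hc, h⟩ := exists_factorization hm hd (Nat.lt_succ_iff.1 hlt)
    -- The factorization of diagrams holds in the algebra up to powers of `x`, which are invertible.
    have h2 : diag x b hb * (loopElt k n x m * diag x c hc) =
        (x ^ innerComponents (loopDiagram n m) c * x ^ innerComponents b (comp (loopDiagram n m) c)) •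
          diag x d hd := by
      rw [diag_congr hd h, loopElt, diag_mul_diag, mul_smul_comm, diag_mul_diag, smul_smul]
    have h3 : diag x d hd = algebraMap F (DiagramAlg k n x)
        (x ^ innerComponents (loopDiagram n m) c *
          x ^ innerComponents b (comp (loopDiagram n m) c))⁻¹ *
        (diag x b hb * (loopElt k n x m * diag x c hc)) := by
      rw [h2, ← Algebra.smul_def, smul_smul, inv_mul_cancel₀, one_smul]
      exact mul_ne_zero (pow_ne_zero _ hx) (pow_ne_zero _ hx)
    rw [h3]
    exact TwoSidedIdeal.mul_mem_left _ _ _ (TwoSidedIdeal.mul_mem_left _ _ _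
      (TwoSidedIdeal.mul_mem_right _ _ _ (TwoSidedIdeal.subset_span rfl)))
  clear ha
  rw [TwoSidedIdeal.mem_span_iff_mem_addSubgroup_closure] at h1
  induction h1 using AddSubgroup.closure_induction with
  | mem a h =>
    obtain ⟨_, ⟨b, -, _, rfl, rfl⟩, c, -, rfl⟩ := h
    exact AddSubmonoid.subset_closure ⟨(b, c), rfl⟩
  | zero => exact zero_mem _
  | add a b _ _ h1 h2 => exact add_mem h1 h2
  -- The sign is absorbed by the left factor, so a submonoid suffices and later inductions have no
  -- case for negation.
  | neg a h' h =>
    clear h'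
    induction h using AddSubmonoid.closure_induction with
    | mem a h =>
      obtain ⟨⟨b, c⟩, rfl⟩ := h
      exact AddSubmonoid.subset_closure ⟨(-b, c), by simp⟩
    | zero => rw [neg_zero]; exact zero_mem _
    | add a b _ _ h1 h2 => rw [neg_add]; exact add_mem h1 h2

/-- Modulo diagrams with fewer vertical arcs, the corner of `loopElt` is the group algebra of a
symmetric group. -/
theorem exists_loopElt_mul_mul_loopElt {m : ℕ} (hm : m ≤ n) (a : DiagramAlg k n x) :
    ∃ w : MonoidAlgebra F (Equiv.Perm (Fin m)),
      loopElt k n x m * a * loopElt k n x m - loopElt k n x m * permAlg k x hm w ∈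
        arcIdeal k n x m := by
  induction a using diag_induction with
  | diag d hd =>
    set c := restrict d {p | (Sum.elim id id p : Fin n).val < m} with hc
    have h1 : loopElt k n x m * diag x d hd * loopElt k n x m =
        (x ^ innerComponents d (loopDiagram n m) *
          x ^ innerComponents (loopDiagram n m) (comp d (loopDiagram n m))) •
        diag x c (restrict_mem_diagrams hd _) := by
      rw [mul_assoc, loopElt, diag_mul_diag, mul_smul_comm, diag_mul_diag, smul_smul]
      congr 1
      exact diag_congr _ (loop_comp_loop d)
    rw [h1]
    -- Either the cut-down diagram lies in the smaller ideal, and `w = 0` works, or it is a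
    -- permutation of the first `m` vertices times `loopDiagram n m`.
    by_cases h : verticalArcs c < m
    · refine ⟨0, ?_⟩
      rw [map_zero, mul_zero, sub_zero, Algebra.smul_def]
      exact Ideal.mul_mem_left _ _ (diag_mem_arcIdeal _ h)
    · obtain ⟨σ, hσ⟩ := exists_perm_of_verticalArcs hm (isPartialOneFactor_of_mem hd) h
      refine ⟨(x ^ innerComponents d (loopDiagram n m) *
          x ^ innerComponents (loopDiagram n m) (comp d (loopDiagram n m))) •
          MonoidAlgebra.single σ 1, ?_⟩
      rw [map_smul, permAlg_single, mul_smul_comm, loopElt_mul_permElt, permElt, loopElt,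
        diag_mul_diag, innerComponents_permDiagram_left, pow_zero, one_smul,
        diag_congr (restrict_mem_diagrams hd _) hσ, sub_self]
      exact zero_mem _
  | add a b ha hb =>
    obtain ⟨v, hv⟩ := ha
    obtain ⟨w, hw⟩ := hb
    refine ⟨v + w, ?_⟩
    have := add_mem hv hw
    rwa [sub_add_sub_comm, ← mul_add, ← map_add, ← add_mul, ← mul_add] at this
  | smul r a ha =>
    obtain ⟨w, hw⟩ := ha
    refine ⟨r • w, ?_⟩
    have := Ideal.mul_mem_left _ (algebraMap F (DiagramAlg k n x) r) hw
    rwa [← Algebra.smul_def, smul_sub, ← smul_mul_assoc, ← mul_smul_comm, ← mul_smul_comm,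
      ← map_smul] at this

/-! ### The reflection -/

/-- The reflection as a linear map of the partition algebra. -/
noncomputable def reflectLinear (n : ℕ) (x : F) : PartitionAlgebra n x →ₗ[F] PartitionAlgebra n x :=
  Finsupp.lmapDomain F F (reflect : Setoid (Fin n ⊕ Fin n) → Setoid (Fin n ⊕ Fin n))

theorem reflectLinear_of (d : Setoid (Fin n ⊕ Fin n)) :
    reflectLinear n x (PartitionAlgebra.of x d) = PartitionAlgebra.of x (reflect d) :=
  Finsupp.mapDomain_single

theorem reflectLinear_mem {a : PartitionAlgebra n x} (ha : a ∈ diagramSubalgebra k n x) :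
    reflectLinear n x a ∈ diagramSubalgebra k n x := by
  have h : Submodule.span F (PartitionAlgebra.of x '' diagrams k n) ≤
      (Submodule.span F (PartitionAlgebra.of x '' diagrams k n)).comap (reflectLinear n x) := by
    rw [Submodule.span_le]
    rintro _ ⟨d, hd, rfl⟩
    refine Submodule.subset_span ⟨reflect d, reflect_mem_diagrams hd, ?_⟩
    rw [reflectLinear_of]
  exact h ha

/-- The reflection as a linear map of the diagram algebra. -/
noncomputable def reflectAlg (k : Kind) (n : ℕ) (x : F) :
    DiagramAlg k n x →ₗ[F] DiagramAlg k n x where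
  toFun a := ⟨reflectLinear n x a.1, reflectLinear_mem a.2⟩
  map_add' a b := Subtype.ext (map_add (reflectLinear n x) a.1 b.1)
  map_smul' r a := Subtype.ext (map_smul (reflectLinear n x) r a.1)

theorem reflectAlg_diag {d : Setoid (Fin n ⊕ Fin n)} (hd : d ∈ diagrams k n) :
    reflectAlg k n x (diag x d hd) = diag x (reflect d) (reflect_mem_diagrams hd) :=
  Subtype.ext (reflectLinear_of d)

theorem reflectAlg_reflectAlg (a : DiagramAlg k n x) :
    reflectAlg k n x (reflectAlg k n x a) = a := by
  induction a using diag_induction with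
  | diag d hd =>
    rw [reflectAlg_diag, reflectAlg_diag]
    exact diag_congr _ (reflect_reflect d)
  | add a b ha hb => rw [map_add, map_add, ha, hb]
  | smul r a ha => rw [map_smul, map_smul, ha]

/-- Being an anti-automorphism that preserves every `arcIdeal`, the reflection turns statements on
left annihilation into statements on right annihilation. -/
theorem reflectAlg_mul (a b : DiagramAlg k n x) :
    reflectAlg k n x (a * b) = reflectAlg k n x b * reflectAlg k n x a := by
  induction a using diag_induction with
  | diag d hd =>
    induction b using diag_induction with
    | diag e he =>
      rw [diag_mul_diag, map_smul, reflectAlg_diag, reflectAlg_diag, reflectAlg_diag, diag_mul_diag,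
        innerComponents_reflect]
      congr 1
      exact diag_congr _ (comp_reflect d e).symm
    | add a b ha hb => rw [mul_add, map_add, map_add, add_mul, ha, hb]
    | smul r a ha => rw [mul_smul_comm, map_smul, map_smul, smul_mul_assoc, ha]
  | add a b ha hb => rw [add_mul, map_add, map_add, mul_add, ha, hb]
  | smul r a ha => rw [smul_mul_assoc, map_smul, map_smul, mul_smul_comm, ha]

theorem reflectAlg_one : reflectAlg k n x 1 = 1 := by
  rw [← diag_straight straight_mem_diagrams, reflectAlg_diag]
  exact diag_congr _ (reflect_permDiagram (Equiv.refl _))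

theorem reflectAlg_pow (a : DiagramAlg k n x) (i : ℕ) :
    reflectAlg k n x (a ^ i) = reflectAlg k n x a ^ i := by
  induction i with
  | zero => rw [pow_zero, pow_zero, reflectAlg_one]
  | succ i ih => rw [pow_succ, reflectAlg_mul, ih, pow_succ']

theorem reflectAlg_mem_arcIdeal {m : ℕ} {a : DiagramAlg k n x} (ha : a ∈ arcIdeal k n x m) :
    reflectAlg k n x a ∈ arcIdeal k n x m := by
  have h1 := TwoSidedIdeal.mem_asIdeal.1 ha
  clear ha
  rw [TwoSidedIdeal.mem_span_iff_mem_addSubgroup_closure] at h1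
  induction h1 using AddSubgroup.closure_induction with
  | mem a h =>
    obtain ⟨_, ⟨b, -, _, ⟨d, hd, hlt, rfl⟩, rfl⟩, c, -, rfl⟩ := h
    rw [reflectAlg_mul, reflectAlg_mul, reflectAlg_diag]
    refine Ideal.mul_mem_left _ _ (Ideal.mul_mem_right _ _ (diag_mem_arcIdeal _ ?_))
    rwa [verticalArcs_reflect]
  | zero => rw [map_zero]; exact zero_mem _
  | add a b _ _ h1 h2 =>
    rw [map_add]
    exact add_mem h1 h2
  | neg a _ h =>
    rw [map_neg]
    exact neg_mem h

end

end DiagramAlgebra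

namespace DiagramAlgebra

/-! ### Homomorphisms out of `M(ν)` -/

section

open scoped TensorProduct

variable {F : Type*} [Field F] {k : Kind} {n : ℕ} {x : F}

noncomputable instance moduleCellModule (ν : YoungDiagram) (h : ν.card ≤ n) :
    Module F (CellModule k x ν h) :=
  inferInstanceAs (Module F (TensorModule k n x ν ⧸ tensorRelations k x ν h))

instance isScalarTower_cellModule (ν : YoungDiagram) (h : ν.card ≤ n) :
    IsScalarTower F (DiagramAlg k n x) (CellModule k x ν h) :=
  inferInstanceAs (IsScalarTower F (DiagramAlg k n x)
    (TensorModule k n x ν ⧸ tensorRelations k x ν h))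

/-- The class of a pure tensor. -/
noncomputable def cellMk {ν : YoungDiagram} (h : ν.card ≤ n) (p : LoopModule k n x ν.card)
    (s : SpechtModule F ν) : CellModule k x ν h :=
  (tensorRelations k x ν h).mkQ (p ⊗ₜ[F] s)

theorem cellModule_induction {ν : YoungDiagram} {h : ν.card ≤ n}
    {motive : CellModule k x ν h → Prop} (w : CellModule k x ν h)
    (zero : motive 0) (mk : ∀ p s, motive (cellMk h p s))
    (add : ∀ v w, motive v → motive w → motive (v + w)) : motive w := by
  obtain ⟨w, rfl⟩ := (tensorRelations k x ν h).mkQ_surjective w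
  induction w using TensorProduct.induction_on with
  | zero => rw [map_zero]; exact zero
  | tmul p s => exact mk p s
  | add v w hv hw => rw [map_add]; exact add _ _ hv hw

theorem smul_cellMk {ν : YoungDiagram} {h : ν.card ≤ n} (a : DiagramAlg k n x)
    (p : LoopModule k n x ν.card) (s : SpechtModule F ν) :
    a • cellMk h p s = cellMk h (a • p) s := rfl

theorem cellMk_add_right {ν : YoungDiagram} {h : ν.card ≤ n} (p : LoopModule k n x ν.card)
    (s t : SpechtModule F ν) : cellMk h p (s + t) = cellMk h p s + cellMk h p t := by
  unfold cellMk
  rw [TensorProduct.tmul_add, map_add]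
  rfl

theorem cellMk_smul {ν : YoungDiagram} {h : ν.card ≤ n} (r : F) (p : LoopModule k n x ν.card)
    (s : SpechtModule F ν) : cellMk h (r • p) s = cellMk h p (r • s) := by
  unfold cellMk
  rw [TensorProduct.smul_tmul]

theorem cellMk_zero_right {ν : YoungDiagram} {h : ν.card ≤ n} (p : LoopModule k n x ν.card) :
    cellMk h p (0 : SpechtModule F ν) = 0 := by
  unfold cellMk
  rw [TensorProduct.tmul_zero, map_zero]
  rfl

theorem cellMk_perm {ν : YoungDiagram} {h : ν.card ≤ n} {p q : LoopModule k n x ν.card}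
    {σ : Equiv.Perm (Fin ν.card)}
    (hq : (q.1 : DiagramAlg k n x ⧸ arcIdeal k n x ν.card) =
      p.1 * Ideal.Quotient.mk (arcIdeal k n x ν.card) (permElt k x h σ)) (s : SpechtModule F ν) :
    cellMk h q s =
      cellMk h p ((MonoidAlgebra.single σ 1 : MonoidAlgebra F (Equiv.Perm (Fin ν.card))) • s) := by
  refine (Submodule.Quotient.eq _).2 (Submodule.subset_span ?_)
  exact ⟨p, q, σ, s, hq, rfl⟩

/-- The class of `loopElt`. -/
noncomputable def loopGen (k : Kind) (n : ℕ) {x : F} (hx : x ≠ 0) (m : ℕ) : LoopModule k n x m :=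
  ⟨Ideal.Quotient.mk (arcIdeal k n x m) (loopElt k n x m), by
    -- Membership in `loopIdeal` asks for a left factor in the ideal: with e = `loopElt k n x m` and
    -- e² = ce, the factor c⁻¹e works.
    obtain ⟨c, hc, h⟩ := exists_loopElt_mul_loopElt (k := k) (n := n) hx m
    refine ⟨c⁻¹ • loopElt k n x m, ?_, ?_⟩
    · rw [Algebra.smul_def]
      exact Ideal.mul_mem_left _ _ (loopElt_mem_arcIdeal m)
    · change Ideal.Quotient.mk (arcIdeal k n x m) ((c⁻¹ • loopElt k n x m) * loopElt k n x m) = _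
      rw [smul_mul_assoc, h, smul_smul, inv_mul_cancel₀ hc, one_smul]⟩

theorem exists_smul_loopGen (hx : x ≠ 0) {m : ℕ} (p : LoopModule k n x m) :
    ∃ a : DiagramAlg k n x, p = a • loopGen k n hx m := by
  obtain ⟨p, a, -, rfl⟩ := p
  exact ⟨a, rfl⟩

section hom

variable {Q : Type*} [AddCommGroup Q] [Module F Q] [Module (DiagramAlg k n x) Q]
  [IsScalarTower F (DiagramAlg k n x) Q]

/-- The action of a quotient by an annihilating ideal. -/
noncomputable def quotientAction {m : ℕ} (hQ : ∀ a ∈ arcIdeal k n x m, ∀ q : Q, a • q = 0) :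
    (DiagramAlg k n x ⧸ arcIdeal k n x m) →ₗ[DiagramAlg k n x] Q →ₗ[F] Q :=
  have := IsScalarTower.to_smulCommClass (R := F) (A := DiagramAlg k n x) (M := Q)
  Submodule.liftQ (arcIdeal k n x m)
    (LinearMap.toSpanSingleton (DiagramAlg k n x) (Q →ₗ[F] Q) LinearMap.id)
    (fun a ha => LinearMap.ext fun q => hQ a ha q)

theorem quotientAction_mk {m : ℕ} (hQ : ∀ a ∈ arcIdeal k n x m, ∀ q : Q, a • q = 0)
    (a : DiagramAlg k n x) (q : Q) :
    quotientAction hQ (Ideal.Quotient.mk (arcIdeal k n x m) a) q = a • q := rfl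

/-- Tensor–hom adjunction: the class of a acts on θ(s) because the smaller ideal kills `Q`, and
equivariance of `θ` respects the relations pσ ⊗ s = p ⊗ σs. -/
theorem exists_hom (hx : x ≠ 0) {ν : YoungDiagram} (h : ν.card ≤ n)
    (hQ : ∀ a ∈ arcIdeal k n x ν.card, ∀ q : Q, a • q = 0) (θ : SpechtModule F ν →ₗ[F] Q)
    (hθ : ∀ (σ : Equiv.Perm (Fin ν.card)) s,
      θ ((MonoidAlgebra.single σ 1 : MonoidAlgebra F (Equiv.Perm (Fin ν.card))) • s) =
        permElt k x h σ • θ s) :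
    ∃ φ : CellModule k x ν h →ₗ[DiagramAlg k n x] Q,
      ∀ s, φ (cellMk h (loopGen k n hx ν.card) s) = loopElt k n x ν.card • θ s := by
  have := IsScalarTower.to_smulCommClass (R := F) (A := DiagramAlg k n x) (M := Q)
  let B : LoopModule k n x ν.card →ₗ[DiagramAlg k n x] SpechtModule F ν →ₗ[F] Q :=
    { toFun := fun p => (quotientAction hQ p.1).comp θ
      map_add' := fun p q => by
        change (quotientAction hQ (p.1 + q.1)).comp θ = _
        rw [map_add, LinearMap.add_comp]
      map_smul' := fun a p => by
        change (quotientAction hQ (a • p.1)).comp θ = _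
        rw [map_smul]
        rfl }
  let f : TensorModule k n x ν →ₗ[DiagramAlg k n x] Q := TensorProduct.AlgebraTensorModule.lift B
  have hf : tensorRelations k x ν h ≤ LinearMap.ker f := by
    refine Submodule.span_le.2 ?_
    rintro _ ⟨p, q, σ, s, hq, rfl⟩
    change f _ = 0
    rw [map_sub, sub_eq_zero]
    change quotientAction hQ q.1 (θ s) = quotientAction hQ p.1 (θ _)
    obtain ⟨a, ha⟩ := Ideal.Quotient.mk_surjective p.1
    rw [hq, hθ, ← ha, ← map_mul, quotientAction_mk, quotientAction_mk, mul_smul]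
  exact ⟨(tensorRelations k x ν h).liftQ f hf, fun s => rfl⟩

/-- With e = `loopElt k n x m`, the w in the group algebra with e w y in the sum form a subspace. It
contains all a z b with z a Young symmetrizer, hence 1. -/
theorem loopElt_smul_mem [CharZero F] (hx : x ≠ 0) {m : ℕ} (hm : m ≤ n)
    (hQ : ∀ a ∈ arcIdeal k n x m, ∀ q : Q, a • q = 0) (y : Q) :
    loopElt k n x m • y ∈ ⨆ (ν : YoungDiagram) (h : ν.card = m)
      (φ : CellModule k x ν (h.le.trans hm) →ₗ[DiagramAlg k n x] Q), LinearMap.range φ := by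
  have := IsScalarTower.to_smulCommClass (R := F) (A := DiagramAlg k n x) (M := Q)
  set S := ⨆ (ν : YoungDiagram) (h : ν.card = m)
      (φ : CellModule k x ν (h.le.trans hm) →ₗ[DiagramAlg k n x] Q), LinearMap.range φ with hS
  let g : MonoidAlgebra F (Equiv.Perm (Fin m)) →ₗ[F] Q :=
    { toFun := fun w => loopElt k n x m • permAlg k x hm w • y
      map_add' := fun v w => by rw [map_add, add_smul, smul_add]
      map_smul' := fun r w => by
        rw [map_smul, smul_assoc]
        exact (smul_comm r (loopElt k n x m) (permAlg k x hm w • y)).symm }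
  let K : Submodule F (MonoidAlgebra F (Equiv.Perm (Fin m))) :=
    (S.restrictScalars F).comap g
  have h1 : (1 : MonoidAlgebra F (Equiv.Perm (Fin m))) ∈ K := by
    refine one_mem_of_symmetrizers_mem K fun ν h a b => ?_
    subst h
    have hfill : filling ν rfl = tableau ν := rfl
    rw [hfill]
    -- Right multiplication by `b` followed by the action on `y` commutes with left multiplication
    -- by permutations. The resulting map sends e ⊗ az to e(azb)y.
    let θ : SpechtModule F ν →ₗ[F] Q :=
      { toFun := fun s => permAlg k x hm (s.1 * b) • y
        map_add' := fun s t => by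
          change permAlg k x hm ((s.1 + t.1) * b) • y = _
          rw [add_mul, map_add, add_smul]
        map_smul' := fun r s => by
          change permAlg k x hm ((r • s.1) * b) • y = _
          rw [smul_mul_assoc, map_smul, smul_assoc, RingHom.id_apply] }
    obtain ⟨φ, hφ⟩ := exists_hom hx hm hQ θ (by
      intro σ s
      change permAlg k x hm ((MonoidAlgebra.single σ 1 * s.1) * b) • y =
        permElt k x hm σ • permAlg k x hm (s.1 * b) • y
      rw [mul_assoc, map_mul, permAlg_single, mul_smul])
    have hs : a * symmetrizer F (tableau ν) ∈ specht F ν := by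
      rw [specht_eq_span]
      exact Ideal.mul_mem_left _ _ (Submodule.subset_span rfl)
    let s : SpechtModule F ν := ⟨_, hs⟩
    have h2 : φ (cellMk hm (loopGen k n hx ν.card) s) ∈ S := by
      rw [hS]
      exact Submodule.mem_iSup_of_mem ν (Submodule.mem_iSup_of_mem rfl
        (Submodule.mem_iSup_of_mem φ ⟨_, rfl⟩))
    rw [hφ] at h2
    exact h2
  have h2 : loopElt k n x m • permAlg k x hm 1 • y ∈ S := h1
  rwa [map_one, one_smul] at h2

end hom

/-! ### Submodules of `M(ν)` -/

theorem permAlg_smul_cellMk (hx : x ≠ 0) {ν : YoungDiagram} {h : ν.card ≤ n}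
    (w : MonoidAlgebra F (Equiv.Perm (Fin ν.card))) (s : SpechtModule F ν) :
    permAlg k x h w • cellMk h (loopGen k n hx ν.card) s =
      cellMk h (loopGen k n hx ν.card) (w • s) := by
  induction w using MonoidAlgebra.induction_on with
  | of σ =>
    rw [MonoidAlgebra.of_apply, permAlg_single, smul_cellMk]
    refine cellMk_perm ?_ s
    change Ideal.Quotient.mk (arcIdeal k n x ν.card) (permElt k x h σ * loopElt k n x ν.card) =
      Ideal.Quotient.mk (arcIdeal k n x ν.card) (loopElt k n x ν.card * permElt k x h σ)
    rw [loopElt_mul_permElt]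
  | add v w hv hw => rw [map_add, add_smul, hv, hw, add_smul, cellMk_add_right]
  | smul r w hw =>
    rw [map_smul, smul_assoc, hw]
    have h1 : (r • w) • s = r • (w • s) := Subtype.ext (smul_mul_assoc r w s.1)
    rw [h1, ← cellMk_smul]
    rfl

/-- For e = `loopElt k n x ν.card`, modulo the smaller ideal eae = ew with w in the group algebra,
and w crosses the tensor sign. -/
theorem exists_loopElt_smul (hx : x ≠ 0) {ν : YoungDiagram} {h : ν.card ≤ n}
    (w : CellModule k x ν h) :
    ∃ s, loopElt k n x ν.card • w = cellMk h (loopGen k n hx ν.card) s := by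
  induction w using cellModule_induction with
  | zero => exact ⟨0, by rw [smul_zero, cellMk_zero_right]⟩
  | mk p s =>
    obtain ⟨a, rfl⟩ := exists_smul_loopGen hx p
    obtain ⟨w, hw⟩ := exists_loopElt_mul_mul_loopElt h a
    refine ⟨w • s, ?_⟩
    rw [← permAlg_smul_cellMk, smul_cellMk, smul_cellMk]
    congr 1
    refine Subtype.ext ?_
    change Ideal.Quotient.mk (arcIdeal k n x ν.card)
        (loopElt k n x ν.card * (a * loopElt k n x ν.card)) =
      Ideal.Quotient.mk (arcIdeal k n x ν.card) (permAlg k x h w * loopElt k n x ν.card)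
    rw [Ideal.Quotient.eq, ← mul_assoc, ← loopElt_mul_permAlg]
    exact hw
  | add v w hv hw =>
    obtain ⟨s, hs⟩ := hv
    obtain ⟨t, ht⟩ := hw
    exact ⟨s + t, by rw [smul_add, hs, ht, cellMk_add_right]⟩

/-- The ideal consists of sums of products with `loopElt` in the middle, so if `loopElt` killed
every multiple of `q`, the ideal would kill `q`. -/
theorem exists_loopElt_smul_ne_zero (hx : x ≠ 0) {Q : Type*} [AddCommGroup Q]
    [Module (DiagramAlg k n x) Q] {m : ℕ} (hm : m ≤ n) {a : DiagramAlg k n x}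
    (ha : a ∈ arcIdeal k n x (m + 1)) {q : Q} (h0 : a • q ≠ 0) :
    ∃ b : DiagramAlg k n x, loopElt k n x m • b • q ≠ 0 := by
  by_contra! h
  refine h0 ?_
  have h1 := mem_closure_of_mem_arcIdeal hx hm ha
  clear ha h0
  induction h1 using AddSubmonoid.closure_induction with
  | mem a ha =>
    obtain ⟨⟨b, c⟩, rfl⟩ := ha
    change (b * loopElt k n x m * c) • q = 0
    rw [mul_smul, mul_smul, h, smul_zero]
  | zero => exact zero_smul _ _
  | add a b _ _ ha hb => rw [add_smul, ha, hb, add_zero]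

/-- A vector outside `N(ν)` generates `M(ν)`. -/
theorem eq_top_of_notMem_cellRadical [CharZero F] (hx : x ≠ 0) {ν : YoungDiagram} {h : ν.card ≤ n}
    (U : Submodule (DiagramAlg k n x) (CellModule k x ν h)) {w : CellModule k x ν h} (hw : w ∈ U)
    (hw' : w ∉ cellRadical k x ν h) : U = ⊤ := by
  have h1 : ∃ a ∈ arcIdeal k n x (ν.card + 1), a • w ≠ 0 := by
    by_contra! h1
    exact hw' h1
  obtain ⟨a, ha, ha0⟩ := h1
  -- The submodule `U` thus contains some e ⊗ s with s ≠ 0. As s generates the Specht module and e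
  -- generates `LoopModule`, this vector generates everything.
  obtain ⟨b, hb⟩ := exists_loopElt_smul_ne_zero hx h ha ha0
  obtain ⟨s, hs⟩ := exists_loopElt_smul hx (b • w)
  have hs0 : s ≠ 0 := by
    rintro rfl
    exact hb (hs.trans (cellMk_zero_right _))
  have hsU : cellMk h (loopGen k n hx ν.card) s ∈ U := by
    rw [← hs]
    exact U.smul_mem _ (U.smul_mem _ hw)
  rw [eq_top_iff]
  rintro v -
  induction v using cellModule_induction with
  | zero => exact U.zero_mem
  | mk p t =>
    obtain ⟨c, rfl⟩ := exists_smul_loopGen hx p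
    obtain ⟨y, rfl⟩ := exists_smul_eq_of_spechtModule hs0 t
    rw [← smul_cellMk, ← permAlg_smul_cellMk]
    exact U.smul_mem _ (U.smul_mem _ hsU)
  | add v w hv hw => exact U.add_mem hv hw

end

end DiagramAlgebra

namespace DiagramAlgebra

/-! ### Semisimplicity -/

theorem isSemisimpleModule_iSup {R M : Type*} {ι : Sort*} [Ring R] [AddCommGroup M] [Module R M]
    (p : ι → Submodule R M) (hp : ∀ i, IsSemisimpleModule R (p i)) :
    IsSemisimpleModule R ↥(⨆ i, p i) := by
  have h := isSemisimpleModule_biSup_of_isSemisimpleModule_submodule (s := Set.range p)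
    (p := fun q : Submodule R M => q) (by rintro _ ⟨i, rfl⟩; exact hp i)
  rwa [iSup_range] at h

section

variable {F : Type*} [Field F] {k : Kind} {n : ℕ} {x : F}

instance isArtinianRing_diagramAlg : IsArtinianRing (DiagramAlg k n x) :=
  IsArtinianRing.of_finite F (DiagramAlg k n x)

/-- The radical of an Artinian ring is nilpotent. Writing * for the reflection, ry* is nilpotent,
hence so is its reflection yr*, and yr* + 1 is invertible for every y. -/
theorem reflectAlg_mem_jacobson {r : DiagramAlg k n x}
    (hr : r ∈ Ring.jacobson (DiagramAlg k n x)) :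
    reflectAlg k n x r ∈ Ring.jacobson (DiagramAlg k n x) := by
  rw [← Ideal.jacobson_bot, Ideal.mem_jacobson_iff]
  intro y
  obtain ⟨N, hN⟩ := IsSemiprimaryRing.isNilpotent (R := DiagramAlg k n x)
  have h1 : r * reflectAlg k n x y ∈ Ring.jacobson (DiagramAlg k n x) :=
    Ideal.mul_mem_right _ _ hr
  have h2 : (r * reflectAlg k n x y) ^ N = 0 := by
    have := Ideal.pow_mem_pow h1 N
    rwa [hN] at this
  have h3 : (y * reflectAlg k n x r) ^ N = 0 := by
    have := congrArg (reflectAlg k n x) h2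
    rwa [reflectAlg_pow, reflectAlg_mul, reflectAlg_reflectAlg, map_zero] at this
  have hnil : IsNilpotent (y * reflectAlg k n x r) := ⟨N, h3⟩
  obtain ⟨u, hu⟩ := hnil.isUnit_add_one
  refine ⟨(u⁻¹ : (DiagramAlg k n x)ˣ), ?_⟩
  rw [Submodule.mem_bot, sub_eq_zero]
  calc ((u⁻¹ : (DiagramAlg k n x)ˣ) : DiagramAlg k n x) * y * reflectAlg k n x r +
        ((u⁻¹ : (DiagramAlg k n x)ˣ) : DiagramAlg k n x)
      = ((u⁻¹ : (DiagramAlg k n x)ˣ) : DiagramAlg k n x) * (y * reflectAlg k n x r + 1) := by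
        rw [mul_add, mul_assoc, mul_one]
    _ = 1 := by rw [← hu, Units.inv_mul]

/-- Every nonzero vector generates the module, so its only submodules are zero and the whole. -/
theorem isSemisimpleModule_cellModule [CharZero F] (hx : x ≠ 0) {ν : YoungDiagram} {h : ν.card ≤ n}
    (hN : cellRadical k x ν h = ⊥) :
    IsSemisimpleModule (DiagramAlg k n x) (CellModule k x ν h) := by
  rw [isSemisimpleModule_iff]
  refine ⟨fun U => ?_⟩
  by_cases hU : U = ⊥
  · exact ⟨⊤, hU ▸ isCompl_bot_top⟩
  · obtain ⟨w, hw, hw0⟩ := (Submodule.ne_bot_iff U).1 hU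
    have hUtop := eq_top_of_notMem_cellRadical hx U hw (by
      rw [hN]
      exact hw0)
    exact ⟨⊥, hUtop ▸ isCompl_top_bot⟩

/-- If all the modules `N(ν)` vanish, then the algebra is semisimple. -/
theorem isSemisimpleRing_of_cellRadical_eq_bot [CharZero F] (hx : x ≠ 0)
    (hN : ∀ (ν : YoungDiagram) (h : ν.card ≤ n), cellRadical k x ν h = ⊥) :
    IsSemisimpleRing (DiagramAlg k n x) := by
  classical
  rw [IsArtinianRing.isSemisimpleRing_iff_jacobson, eq_bot_iff]
  intro r₀ hr₀
  by_contra hne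
  -- The least such index is positive, say m + 1: the radical meets J(m + 1), but not J(m), in a
  -- nonzero element.
  have hex : ∃ m, ∃ r ∈ Ring.jacobson (DiagramAlg k n x), r ∈ arcIdeal k n x m ∧ r ≠ 0 :=
    ⟨n + 1, r₀, hr₀, by rw [arcIdeal_top]; trivial, hne⟩
  obtain ⟨r, hr, hrm, hr0⟩ := Nat.find_spec hex
  have hmin : ∀ m < Nat.find hex, ∀ r ∈ Ring.jacobson (DiagramAlg k n x), r ∈ arcIdeal k n x m →
      r = 0 := by
    intro m hm r h1 h2
    by_contra h3
    exact Nat.find_min hex hm ⟨r, h1, h2, h3⟩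
  have hle : Nat.find hex ≤ n + 1 :=
    Nat.find_min' hex ⟨r₀, hr₀, by rw [arcIdeal_top]; trivial, hne⟩
  have hpos : Nat.find hex ≠ 0 := by
    intro h0
    rw [h0, arcIdeal_zero] at hrm
    exact hr0 hrm
  obtain ⟨m, hm⟩ := Nat.exists_eq_succ_of_ne_zero hpos
  rw [hm] at hrm hmin hle
  have hmn : m ≤ n := Nat.succ_le_succ_iff.1 hle
  let Q := DiagramAlg k n x ⧸ arcIdeal k n x m
  let π : DiagramAlg k n x →ₗ[DiagramAlg k n x] Q := (arcIdeal k n x m).mkQ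
  have hπ : ∀ a, π a = 0 ↔ a ∈ arcIdeal k n x m := fun a => Submodule.Quotient.mk_eq_zero _
  have hQ : ∀ a ∈ arcIdeal k n x m, ∀ q : Q, a • q = 0 := by
    intro a ha q
    obtain ⟨b, rfl⟩ := Submodule.mkQ_surjective _ q
    exact (hπ (a * b)).2 (Ideal.mul_mem_right _ _ ha)
  -- `S` is semisimple, as a sum of images of modules M(ν), and contains the image of J(m + 1) in A
  -- / J(m).
  set S := ⨆ (ν : YoungDiagram) (h : ν.card = m)
      (φ : CellModule k x ν (h.le.trans hmn) →ₗ[DiagramAlg k n x] Q), LinearMap.range φ with hS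
  have hSs : IsSemisimpleModule (DiagramAlg k n x) S := by
    refine isSemisimpleModule_iSup _ fun ν => isSemisimpleModule_iSup _ fun h =>
      isSemisimpleModule_iSup _ fun φ => ?_
    have := isSemisimpleModule_cellModule hx (hN ν (h.le.trans hmn))
    exact IsSemisimpleModule.range φ
  have hmem : ∀ a ∈ arcIdeal k n x (m + 1), π a ∈ S := by
    intro a ha
    have h1 := mem_closure_of_mem_arcIdeal hx hmn ha
    clear ha
    induction h1 using AddSubmonoid.closure_induction with
    | mem a h =>
      obtain ⟨⟨b, c⟩, rfl⟩ := h
      have : π (b * loopElt k n x m * c) = b • loopElt k n x m • π c := by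
        rw [mul_assoc]
        rfl
      change π (b * loopElt k n x m * c) ∈ S
      rw [this]
      exact S.smul_mem _ (loopElt_smul_mem hx hmn hQ _)
    | zero => rw [map_zero]; exact zero_mem _
    | add a b _ _ ha hb => rw [map_add]; exact add_mem ha hb
  -- The radical kills `S`, so its product with J(m + 1) lies in J(m), where the radical has only
  -- zero. The reflection then gives the product in the other order.
  have hann : ∀ s ∈ Ring.jacobson (DiagramAlg k n x), ∀ a ∈ arcIdeal k n x (m + 1),
      s * a = 0 := by
    intro s hs a ha
    have h1 := IsSemisimpleModule.jacobson_le_annihilator (DiagramAlg k n x) S hs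
    have h2 := Module.mem_annihilator.1 h1 ⟨π a, hmem a ha⟩
    have h3 : π (s * a) = 0 := congrArg Subtype.val h2
    exact hmin m (Nat.lt_succ_self m) _ (Ideal.mul_mem_right _ _ hs) ((hπ _).1 h3)
  have hann' : ∀ s ∈ Ring.jacobson (DiagramAlg k n x), ∀ a ∈ arcIdeal k n x (m + 1),
      a * s = 0 := by
    intro s hs a ha
    have h1 := hann _ (reflectAlg_mem_jacobson hs) _ (reflectAlg_mem_arcIdeal ha)
    have h2 := congrArg (reflectAlg k n x) h1
    rwa [reflectAlg_mul, reflectAlg_reflectAlg, reflectAlg_reflectAlg, map_zero] at h2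
  -- Split off the part of `S` killed by J(m + 1). The image of `r` lies in `T`; it also lies in the
  -- complement `T'`, so `r` lies in J(m) and vanishes.
  let T : Submodule (DiagramAlg k n x) S :=
    { carrier := {v | ∀ a ∈ arcIdeal k n x (m + 1), a • v = 0}
      add_mem' := fun {v w} hv hw a ha => by rw [smul_add, hv a ha, hw a ha, add_zero]
      zero_mem' := fun a _ => smul_zero a
      smul_mem' := fun b v hv a ha => by
        rw [smul_smul]
        exact hv _ (Ideal.mul_mem_right _ _ ha) }
  obtain ⟨T', hT'⟩ := exists_isCompl T
  -- J(m + 1) maps `S` into `T'`, and J(m + 1) is its own square: bed = c⁻¹(be)(ed) whenever e² =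
  -- ce.
  have hmem' : ∀ a (ha : a ∈ arcIdeal k n x (m + 1)), (⟨π a, hmem a ha⟩ : S) ∈ T' := by
    intro a ha
    obtain ⟨c, hc, hcc⟩ := exists_loopElt_mul_loopElt (k := k) (n := n) hx m
    have key : ∀ a b, a ∈ arcIdeal k n x (m + 1) → ∀ hb : b ∈ arcIdeal k n x (m + 1),
        a • (⟨π b, hmem b hb⟩ : S) ∈ T' := by
      intro a b ha hb
      have h1 : (⟨π b, hmem b hb⟩ : S) ∈ T ⊔ T' := by rw [hT'.sup_eq_top]; trivial
      obtain ⟨t, ht, t', ht', h1⟩ := Submodule.mem_sup.1 h1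
      rw [← h1, smul_add, ht a ha, zero_add]
      exact T'.smul_mem _ ht'
    have h1 := mem_closure_of_mem_arcIdeal hx hmn ha
    have h2 : ∃ v ∈ T', v.1 = π a := by
      clear ha
      induction h1 using AddSubmonoid.closure_induction with
      | mem a h =>
        obtain ⟨⟨b, d⟩, rfl⟩ := h
        have hb : c⁻¹ • (b * loopElt k n x m) ∈ arcIdeal k n x (m + 1) := by
          rw [Algebra.smul_def]
          exact Ideal.mul_mem_left _ _ (Ideal.mul_mem_left _ _ (loopElt_mem_arcIdeal m))
        have hd : loopElt k n x m * d ∈ arcIdeal k n x (m + 1) :=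
          Ideal.mul_mem_right _ _ (loopElt_mem_arcIdeal m)
        refine ⟨_, key _ _ hb hd, ?_⟩
        change π (c⁻¹ • (b * loopElt k n x m) * (loopElt k n x m * d)) =
          π (b * loopElt k n x m * d)
        congr 1
        rw [smul_mul_assoc, mul_assoc b, ← mul_assoc (loopElt k n x m), hcc, smul_mul_assoc,
          mul_smul_comm, smul_smul, inv_mul_cancel₀ hc, one_smul, mul_assoc]
      | zero => exact ⟨0, T'.zero_mem, by rw [map_zero]; rfl⟩
      | add a b _ _ ha hb =>
        obtain ⟨v, hv, hva⟩ := ha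
        obtain ⟨w, hw, hwb⟩ := hb
        exact ⟨v + w, T'.add_mem hv hw, by rw [map_add, ← hva, ← hwb]; rfl⟩
    obtain ⟨v, hv, hva⟩ := h2
    have : v = ⟨π a, hmem a ha⟩ := Subtype.ext hva
    exact this ▸ hv
  have hrT : (⟨π r, hmem r hrm⟩ : S) ∈ T := by
    intro a ha
    refine Subtype.ext ?_
    change π (a * r) = 0
    rw [hann' r hr a ha, map_zero]
  have hzero := Submodule.disjoint_def.1 hT'.disjoint _ hrT (hmem' r hrm)
  exact hr0 (hmin m (Nat.lt_succ_self m) r hr ((hπ r).1 (congrArg Subtype.val hzero)))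

/-- Every simple module is a quotient `M(ν) / N(ν)`. -/
theorem exists_hom_of_isSimpleModule [CharZero F] (hx : x ≠ 0) {Q : Type*} [AddCommGroup Q]
    [Module F Q] [Module (DiagramAlg k n x) Q] [IsScalarTower F (DiagramAlg k n x) Q]
    [IsSimpleModule (DiagramAlg k n x) Q] :
    ∃ (ν : YoungDiagram) (h : ν.card ≤ n) (φ : CellModule k x ν h →ₗ[DiagramAlg k n x] Q),
      φ ≠ 0 ∧ LinearMap.ker φ = cellRadical k x ν h ∧
      ∃ a ∈ arcIdeal k n x (ν.card + 1), ∃ q : Q, a • q ≠ 0 := by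
  classical
  have hnt : Nontrivial Q := IsSimpleModule.nontrivial (DiagramAlg k n x) Q
  obtain ⟨q₀, hq₀⟩ := exists_ne (0 : Q)
  have htop : ∃ a ∈ arcIdeal k n x (n + 1), ∃ q : Q, a • q ≠ 0 :=
    ⟨1, by rw [arcIdeal_top]; trivial, q₀, by rwa [one_smul]⟩
  -- The least such index is m + 1, where m becomes |ν|: `Q` is a module annihilated by J(m) but not
  -- by J(m + 1).
  have hex : ∃ m, ∃ a ∈ arcIdeal k n x m, ∃ q : Q, a • q ≠ 0 := ⟨n + 1, htop⟩
  obtain ⟨a, ha, q, hq⟩ := Nat.find_spec hex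
  have hmin : ∀ m < Nat.find hex, ∀ a ∈ arcIdeal k n x m, ∀ q : Q, a • q = 0 := by
    intro m hm a h1 q
    by_contra h3
    exact Nat.find_min hex hm ⟨a, h1, q, h3⟩
  have hle : Nat.find hex ≤ n + 1 := Nat.find_min' hex htop
  have hpos : Nat.find hex ≠ 0 := by
    intro h0
    rw [h0, arcIdeal_zero] at ha
    rw [(Submodule.mem_bot _).1 ha, zero_smul] at hq
    exact hq rfl
  obtain ⟨m, hm⟩ := Nat.exists_eq_succ_of_ne_zero hpos
  rw [hm] at ha hmin hle
  have hmn : m ≤ n := Nat.succ_le_succ_iff.1 hle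
  obtain ⟨b, hb⟩ := exists_loopElt_smul_ne_zero hx hmn ha hq
  have h1 := loopElt_smul_mem hx hmn (hmin m (Nat.lt_succ_self m)) (b • q)
  obtain ⟨ν, h, φ, hφ⟩ : ∃ (ν : YoungDiagram) (h : ν.card = m)
      (φ : CellModule k x ν (h.le.trans hmn) →ₗ[DiagramAlg k n x] Q), φ ≠ 0 := by
    by_contra! hall
    refine hb ?_
    have : (⨆ (ν : YoungDiagram) (h : ν.card = m)
        (φ : CellModule k x ν (h.le.trans hmn) →ₗ[DiagramAlg k n x] Q), LinearMap.range φ) = ⊥ := by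
      refine eq_bot_iff.2 (iSup_le fun ν => iSup_le fun h => iSup_le fun φ => ?_)
      rw [hall ν h φ, LinearMap.range_zero]
    rw [this] at h1
    exact h1
  subst h
  refine ⟨ν, hmn, φ, hφ, le_antisymm ?_ ?_, a, ha, q, hq⟩
  -- A kernel vector outside N(ν) would generate M(ν) and force φ = 0.
  · intro w hw
    by_contra hw'
    exact hφ (LinearMap.ker_eq_top.1 (eq_top_of_notMem_cellRadical hx _ hw hw'))
  -- If φ(w) ≠ 0, then q = cφ(w) by simplicity, whence aq = φ(acw) = 0 for w in N(ν), contrary to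
  -- the choice of a and q.
  · intro w hw
    by_contra hw'
    have hspan := IsSimpleModule.span_singleton_eq_top (DiagramAlg k n x)
      (show φ w ≠ 0 from hw')
    have hq' : q ∈ Submodule.span (DiagramAlg k n x) {φ w} := by rw [hspan]; trivial
    obtain ⟨c, rfl⟩ := Submodule.mem_span_singleton.1 hq'
    refine hq ?_
    rw [smul_smul, ← map_smul, hw _ (Ideal.mul_mem_right _ _ ha), map_zero]

end

end DiagramAlgebra

/-! ### The exact sequence -/

theorem propositionP {F : Type*} [Field F] [CharZero F] (k : DiagramAlgebra.Kind) (n : ℕ)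
    (x : F) (hx : x ≠ 0)
    (hns : ¬ IsSemisimpleRing (DiagramAlgebra.DiagramAlg k n x)) :
    ∃ (lam mu : YoungDiagram) (hlam : lam.card ≤ n) (hmu : mu.card ≤ n),
      mu.card < lam.card ∧
      ∃ φ : DiagramAlgebra.CellModule k x lam hlam →ₗ[DiagramAlgebra.DiagramAlg k n x]
          DiagramAlgebra.CellModule k x mu hmu,
        φ ≠ 0 ∧ LinearMap.ker φ = DiagramAlgebra.cellRadical k x lam hlam := by
  open DiagramAlgebra in
  have hex : ∃ (mu : YoungDiagram) (hmu : mu.card ≤ n), cellRadical k x mu hmu ≠ ⊥ := by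
    by_contra! h
    exact hns (isSemisimpleRing_of_cellRadical_eq_bot hx h)
  obtain ⟨mu, hmu, hN⟩ := hex
  obtain ⟨w, hw, hw0⟩ := (Submodule.ne_bot_iff _).1 hN
  -- A cyclic module over an Artinian ring is Artinian, so a simple submodule exists inside `P`,
  -- hence inside N(μ).
  set P := Submodule.span (DiagramAlgebra.DiagramAlg k n x) {w} with hP
  have hPN : P ≤ DiagramAlgebra.cellRadical k x mu hmu :=
    (Submodule.span_singleton_le_iff_mem _ _).2 hw
  have hPa : IsArtinian (DiagramAlgebra.DiagramAlg k n x) P :=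
    isArtinian_span_of_finite _ (Set.finite_singleton w)
  have hPn : Nontrivial P :=
    ⟨⟨w, Submodule.mem_span_singleton_self w⟩, 0, fun h => hw0 (congrArg Subtype.val h)⟩
  obtain ⟨L, hL⟩ := IsAtomic.exists_atom (Submodule (DiagramAlgebra.DiagramAlg k n x) P)
  have hLs : IsSimpleModule (DiagramAlgebra.DiagramAlg k n x) L := isSimpleModule_iff_isAtom.2 hL
  obtain ⟨lam, hlam, φ, hφ, hker, a, ha, q, hq⟩ :=
    DiagramAlgebra.exists_hom_of_isSimpleModule (F := F) (k := k) (n := n) hx (Q := L)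
  have hinj : Function.Injective (P.subtype ∘ₗ L.subtype) :=
    P.injective_subtype.comp L.injective_subtype
  refine ⟨lam, mu, hlam, hmu, ?_, (P.subtype ∘ₗ L.subtype) ∘ₗ φ, ?_, ?_⟩
  -- If |λ| ≤ |μ|, the element `a` would lie in J(|μ| + 1), which kills N(μ) and so `q`.
  · by_contra! hle
    refine hq (hinj ?_)
    rw [map_smul, map_zero]
    exact hPN q.1.2 a (DiagramAlgebra.arcIdeal_mono (Nat.succ_le_succ hle) ha)
  · intro h
    refine hφ (LinearMap.ext fun v => hinj ?_)
    rw [LinearMap.zero_apply, map_zero]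
    exact LinearMap.congr_fun h v
  · rw [LinearMap.ker_comp_of_ker_eq_bot _ (LinearMap.ker_eq_bot.2 hinj), hker]
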